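/- **Setting.** Let $\alpha>0$, $\gamma\ge 0$, $\omega\in\mathbb R$, $\rho\in(0,1)$, $\nu\in[0,1]$, $M>0$. Let $E^{\gamma}_{\alpha,\mu}(z)=\sum_{k\ge0}\frac{(\gamma)_k}{\Gamma(\alpha k+\mu)}\frac{z^k}{k!}$ be the three-parameter Mittag-Leffler function (with $1/\Gamma=0$ at the poles of $\Gamma$), let $$\mathcal I^{\gamma}_{\alpha,\mu,\omega,0^+}u(t)=\int_0^t(t-\tau)^{\mu-1}E^{\gamma}_{\alpha,\mu}(\omega(t-\tau)^\alpha)u(\tau)\,d\tau$$ be the Prabhakar integral ($\mathcal I^{0}_{\alpha,0,\omega,0^+}$ being the identity), and let $$\mathcal D^{\gamma,\rho,\nu}_{\alpha,\omega,0^+}u=\mathcal I^{-\gamma\nu}_{\alpha,\nu(1-\rho),\omega,0^+}\,\frac{d}{dt}\,\mathcal I^{-\gamma(1-\nu)}_{\alpha,(1-\nu)(1-\rho),\omega,0^+}u$$ be the Hilfer-Prabhakar derivative. Let $g:\mathbb R\to\mathbb C$ be continuous and integrable, with integrable Fourier transform $g^*(k)=\int_{-\infty}^\infty g(x)e^{ikx}\,dx$.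 Consider the problem, for $x\in\mathbb R$ and $t>0$, $$\mathcal D^{\gamma,\rho,\nu}_{\alpha,\omega,0^+}\psi(x,t)=M\,\frac{\partial^2}{\partial x^2}\psi(x,t),\qquad \mathcal I^{-\gamma(1-\nu)}_{\alpha,(1-\nu)(1-\rho),\omega,0^+}\psi(x,t)\Big|_{t=0^+}=g(x),\qquad \lim_{x\to\infty}\psi(x,t)=0 .$$ A *solution* is a function $\psi:\mathbb R\times(0,\infty)\to\mathbb C$ satisfying these three conditions pointwise, such that - $\psi$ is integrable on $\mathbb R\times(0,T]$ for every $T>0$; $\psi(\cdot,t)$ is $C^2$ for every $t>0$; and $\partial_x^2\psi$ is integrable on $[-R,R]\times(0,T]$ for all $R,T>0$; - for every $x$, $\psi(x,\cdot)$ is integrable on $(0,b]$ for every $b>0$; the function $F=\mathcal I^{-\gamma(1-\nu)}_{\alpha,(1-\nu)(1-\rho),\omega,0^+}\psi(x,\cdot)$ is differentiable on $(0,\infty)$ and extends to an absolutely continuous function on $[0,b]$ for every $b>0$; and the integrals defining $F(t)$ and $\mathcal I^{-\gamma\nu}_{\alpha,\nu(1-\rho),\omega,0^+}F'(t)$ converge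 absolutely for every $t>0$. **Theorem.** The problem has exactly one solution, namely $$\psi(x,t)=\frac1{2\pi}\int_{-\infty}^{\infty}e^{-ikx}\sum_{n=0}^{\infty}g^*(k)\,(-Mk^2)^n\,t^{\rho(n+1)+\nu(1-\rho)-1}\,E^{\gamma(n+1-\nu)}_{\alpha,\rho(n+1)+\nu(1-\rho)}(\omega t^\alpha)\,dk ,\qquad x\in\mathbb R,\ t>0,$$ where for every $t>0$ the series converges absolutely for every $k\in\mathbb R$ and its sum is an integrable function of $k$. -/

import Mathlib

open MeasureTheory Filter Topology Set

noncomputable section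

namespace HilferPrabhakar

/-- Fourier transform `g*(k) = ∫ g(x) e^{ikx} dx`. -/
def fourierTransform (g : ℝ → ℂ) (k : ℝ) : ℂ :=
  ∫ x : ℝ, g x * Complex.exp (Complex.I * k * x)

/-- Inverse Fourier transform `(1/2π) ∫ h(k) e^{-ikx} dk`. -/
def inverseFourierTransform (h : ℝ → ℂ) (x : ℝ) : ℂ :=
  (1 / (2 * Real.pi) : ℂ) * ∫ k : ℝ, h k * Complex.exp (-Complex.I * k * x)

/-- Three-parameter Mittag-Leffler (Prabhakar) function
`E^γ_{α,μ}(z) = ∑ₖ (γ)ₖ / Γ(αk + μ) · z^k / k!`, with `1/Γ` equal to `0` at the poles of `Γ`. -/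
def mittagLeffler (α μ γ z : ℝ) : ℝ :=
  ∑' k : ℕ, (ascPochhammer ℝ k).eval γ / Real.Gamma (α * k + μ) * (z ^ k / (k.factorial : ℝ))

/-- The Prabhakar kernel `e^γ_{α,μ,ω}(t) = t^{μ-1} E^γ_{α,μ}(ω t^α)`. -/
def prabhakarKernel (α μ ω γ t : ℝ) : ℝ :=
  t ^ (μ - 1) * mittagLeffler α μ γ (ω * t ^ α)

/-- Prabhakar fractional integral `(I^γ_{α,μ,ω,0+} u)(t) = ∫₀ᵗ e^γ_{α,μ,ω}(t-τ) u(τ) dτ`.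
For order `μ = 0` the leading term `t^{μ-1}/Γ(μ)` of the kernel is the Dirac mass at `0`, which
contributes `u t`; in particular `I^0_{α,0,ω,0+}` is the identity. -/
def prabhakarIntegral (α μ ω γ : ℝ) (u : ℝ → ℂ) (t : ℝ) : ℂ :=
  (if μ = 0 then u t else 0) + ∫ τ in (0 : ℝ)..t, (prabhakarKernel α μ ω γ (t - τ) : ℂ) * u τ

/-- The integral defining `(I^γ_{α,μ,ω,0+} u)(t)` converges absolutely. -/
def PrabhakarIntegrable (α μ ω γ : ℝ) (u : ℝ → ℂ) (t : ℝ) : Prop :=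
  IntervalIntegrable (fun τ => (prabhakarKernel α μ ω γ (t - τ) : ℂ) * u τ) volume 0 t

/-- The inner integral `I^{-γ(1-ν)}_{α,(1-ν)(1-ρ),ω,0+} u`. -/
def innerIntegral (α ω γ ρ ν : ℝ) (u : ℝ → ℂ) : ℝ → ℂ :=
  prabhakarIntegral α ((1 - ν) * (1 - ρ)) ω (-γ * (1 - ν)) u

/-- Hilfer-Prabhakar derivative
`I^{-γν}_{α,ν(1-ρ),ω,0+} (d/dt) I^{-γ(1-ν)}_{α,(1-ν)(1-ρ),ω,0+} u`. -/
def hilferPrabhakarDeriv (α ω γ ρ ν : ℝ) (u : ℝ → ℂ) : ℝ → ℂ :=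
  prabhakarIntegral α (ν * (1 - ρ)) ω (-γ * ν) (deriv (innerIntegral α ω γ ρ ν u))

/-- The conditions on `u` under which the Hilfer-Prabhakar derivative is meaningful at every
`t > 0`: `u` is locally integrable on `[0, ∞)`, the inner integral is (for `t > 0`) absolutely
convergent, differentiable, and absolutely continuous on every `[0, b]` (once extended to `t = 0`),
and the outer integral converges. -/
structure HilferPrabhakarDifferentiable (α ω γ ρ ν : ℝ) (u : ℝ → ℂ) : Prop where
  locallyIntegrable : ∀ b : ℝ, 0 < b → IntervalIntegrable u volume 0 b
  inner_integrable : ∀ t : ℝ, 0 < t →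
    PrabhakarIntegrable α ((1 - ν) * (1 - ρ)) ω (-γ * (1 - ν)) u t
  inner_absolutelyContinuous : ∀ b : ℝ, 0 < b → ∃ f : ℝ → ℂ,
    AbsolutelyContinuousOnInterval f 0 b ∧ ∀ t ∈ Ioc 0 b, f t = innerIntegral α ω γ ρ ν u t
  inner_differentiable : ∀ t : ℝ, 0 < t → DifferentiableAt ℝ (innerIntegral α ω γ ρ ν u) t
  outer_integrable : ∀ t : ℝ, 0 < t →
    PrabhakarIntegrable α (ν * (1 - ρ)) ω (-γ * ν) (deriv (innerIntegral α ω γ ρ ν u)) t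

/-- `ψ` (with `ψ x t` the value at the point `x` and the time `t`) solves the fractional heat
equation `D^{γ,ρ,ν}_{α,ω,0+} ψ = M ∂ₓ² ψ` on `ℝ × (0, ∞)` with initial condition
`I^{-γ(1-ν)}_{α,(1-ν)(1-ρ),ω,0+} ψ(x, ·)|_{t=0+} = g x` and `ψ(x, t) → 0` as `x → ∞`.
The first two fields express that `ψ` can be Fourier transformed in `x`, as a function that is
locally integrable in time, and that `∂ₓ² ψ` is locally integrable on `ℝ × [0, ∞)`. -/
structure IsSolution (α ω γ ρ ν M : ℝ) (g : ℝ → ℂ) (ψ : ℝ → ℝ → ℂ) : Prop where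
  integrable : ∀ T : ℝ, 0 < T →
    IntegrableOn (fun p : ℝ × ℝ => ψ p.1 p.2) (univ ×ˢ Ioc 0 T) volume
  locallyIntegrable_dxx : ∀ R T : ℝ, 0 < R → 0 < T →
    IntegrableOn (fun p : ℝ × ℝ => iteratedDeriv 2 (fun y => ψ y p.2) p.1)
      (Icc (-R) R ×ˢ Ioc 0 T) volume
  contDiff : ∀ t : ℝ, 0 < t → ContDiff ℝ 2 (fun x => ψ x t)
  differentiable : ∀ x : ℝ, HilferPrabhakarDifferentiable α ω γ ρ ν (ψ x)
  equation : ∀ x t : ℝ, 0 < t →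
    hilferPrabhakarDeriv α ω γ ρ ν (ψ x) t = (M : ℂ) * iteratedDeriv 2 (fun y => ψ y t) x
  initial : ∀ x : ℝ, Tendsto (innerIntegral α ω γ ρ ν (ψ x)) (𝓝[>] 0) (𝓝 (g x))
  decay : ∀ t : ℝ, 0 < t → Tendsto (fun x => ψ x t) atTop (𝓝 0)

/-- The `n`-th term
`g*(k) (-M k²)^n t^{ρ(n+1)+ν(1-ρ)-1} E^{γ(n+1-ν)}_{α,ρ(n+1)+ν(1-ρ)}(ω t^α)`. -/
def seriesTerm (α ω γ ρ ν M : ℝ) (g : ℝ → ℂ) (t k : ℝ) (n : ℕ) : ℂ :=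
  fourierTransform g k *
    (((-M * k ^ 2) ^ n * t ^ (ρ * (n + 1) + ν * (1 - ρ) - 1) *
      mittagLeffler α (ρ * (n + 1) + ν * (1 - ρ)) (γ * (n + 1 - ν)) (ω * t ^ α) : ℝ) : ℂ)

/-- The inverse Fourier integral of the series. -/
def solution (α ω γ ρ ν M : ℝ) (g : ℝ → ℂ) (x t : ℝ) : ℂ :=
  inverseFourierTransform (fun k => ∑' n : ℕ, seriesTerm α ω γ ρ ν M g t k n) x

end HilferPrabhakar

end

noncomputable section

namespace HilferPrabhakar

/-! A Fourier transform in x splits the problem into scalar equations in t, one for each l = M k²,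
and a Laplace transform in t solves these. The Prabhakar kernel has transform s^{-μ}(1 - ω
s^{-α})^{-γ} (`prabhakarKernel_laplace`), so the series over n becomes geometric, and the time
factor `modeSeries` has transform A/(Φ + l) with Φ = s^ρ (1 - ω s^{-α})^γ and A = s^{-ν(1-ρ)} (1 - ω
s^{-α})^{γν} (`laplace_modeSeries`).

The difficulty is uniformity in l, because the transformed series is summed only to the right of an
abscissa that grows with l. The closed form A/(Φ + l), however, is holomorphic on one half-plane Re
s ≥ c for all l ≥ 0, since Re Φ > 0 there (`Admissible.symbol_re_pos`). Two derivatives in s make it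
absolutely integrable on vertical lines at the cost of a factor t² on the other side; the inversion
contour is then moved back to c (`modeSeries_eq_integral`), and the choice of c proportional to 1/t
gives bounds with the correct scaling in t and l (`modeSeries_bound`).

Existence. Multiplication of symbols shows that the inner integral of the mode is 1 - l ∫ m₀, where
m₀ is the mode with ν = 0, and that the outer integral carries m₀ to the mode with parameter ν
(`inner_mode_identity`, `outer_mode_identity`). The uniform bounds justify integrating these
identities against g*(k) e^{-ikx}. Integrability of the solution in x does not follow from bounds on
its Fourier transform. It comes from the resolvent: 1/(Φ + M k²) is the transform of an explicit
exponential kernel of L¹ norm at most 2/|Φ| (`resolvent_l1`), and this estimate is integrated along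
the inversion line (`solution_l1`).

Uniqueness. Convolution with the kernels of complementary order undoes both Prabhakar integrals up
to integration in time. For the difference φ of two solutions this leaves ∫₀ᵗ φ = M q * ∂ₓ²φ with q
a kernel of order 1 + ρ, hence bounded on bounded time intervals. Testing with cut-off characters
yields a homogeneous Volterra equation for the time primitive of each Fourier mode of φ, so φ(·, t)
= 0 for almost every t (`IntegratedEquation.ae_eq_zero`). The inner integrals are continuous in t
and therefore agree at every t. By the equation so do the second space derivatives, and the
remaining affine function of x is killed by the decay at infinity (`IsSolution.unique`). -/

/-! ### Laplace transform and causal convolution. -/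

/-- Causal convolution on `(0, ∞)`. -/
def causalConv (f g : ℝ → ℂ) (t : ℝ) : ℂ := ∫ τ in (0 : ℝ)..t, f (t - τ) * g τ

/-- Laplace transform. -/
def laplace (f : ℝ → ℂ) (s : ℂ) : ℂ := ∫ t in Ioi (0 : ℝ), Complex.exp (-(s * t)) * f t

/-- Functions on `(0, ∞)` that are continuous, `O(t^{a-1})` locally, and absolutely Laplace
transformable on `Re s ≥ c`. -/
structure LaplaceKernel (a c : ℝ) (f : ℝ → ℂ) : Prop where
  pos : 0 < a
  cont : ContinuousOn f (Ioi 0)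
  bound : ∀ T : ℝ, ∃ C : ℝ, 0 ≤ C ∧ ∀ t ∈ Ioc 0 T, ‖f t‖ ≤ C * t ^ (a - 1)
  integrable : IntegrableOn (fun t : ℝ => Complex.exp (-((c : ℂ) * t)) * f t) (Ioi 0)

theorem laplace_integrableOn {f : ℝ → ℂ} {c : ℝ} (hf : ContinuousOn f (Ioi 0))
    (h : IntegrableOn (fun t : ℝ => Complex.exp (-((c : ℂ) * t)) * f t) (Ioi 0)) {s : ℂ}
    (hs : c ≤ s.re) : IntegrableOn (fun t : ℝ => Complex.exp (-(s * t)) * f t) (Ioi 0) := by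
  refine Integrable.mono' h.norm ?_ ?_
  · refine ContinuousOn.aestronglyMeasurable ?_ measurableSet_Ioi
    exact (by fun_prop : Continuous fun t : ℝ => Complex.exp (-(s * t))).continuousOn.mul hf
  · refine (ae_restrict_iff' measurableSet_Ioi).2 (Eventually.of_forall fun t ht => ?_)
    rw [norm_mul, norm_mul, Complex.norm_exp, Complex.norm_exp]
    have : (0 : ℝ) < t := ht
    refine mul_le_mul_of_nonneg_right (Real.exp_le_exp.2 ?_) (norm_nonneg _)
    simp only [Complex.neg_re, Complex.mul_re, Complex.ofReal_re, Complex.ofReal_im, mul_zero,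
      sub_zero]
    nlinarith

/-- Cut at t/2: on each half only one of the two factors is singular, and the other is continuous.
-/
theorem intervalIntegrable_beta {a b : ℝ} (ha : 0 < a) (hb : 0 < b) (t : ℝ) (ht : 0 < t) :
    IntervalIntegrable (fun τ : ℝ => (t - τ) ^ (a - 1) * τ ^ (b - 1)) volume 0 t := by
  have h2 : (0:ℝ) ≤ t / 2 := by linarith
  have h3 : t / 2 ≤ t := by linarith
  refine IntervalIntegrable.trans (b := t / 2) ?_ ?_
  · refine (intervalIntegral.intervalIntegrable_rpow' (by linarith : -1 < b - 1)).continuousOn_mul ?_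
    refine ContinuousOn.rpow_const (by fun_prop) fun x hx => Or.inl ?_
    rw [uIcc_of_le h2] at hx
    linarith [hx.2]
  · have h := (intervalIntegral.intervalIntegrable_rpow' (a := 0) (b := t / 2)
      (by linarith : -1 < a - 1)).comp_sub_left t
    rw [sub_zero, show t - t / 2 = t / 2 by ring] at h
    refine h.symm.mul_continuousOn ?_
    refine ContinuousOn.rpow_const (by fun_prop) fun x hx => Or.inl ?_
    rw [uIcc_of_le h3] at hx
    linarith [hx.1]

theorem causalConv_integrable_of_bound {a b : ℝ} (ha : 0 < a) (hb : 0 < b) {f g : ℝ → ℂ}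
    (hf : ContinuousOn f (Ioi 0)) (hg : ContinuousOn g (Ioi 0)) {t Cf Cg : ℝ} (ht : 0 < t)
    (hfb : ∀ τ ∈ Ioc 0 t, ‖f τ‖ ≤ Cf * τ ^ (a - 1))
    (hgb : ∀ τ ∈ Ioc 0 t, ‖g τ‖ ≤ Cg * τ ^ (b - 1)) :
    IntervalIntegrable (fun τ => f (t - τ) * g τ) volume 0 t := by
  have h := (intervalIntegrable_beta ha hb t ht).const_mul (Cf * Cg)
  rw [intervalIntegrable_iff_integrableOn_Ioo_of_le ht.le] at h ⊢
  refine Integrable.mono' h ?_ ?_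
  · refine ContinuousOn.aestronglyMeasurable (ContinuousOn.mul ?_ ?_) measurableSet_Ioo
    · exact hf.comp (by fun_prop) fun x hx => by simpa using hx.2
    · exact hg.mono fun x hx => hx.1
  · refine (ae_restrict_iff' measurableSet_Ioo).2 (Eventually.of_forall fun τ hτ => ?_)
    rw [norm_mul]
    have h1 := hfb (t - τ) ⟨by linarith [hτ.2], by linarith [hτ.1]⟩
    have h2 := hgb τ ⟨hτ.1, hτ.2.le⟩
    calc _ ≤ (Cf * (t - τ) ^ (a - 1)) * (Cg * τ ^ (b - 1)) :=
          mul_le_mul h1 h2 (norm_nonneg _) ((norm_nonneg _).trans h1)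
      _ = _ := by ring

theorem LaplaceKernel.conv_integrable {a b c d : ℝ} {f g : ℝ → ℂ} (hf : LaplaceKernel a c f)
    (hg : LaplaceKernel b d g) {t : ℝ} (ht : 0 < t) :
    IntervalIntegrable (fun τ => f (t - τ) * g τ) volume 0 t := by
  obtain ⟨Cf, -, hCf⟩ := hf.bound t
  obtain ⟨Cg, -, hCg⟩ := hg.bound t
  exact causalConv_integrable_of_bound hf.pos hg.pos hf.cont hg.cont ht hCf hCg

/-- The substitution τ = tσ fixes the domain of integration, so that dependence on t can be treated
by dominated convergence. -/
theorem causalConv_eq_scaled (f g : ℝ → ℂ) (t : ℝ) :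
    causalConv f g t = t * ∫ σ in (0 : ℝ)..1, f (t * (1 - σ)) * g (t * σ) := by
  have h := intervalIntegral.smul_integral_comp_mul_left
    (fun τ => f (t - τ) * g τ) t (a := 0) (b := 1)
  rw [mul_zero, mul_one] at h
  rw [causalConv, ← h]
  simp [mul_sub]

theorem LaplaceKernel.mono {a c d : ℝ} {f : ℝ → ℂ} (hf : LaplaceKernel a c f) (h : c ≤ d) :
    LaplaceKernel a d f :=
  ⟨hf.pos, hf.cont, hf.bound, laplace_integrableOn hf.cont hf.integrable (by simpa using h)⟩

/-- After rescaling to [0, 1] the integrand is dominated by t^{a+b-2} times the Beta integrand;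
together with the Jacobian t this gives both the exponent a + b - 1 and, by dominated convergence,
continuity. -/
theorem causalConv_bound_continuousAt {a b : ℝ} (ha : 0 < a) (hb : 0 < b) {f g : ℝ → ℂ}
    (hf : ContinuousOn f (Ioi 0)) (hg : ContinuousOn g (Ioi 0)) {T Cf Cg : ℝ}
    (hfb : ∀ τ ∈ Ioc 0 T, ‖f τ‖ ≤ Cf * τ ^ (a - 1))
    (hgb : ∀ τ ∈ Ioc 0 T, ‖g τ‖ ≤ Cg * τ ^ (b - 1)) :
    ContinuousOn (causalConv f g) (Ioo 0 T) ∧ ∃ C, 0 ≤ C ∧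
      ∀ t ∈ Ioc 0 T, ‖causalConv f g t‖ ≤ C * t ^ (a + b - 1) := by
  have key : ∀ t ∈ Ioc 0 T, ∀ σ ∈ Ioo (0:ℝ) 1, ‖f (t * (1 - σ)) * g (t * σ)‖ ≤
      (Cf * Cg) * t ^ (a + b - 2) * ((1 - σ) ^ (a - 1) * σ ^ (b - 1)) := by
    intro t ht σ hσ
    have ht0 := ht.1
    have hs1 : 0 < 1 - σ := by linarith [hσ.2]
    have h1 := hfb (t * (1 - σ)) ⟨by positivity, by nlinarith [hσ.1, ht.2]⟩
    have h2 := hgb (t * σ) ⟨mul_pos ht.1 hσ.1, by nlinarith [hσ.2, hσ.1, ht.2]⟩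
    rw [norm_mul]
    refine (mul_le_mul h1 h2 (norm_nonneg _) ((norm_nonneg _).trans h1)).trans (le_of_eq ?_)
    rw [Real.mul_rpow ht0.le hs1.le, Real.mul_rpow ht0.le hσ.1.le,
      show a + b - 2 = (a - 1) + (b - 1) by ring, Real.rpow_add ht0]
    ring
  have hB := intervalIntegrable_beta ha hb 1 one_pos
  constructor
  · intro t0 ht0
    have hpos : 0 < t0 := ht0.1
    have hnear : ∀ᶠ t in 𝓝[Ioo 0 T] t0, t ∈ Ioc 0 T ∧ t ^ (a + b - 2) < t0 ^ (a + b - 2) + 1 := by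
      refine (eventually_mem_nhdsWithin.mono fun t ht => ⟨ht.1, ht.2.le⟩).and ?_
      have : ContinuousAt (fun t : ℝ => t ^ (a + b - 2)) t0 :=
        Real.continuousAt_rpow_const _ _ (Or.inl hpos.ne')
      exact (this.continuousWithinAt).eventually (gt_mem_nhds (by linarith))
    have hc : ContinuousWithinAt (fun t : ℝ => (t : ℂ) *
        ∫ σ in (0 : ℝ)..1, f (t * (1 - σ)) * g (t * σ)) (Ioo 0 T) t0 := by
      refine ContinuousWithinAt.mul (by fun_prop) ?_
      refine intervalIntegral.continuousWithinAt_of_dominated_interval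
        (bound := fun σ => |Cf * Cg| * (t0 ^ (a + b - 2) + 1) * ((1 - σ) ^ (a - 1) * σ ^ (b - 1)))
        ?_ ?_ (hB.const_mul _) ?_
      · filter_upwards [hnear] with t ht
        rw [uIoc_of_le zero_le_one, ← restrict_Ioo_eq_restrict_Ioc]
        refine ContinuousOn.aestronglyMeasurable (ContinuousOn.mul ?_ ?_) measurableSet_Ioo
        · refine hf.comp (by fun_prop) fun σ hσ => ?_
          exact mul_pos ht.1.1 (by linarith [hσ.2])
        · exact hg.comp (by fun_prop) fun σ hσ => mul_pos ht.1.1 hσ.1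
      · filter_upwards [hnear] with t ht
        -- The endpoint σ = 1 is discarded because f would be evaluated at 0, where neither its
        -- bound nor its continuity is available.
        filter_upwards [Measure.ae_ne volume (1:ℝ)] with σ hσ1 hσ
        rw [uIoc_of_le zero_le_one] at hσ
        have hσ' : σ ∈ Ioo (0:ℝ) 1 := ⟨hσ.1, lt_of_le_of_ne hσ.2 hσ1⟩
        refine (key t ht.1 σ hσ').trans ?_
        have h3 : 0 ≤ (1 - σ) ^ (a - 1) * σ ^ (b - 1) :=
          mul_nonneg (Real.rpow_nonneg (by linarith [hσ'.2]) _) (Real.rpow_nonneg hσ.1.le _)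
        refine mul_le_mul_of_nonneg_right ?_ h3
        exact mul_le_mul (le_abs_self _) ht.2.le (Real.rpow_nonneg ht.1.1.le _) (abs_nonneg _)
      · filter_upwards [Measure.ae_ne volume (1:ℝ)] with σ hσ1 hσ
        rw [uIoc_of_le zero_le_one] at hσ
        have hσ' : σ ∈ Ioo (0:ℝ) 1 := ⟨hσ.1, lt_of_le_of_ne hσ.2 hσ1⟩
        have hs1 : 0 < 1 - σ := by linarith [hσ'.2]
        refine ContinuousAt.continuousWithinAt (ContinuousAt.mul ?_ ?_)
        · exact ContinuousAt.comp (f := fun x => x * (1 - σ))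
            (hf.continuousAt (Ioi_mem_nhds (mul_pos hpos hs1))) (by fun_prop)
        · exact ContinuousAt.comp (f := fun x => x * σ)
            (hg.continuousAt (Ioi_mem_nhds (mul_pos hpos hσ'.1))) (by fun_prop)
    refine hc.congr (fun t _ => causalConv_eq_scaled f g t) (causalConv_eq_scaled f g t0)
  · have hBn : 0 ≤ ∫ σ in (0:ℝ)..1, ((1 - σ) ^ (a - 1) * σ ^ (b - 1)) :=
      intervalIntegral.integral_nonneg zero_le_one fun σ hσ =>
        mul_nonneg (Real.rpow_nonneg (by linarith [hσ.2]) _) (Real.rpow_nonneg hσ.1 _)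
    refine ⟨|Cf * Cg| * ∫ σ in (0:ℝ)..1, ((1 - σ) ^ (a - 1) * σ ^ (b - 1)), by positivity,
      fun t ht => ?_⟩
    rw [causalConv_eq_scaled f g t, norm_mul, Complex.norm_real, Real.norm_of_nonneg ht.1.le]
    have h1 : ‖∫ σ in (0 : ℝ)..1, f (t * (1 - σ)) * g (t * σ)‖ ≤
        ∫ σ in (0:ℝ)..1, (Cf * Cg) * t ^ (a + b - 2) * ((1 - σ) ^ (a - 1) * σ ^ (b - 1)) := by
      refine intervalIntegral.norm_integral_le_of_norm_le zero_le_one ?_ (hB.const_mul _)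
      filter_upwards [Measure.ae_ne volume (1:ℝ)] with σ hσ1 hσ
      exact key t ht σ ⟨hσ.1, lt_of_le_of_ne hσ.2 hσ1⟩
    rw [intervalIntegral.integral_const_mul] at h1
    have h4 : t ^ (a + b - 1) = t * t ^ (a + b - 2) := by
      rw [show a + b - 1 = 1 + (a + b - 2) by ring, Real.rpow_add ht.1, Real.rpow_one]
    rw [h4]
    have h5 : 0 ≤ t ^ (a + b - 2) := Real.rpow_nonneg ht.1.le _
    calc _ ≤ t * ((Cf * Cg) * t ^ (a + b - 2) *
          ∫ σ in (0:ℝ)..1, ((1 - σ) ^ (a - 1) * σ ^ (b - 1))) :=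
          mul_le_mul_of_nonneg_left h1 ht.1.le
      _ ≤ t * (|Cf * Cg| * t ^ (a + b - 2) *
          ∫ σ in (0:ℝ)..1, ((1 - σ) ^ (a - 1) * σ ^ (b - 1))) := by
          have := ht.1.le
          gcongr
          exact le_abs_self _
      _ = _ := by ring

/-- The weight is multiplicative, e^{-sx} = e^{-st} e^{-s(x-t)}, so the weighted convolution is the
convolution of two integrable functions on the half-line. -/
theorem laplace_causalConv {f g : ℝ → ℂ} {s : ℂ}
    (hf : IntegrableOn (fun t : ℝ => Complex.exp (-(s * t)) * f t) (Ioi 0))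
    (hg : IntegrableOn (fun t : ℝ => Complex.exp (-(s * t)) * g t) (Ioi 0)) :
    IntegrableOn (fun t : ℝ => Complex.exp (-(s * t)) * causalConv f g t) (Ioi 0) ∧
    laplace (causalConv f g) s = laplace f s * laplace g s := by
  have e : ∀ x : ℝ, ∫ t in (0:ℝ)..x, ContinuousLinearMap.mul ℝ ℂ (Complex.exp (-(s * t)) * g t)
      (Complex.exp (-(s * (x - t : ℝ))) * f (x - t)) =
      Complex.exp (-(s * x)) * causalConv f g x := by
    intro x
    rw [causalConv, ← intervalIntegral.integral_const_mul]
    refine intervalIntegral.integral_congr fun t _ => ?_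
    simp only [ContinuousLinearMap.mul_apply']
    have : Complex.exp (-(s * x)) = Complex.exp (-(s * t)) * Complex.exp (-(s * (x - t : ℝ))) := by
      rw [← Complex.exp_add]; congr 1; push_cast; ring
    rw [this]; ring
  constructor
  · have := (integrable_posConvolution hg hf (ContinuousLinearMap.mul ℝ ℂ))
    refine (this.integrableOn (s := Ioi 0)).congr_fun (fun x hx => ?_) measurableSet_Ioi
    simp only [posConvolution]
    rw [indicator_of_mem hx]
    exact e x
  · have := integral_posConvolution hg hf (ContinuousLinearMap.mul ℝ ℂ)
    simp_rw [e] at this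
    rw [laplace, this, ContinuousLinearMap.mul_apply', mul_comm]
    rfl

theorem LaplaceKernel.conv {a b c : ℝ} {f g : ℝ → ℂ} (hf : LaplaceKernel a c f)
    (hg : LaplaceKernel b c g) : LaplaceKernel (a + b) c (causalConv f g) := by
  refine ⟨add_pos hf.pos hg.pos, fun t ht => ?_, fun T => ?_,
    (laplace_causalConv hf.integrable hg.integrable).1⟩
  · obtain ⟨Cf, -, hCf⟩ := hf.bound (t + 1)
    obtain ⟨Cg, -, hCg⟩ := hg.bound (t + 1)
    have := (causalConv_bound_continuousAt hf.pos hg.pos hf.cont hg.cont hCf hCg).1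
    exact (this.continuousAt (Ioo_mem_nhds ht (by linarith))).continuousWithinAt
  · obtain ⟨Cf, -, hCf⟩ := hf.bound T
    obtain ⟨Cg, -, hCg⟩ := hg.bound T
    exact (causalConv_bound_continuousAt hf.pos hg.pos hf.cont hg.cont hCf hCg).2

theorem LaplaceKernel.laplace_conv {a b c : ℝ} {f g : ℝ → ℂ} (hf : LaplaceKernel a c f)
    (hg : LaplaceKernel b c g) {s : ℂ} (hs : c ≤ s.re) :
    laplace (causalConv f g) s = laplace f s * laplace g s :=
  (laplace_causalConv (laplace_integrableOn hf.cont hf.integrable hs)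
    (laplace_integrableOn hg.cont hg.integrable hs)).2

open FourierTransform in
theorem fourier_indicator_eq_laplace (f : ℝ → ℂ) (c w : ℝ) :
    𝓕 (indicator (Ioi (0:ℝ)) fun t : ℝ => Complex.exp (-((c : ℂ) * t)) * f t) w =
      laplace f (c + (2 * Real.pi * w : ℝ) * Complex.I) := by
  rw [Real.fourier_eq', laplace, ← integral_indicator measurableSet_Ioi]
  congr 1 with t
  by_cases ht : t ∈ Ioi (0:ℝ)
  · rw [indicator_of_mem ht, indicator_of_mem ht, smul_eq_mul, ← mul_assoc, ← Complex.exp_add]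
    congr 2
    simp
    ring
  · rw [indicator_of_notMem ht, indicator_of_notMem ht, smul_zero]

open FourierTransform in
-- This is pointwise Fourier inversion for e^{-ct} f(t) extended by zero to t ≤ 0; positivity of t
-- keeps the point away from the jump at the origin.
theorem laplace_inversion {f : ℝ → ℂ} {c t : ℝ}
    (hf : IntegrableOn (fun t : ℝ => Complex.exp (-((c : ℂ) * t)) * f t) (Ioi 0)) (ht : 0 < t)
    (hc : ContinuousAt f t)
    (hL : Integrable fun y : ℝ => laplace f (c + y * Complex.I)) :
    f t = (1 / (2 * Real.pi) : ℂ) *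
      ∫ y : ℝ, Complex.exp ((c + y * Complex.I) * t) * laplace f (c + y * Complex.I) := by
  set F : ℝ → ℂ := indicator (Ioi (0:ℝ)) fun t : ℝ => Complex.exp (-((c : ℂ) * t)) * f t with hF
  have h1 : Integrable F := (integrable_indicator_iff measurableSet_Ioi).2 hf
  have h2 : 𝓕 F = fun w : ℝ => laplace f (c + (2 * Real.pi * w : ℝ) * Complex.I) := by
    ext w; exact fourier_indicator_eq_laplace f c w
  have hpi : (2 * Real.pi) ≠ 0 := by positivity
  have h3 : Integrable (𝓕 F) := by
    rw [h2]
    exact hL.comp_mul_left' hpi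
  have hFt : F =ᶠ[𝓝 t] fun t : ℝ => Complex.exp (-((c : ℂ) * t)) * f t := by
    filter_upwards [Ioi_mem_nhds ht] with x hx
    rw [hF, indicator_of_mem hx]
  have h4 : ContinuousAt F t := by
    refine ContinuousAt.congr ?_ hFt.symm
    exact ContinuousAt.mul (by fun_prop) hc
  have h5 := h1.fourierInv_fourier_eq h3 h4
  rw [hFt.self_of_nhds, h2, Real.fourierInv_eq'] at h5
  have h6 := Measure.integral_comp_mul_left (fun y : ℝ => Complex.exp ((y * Complex.I) * t) *
    laplace f (c + y * Complex.I)) (2 * Real.pi)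
  have h7 : (∫ v : ℝ, Complex.exp (((2 * Real.pi * inner ℝ v t : ℝ) : ℂ) * Complex.I) •
      laplace f (c + (2 * Real.pi * v : ℝ) * Complex.I)) =
      ∫ x : ℝ, Complex.exp ((((2 * Real.pi * x : ℝ) : ℂ) * Complex.I) * t) *
        laplace f (c + (2 * Real.pi * x : ℝ) * Complex.I) := by
    congr 1 with v
    rw [smul_eq_mul]
    congr 2
    simp
    ring
  rw [h7, h6] at h5
  have h8 : f t = Complex.exp (c * t) * (Complex.exp (-((c : ℂ) * t)) * f t) := by
    rw [← mul_assoc, ← Complex.exp_add]; simp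
  beta_reduce at h5
  rw [h8, ← h5, abs_of_pos (by positivity)]
  have h9 : ∀ y : ℝ, Complex.exp ((c + y * Complex.I) * t) * laplace f (c + y * Complex.I) =
      Complex.exp (c * t) * (Complex.exp ((y * Complex.I) * t) *
        laplace f (c + y * Complex.I)) := by
    intro y
    rw [← mul_assoc, ← Complex.exp_add, add_mul]
  simp_rw [h9]
  rw [integral_const_mul, Complex.real_smul]
  push_cast
  ring

/-- The inversion formula is applied to f - g, whose transform vanishes on the line and so is
trivially integrable; no decay of the individual transforms is needed. -/
theorem laplace_injective {f g : ℝ → ℂ} {c : ℝ} (hf : ContinuousOn f (Ioi 0))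
    (hg : ContinuousOn g (Ioi 0))
    (hfi : IntegrableOn (fun t : ℝ => Complex.exp (-((c : ℂ) * t)) * f t) (Ioi 0))
    (hgi : IntegrableOn (fun t : ℝ => Complex.exp (-((c : ℂ) * t)) * g t) (Ioi 0))
    (h : ∀ s : ℂ, s.re = c → laplace f s = laplace g s) {t : ℝ} (ht : 0 < t) : f t = g t := by
  have h0 : ∀ y : ℝ, laplace (fun t => f t - g t) (c + y * Complex.I) = 0 := by
    intro y
    have hs : ((c : ℂ) + y * Complex.I).re = c := by simp
    have e := h _ hs
    rw [laplace, laplace] at e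
    rw [laplace]
    simp_rw [mul_sub]
    rw [integral_sub (laplace_integrableOn hf hfi hs.ge) (laplace_integrableOn hg hgi hs.ge), e,
      sub_self]
  have hi : IntegrableOn (fun t : ℝ => Complex.exp (-((c : ℂ) * t)) * (f t - g t)) (Ioi 0) := by
    simp_rw [mul_sub]
    exact hfi.sub hgi
  have := laplace_inversion (f := fun t => f t - g t) hi ht
    ((hf.continuousAt (Ioi_mem_nhds ht)).sub (hg.continuousAt (Ioi_mem_nhds ht)))
    (by simp_rw [h0]; exact integrable_zero _ _ _)
  simp_rw [h0] at this
  simpa [sub_eq_zero] using this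

theorem LaplaceKernel.ext {a b c : ℝ} {f g : ℝ → ℂ} (hf : LaplaceKernel a c f)
    (hg : LaplaceKernel b c g) (h : ∀ s : ℂ, s.re = c → laplace f s = laplace g s) {t : ℝ}
    (ht : 0 < t) : f t = g t :=
  laplace_injective hf.cont hg.cont hf.integrable hg.integrable h ht

theorem LaplaceKernel.congr {a c : ℝ} {f g : ℝ → ℂ} (hf : LaplaceKernel a c f)
    (h : EqOn g f (Ioi 0)) : LaplaceKernel a c g := by
  refine ⟨hf.pos, hf.cont.congr h, fun T => ?_, hf.integrable.congr_fun (fun t ht => ?_)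
    measurableSet_Ioi⟩
  · obtain ⟨C, hC, hb⟩ := hf.bound T
    exact ⟨C, hC, fun t ht => by rw [h ht.1]; exact hb t ht⟩
  · simp only [h ht]

theorem laplace_congr {f g : ℝ → ℂ} (h : EqOn g f (Ioi 0)) (s : ℂ) : laplace g s = laplace f s :=
  setIntegral_congr_fun measurableSet_Ioi fun t ht => by simp only [h ht]

theorem hasDerivAt_laplace {f : ℝ → ℂ} {c : ℝ} (hf : ContinuousOn f (Ioi 0))
    (h : IntegrableOn (fun t : ℝ => Complex.exp (-((c : ℂ) * t)) * f t) (Ioi 0)) {s : ℂ}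
    (hs : c < s.re) :
    IntegrableOn (fun t : ℝ => Complex.exp (-(s * t)) * (-t * f t)) (Ioi 0) ∧
    HasDerivAt (laplace f) (laplace (fun t => -t * f t) s) s := by
  -- Half of the gap: on the δ-ball about s the exponential still gains e^{-δt} over e^{-ct}, and
  -- this absorbs the factor t of the derivative through δt ≤ e^{δt}.
  set δ := (s.re - c) / 2 with hδ
  have hδ0 : 0 < δ := by rw [hδ]; linarith
  have hmeas : ∀ z : ℂ, ContinuousOn (fun t : ℝ => Complex.exp (-(z * t)) * f t) (Ioi 0) :=
    fun z => (by fun_prop : Continuous fun t : ℝ => Complex.exp (-(z * t))).continuousOn.mul hf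
  have := hasDerivAt_integral_of_dominated_loc_of_deriv_le (μ := volume.restrict (Ioi (0:ℝ)))
    (F := fun (z : ℂ) (t : ℝ) => Complex.exp (-(z * t)) * f t)
    (F' := fun (z : ℂ) (t : ℝ) => Complex.exp (-(z * t)) * (-t * f t))
    (bound := fun t => δ⁻¹ * ‖Complex.exp (-((c : ℂ) * t)) * f t‖)
    (x₀ := s) (Metric.ball_mem_nhds s hδ0)
    (Eventually.of_forall fun z => (hmeas z).aestronglyMeasurable measurableSet_Ioi)
    (laplace_integrableOn hf h hs.le) ?_ ?_ (h.norm.const_mul _) ?_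
  · exact this
  · refine ContinuousOn.aestronglyMeasurable ?_ measurableSet_Ioi
    exact (by fun_prop : Continuous fun t : ℝ => Complex.exp (-(s * t))).continuousOn.mul
      ((by fun_prop : Continuous fun t : ℝ => (-t : ℂ)).continuousOn.mul hf)
  · refine (ae_restrict_iff' measurableSet_Ioi).2 (Eventually.of_forall fun t ht z hz => ?_)
    have ht0 : (0 : ℝ) < t := ht
    have hre : c + δ ≤ z.re := by
      have h1 : |(z - s).re| < δ :=
        (Complex.abs_re_le_norm _).trans_lt (by simpa [dist_eq_norm] using hz)
      rw [Complex.sub_re] at h1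
      have := (abs_lt.1 h1).1
      rw [hδ] at this ⊢
      linarith
    rw [norm_mul, norm_mul, norm_mul, Complex.norm_exp, Complex.norm_exp, norm_neg,
      Complex.norm_real, Real.norm_of_nonneg ht0.le, ← mul_assoc, ← mul_assoc]
    refine mul_le_mul_of_nonneg_right ?_ (norm_nonneg _)
    have e1 : (-(z * t)).re ≤ -(c * t) - δ * t := by
      simp only [Complex.neg_re, Complex.mul_re, Complex.ofReal_re, Complex.ofReal_im, mul_zero,
        sub_zero]
      nlinarith
    have e2 : (-((c:ℂ) * t)).re = -(c * t) := by simp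
    rw [e2]
    have e3 : δ * t ≤ Real.exp (δ * t) := by linarith [Real.add_one_le_exp (δ * t)]
    calc Real.exp (-(z * t)).re * t ≤ Real.exp (-(c * t) - δ * t) * t := by gcongr
      _ = δ⁻¹ * (Real.exp (-(c * t)) * (Real.exp (-(δ * t)) * (δ * t))) := by
          rw [sub_eq_add_neg, Real.exp_add]; field_simp
      _ ≤ δ⁻¹ * (Real.exp (-(c * t)) * (Real.exp (-(δ * t)) * Real.exp (δ * t))) := by gcongr
      _ = δ⁻¹ * Real.exp (-(c * t)) := by rw [← Real.exp_add (-(δ * t))]; simp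
  · refine Eventually.of_forall fun t z _ => ?_
    have h1 : HasDerivAt (fun z : ℂ => Complex.exp (-(z * t))) (Complex.exp (-(z * t)) * (-t)) z := by
      have := ((hasDerivAt_id z).mul_const (t:ℂ)).fun_neg.cexp
      simpa using this
    have := h1.mul_const (f t)
    rwa [mul_assoc] at this

/-! ### Laplace transforms of powers. -/

theorem rpow_integrable_exp {p c : ℝ} (hp : 0 < p) (hc : 0 < c) :
    IntegrableOn (fun t : ℝ => Real.exp (-(c * t)) * t ^ (p - 1)) (Ioi 0) := by
  have := integrableOn_rpow_mul_exp_neg_mul_rpow (p := 1) (s := p - 1) (b := c) (by linarith)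
    one_pos hc
  refine this.congr_fun (fun t _ => ?_) measurableSet_Ioi
  simp only [Real.rpow_one, neg_mul]
  ring

theorem integral_exp_mul_rpow {p c : ℝ} (hp : 0 < p) (hc : 0 < c) :
    ∫ t in Ioi (0:ℝ), Real.exp (-(c * t)) * t ^ (p - 1) = c ^ (-p) * Real.Gamma p := by
  have := Real.integral_rpow_mul_exp_neg_mul_Ioi hp hc
  simp_rw [mul_comm (Real.exp _)]
  rw [this, one_div, Real.inv_rpow hc.le, Real.rpow_neg hc.le]

theorem cexp_rpow_integrable {p c : ℝ} (hp : 0 < p) (hc : 0 < c) :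
    IntegrableOn (fun t : ℝ => Complex.exp (-((c : ℂ) * t)) * ((t ^ (p - 1) : ℝ) : ℂ)) (Ioi 0) := by
  have h : IntegrableOn (fun t : ℝ => ((Real.exp (-(c * t)) * t ^ (p - 1) : ℝ) : ℂ)) (Ioi 0) :=
    (rpow_integrable_exp hp hc).ofReal
  refine h.congr_fun (fun t _ => ?_) measurableSet_Ioi
  push_cast
  rfl

theorem continuousOn_rpow_Ioi (p : ℝ) : ContinuousOn (fun t : ℝ => ((t ^ p : ℝ) : ℂ)) (Ioi 0) :=
  Complex.continuous_ofReal.comp_continuousOn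
    (continuousOn_id.rpow_const fun _ ht => Or.inl (ne_of_gt ht))

/-- For real s this is Euler's integral. Both sides are holomorphic on the right half-plane, and the
real points 1 + 1/(n+1) accumulate at 1, so the identity theorem gives all s. -/
theorem laplace_rpow {p : ℝ} (hp : 0 < p) {s : ℂ} (hs : 0 < s.re) :
    laplace (fun t => ((t ^ (p - 1) : ℝ) : ℂ)) s = Real.Gamma p * s ^ (-(p : ℂ)) := by
  set f : ℝ → ℂ := fun t => ((t ^ (p - 1) : ℝ) : ℂ) with hf
  have hopen : IsOpen {z : ℂ | 0 < z.re} := isOpen_lt continuous_const Complex.continuous_re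
  have h1 : AnalyticOnNhd ℂ (laplace f) {z : ℂ | 0 < z.re} := by
    refine DifferentiableOn.analyticOnNhd (fun z hz => ?_) hopen
    have hz' : 0 < z.re := hz
    exact (hasDerivAt_laplace (c := z.re / 2) (continuousOn_rpow_Ioi _)
      (cexp_rpow_integrable hp (by linarith)) (by linarith)).2.differentiableAt.differentiableWithinAt
  have h2 : AnalyticOnNhd ℂ (fun s : ℂ => (Real.Gamma p : ℂ) * s ^ (-(p : ℂ)))
      {z : ℂ | 0 < z.re} := by
    refine DifferentiableOn.analyticOnNhd (fun z hz => ?_) hopen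
    refine DifferentiableAt.differentiableWithinAt (DifferentiableAt.const_mul ?_ _)
    exact differentiableAt_id.cpow (differentiableAt_const _) (Or.inl hz)
  have hreal : ∀ c : ℝ, 0 < c → laplace f c = Real.Gamma p * (c : ℂ) ^ (-(p : ℂ)) := by
    intro c hc
    have e : ∀ t : ℝ, Complex.exp (-((c : ℂ) * t)) * f t =
        ((Real.exp (-(c * t)) * t ^ (p - 1) : ℝ) : ℂ) := by
      intro t; simp [hf]
    rw [laplace]
    simp_rw [e]
    rw [integral_complex_ofReal, integral_exp_mul_rpow hp hc]
    push_cast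
    rw [Complex.ofReal_cpow hc.le]
    push_cast
    ring
  refine h1.eqOn_of_preconnected_of_frequently_eq h2
    (convex_halfSpace_re_gt 0).isPreconnected (z₀ := 1) (by simp) ?_ hs
  have ht : Tendsto (fun n : ℕ => ((1 + 1 / ((n:ℝ) + 1) : ℝ) : ℂ)) atTop (𝓝[≠] 1) := by
    refine tendsto_nhdsWithin_iff.2 ⟨?_, Eventually.of_forall fun n => ?_⟩
    · have := (tendsto_one_div_add_atTop_nhds_zero_nat (𝕜 := ℝ)).const_add 1
      rw [add_zero] at this
      exact (Complex.continuous_ofReal.tendsto (1:ℝ)).comp this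
    · have h0 : (0:ℝ) < 1 / ((n:ℝ) + 1) := by positivity
      intro h
      have := congrArg Complex.re h
      rw [Complex.ofReal_re, Complex.one_re] at this
      linarith
  exact ht.frequently (Frequently.of_forall fun n => hreal _ (by positivity))

/-- Restricting Euler's integral to (X, 2X] with X = ct bounds Γ(p) from below by e^{-2X} X^p / 2.
The prefactor in the result is free of p, so summability of |a_i| c^{-p_i} alone controls a whole
generalized power series pointwise. -/
theorem rpow_div_Gamma_le {p c t : ℝ} (hp : 0 < p) (hc : 0 < c) (ht : 0 < t) :
    t ^ (p - 1) / Real.Gamma p ≤ 2 * Real.exp (2 * (c * t)) / t * c ^ (-p) := by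
  set X := c * t with hX
  have hX0 : 0 < X := mul_pos hc ht
  have hG : 0 < Real.Gamma p := Real.Gamma_pos_of_pos hp
  have key : Real.exp (-(2 * X)) * X ^ p / 2 ≤ Real.Gamma p := by
    rw [Real.Gamma_eq_integral hp]
    have hint := Real.GammaIntegral_convergent hp
    have h1 : ∫ x in Ioc X (2 * X), Real.exp (-x) * x ^ (p - 1) ≤
        ∫ x in Ioi 0, Real.exp (-x) * x ^ (p - 1) := by
      refine setIntegral_mono_set hint ?_ ?_
      · refine (ae_restrict_iff' measurableSet_Ioi).2 (Eventually.of_forall fun x hx => ?_)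
        have : (0:ℝ) < x := hx
        simp only [Pi.zero_apply]
        positivity
      · exact (Ioc_subset_Ioi_self.trans (Ioi_subset_Ioi hX0.le)).eventuallyLE
    refine le_trans ?_ h1
    have h2 : ∫ x in Ioc X (2 * X), Real.exp (-(2 * X)) * X ^ (p - 1) / 2 ≤
        ∫ x in Ioc X (2 * X), Real.exp (-x) * x ^ (p - 1) := by
      refine setIntegral_mono_on (integrableOn_const (by simp)) (hint.mono_set
        (Ioc_subset_Ioi_self.trans (Ioi_subset_Ioi hX0.le))) measurableSet_Ioc fun x hx => ?_
      rw [mul_div_assoc]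
      have hx0 : 0 < x := hX0.trans hx.1
      refine mul_le_mul (Real.exp_le_exp.2 (by linarith [hx.2])) ?_ (by positivity) (by positivity)
      have e1 : X ^ (p - 1) = X ^ p / X := by rw [Real.rpow_sub hX0, Real.rpow_one]
      have e2 : x ^ (p - 1) = x ^ p / x := by rw [Real.rpow_sub hx0, Real.rpow_one]
      rw [e1, e2, div_div]
      refine div_le_div₀ (by positivity) (Real.rpow_le_rpow hX0.le hx.1.le hp.le) hx0
        (by linarith [hx.2])
    refine le_trans (le_of_eq ?_) h2
    rw [setIntegral_const, Measure.real, Real.volume_Ioc, show 2 * X - X = X by ring,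
      ENNReal.toReal_ofReal hX0.le, smul_eq_mul, Real.rpow_sub hX0, Real.rpow_one]
    field_simp
  rw [div_le_iff₀ hG]
  have e3 : X ^ p = c ^ p * t ^ p := Real.mul_rpow hc.le ht.le
  have e4 : t ^ (p - 1) = t ^ p / t := by rw [Real.rpow_sub ht, Real.rpow_one]
  rw [e4]
  calc t ^ p / t = 2 * Real.exp (2 * X) / t * c ^ (-p) * (Real.exp (-(2 * X)) * X ^ p / 2) := by
        rw [e3, Real.rpow_neg hc.le, Real.exp_neg]
        have : c ^ p ≠ 0 := (Real.rpow_pos_of_pos hc p).ne'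
        field_simp
    _ ≤ _ := by gcongr

/-! ### Generalized power series and termwise Laplace transformation. -/

section PowerSeries

variable {ι : Type*}

/-- The generalized power series `∑ a_i t^{p_i - 1} / Γ(p_i)`. -/
def powerSeries (a p : ι → ℝ) (t : ℝ) : ℝ := ∑' i, a i * (t ^ (p i - 1) / Real.Gamma (p i))

variable {a p : ι → ℝ} {p₀ c : ℝ}

theorem powerSeries_term_le (hp0 : 0 < p₀) (hp : ∀ i, p₀ ≤ p i) (hc : 0 < c) {t : ℝ} (ht : 0 < t)
    (i : ι) : ‖a i * (t ^ (p i - 1) / Real.Gamma (p i))‖ ≤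
      2 * Real.exp (2 * (c * t)) / t * (|a i| * c ^ (-(p i))) := by
  have h := rpow_div_Gamma_le (hp0.trans_le (hp i)) hc ht
  have h0 : 0 ≤ t ^ (p i - 1) / Real.Gamma (p i) :=
    div_nonneg (Real.rpow_nonneg ht.le _) (Real.Gamma_pos_of_pos (hp0.trans_le (hp i))).le
  rw [norm_mul, Real.norm_of_nonneg h0, Real.norm_eq_abs]
  calc _ ≤ |a i| * (2 * Real.exp (2 * (c * t)) / t * c ^ (-(p i))) := by gcongr
    _ = _ := by ring

theorem powerSeries_summable (hp0 : 0 < p₀) (hp : ∀ i, p₀ ≤ p i) (hc : 0 < c)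
    (hs : Summable fun i => |a i| * c ^ (-(p i))) {t : ℝ} (ht : 0 < t) :
    Summable fun i => a i * (t ^ (p i - 1) / Real.Gamma (p i)) :=
  Summable.of_norm_bounded (hs.mul_left _) (powerSeries_term_le hp0 hp hc ht)

theorem powerSeries_continuousOn (hp0 : 0 < p₀) (hp : ∀ i, p₀ ≤ p i) (hc : 0 < c)
    (hs : Summable fun i => |a i| * c ^ (-(p i))) : ContinuousOn (powerSeries a p) (Ioi 0) := by
  intro t ht
  have ht0 : (0:ℝ) < t := ht
  have : ContinuousOn (powerSeries a p) (Ioo (t / 2) (2 * t)) := by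
    refine continuousOn_tsum (u := fun i => 2 * Real.exp (2 * (c * (2 * t))) / (t / 2) *
      (|a i| * c ^ (-(p i)))) (fun i => ?_) (hs.mul_left _) fun i x hx => ?_
    · refine ContinuousOn.mul continuousOn_const (ContinuousOn.div_const ?_ _)
      exact continuousOn_id.rpow_const fun x hx => Or.inl (by
        have := hx.1; simp only [id]; linarith)
    · have hx0 : 0 < x := by linarith [hx.1]
      refine (powerSeries_term_le hp0 hp hc hx0 i).trans ?_
      have := Real.rpow_nonneg hc.le (-(p i))
      gcongr
      · exact hx.2.le
      · exact hx.1.le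
  exact (this.continuousAt (Ioo_mem_nhds (by linarith) (by linarith))).continuousWithinAt

/-- Each term is compared with its value at T: since p_i ≥ p₀, the ratio (t/T)^{p_i - 1} is at most
(t/T)^{p₀ - 1}. -/
theorem powerSeries_bound (hp0 : 0 < p₀) (hp : ∀ i, p₀ ≤ p i) (hc : 0 < c)
    (hs : Summable fun i => |a i| * c ^ (-(p i))) (T : ℝ) :
    ∃ C : ℝ, 0 ≤ C ∧ ∀ t ∈ Ioc 0 T, ‖powerSeries a p t‖ ≤ C * t ^ (p₀ - 1) := by
  rcases le_or_gt T 0 with hT | hT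
  · exact ⟨0, le_rfl, fun t ht => absurd (ht.1.trans_le ht.2) (not_lt.2 hT)⟩
  have hsT := (powerSeries_summable hp0 hp hc hs hT).norm
  refine ⟨T ^ (1 - p₀) * ∑' i, ‖a i * (T ^ (p i - 1) / Real.Gamma (p i))‖, by positivity,
    fun t ht => ?_⟩
  have hle : ∀ i, ‖a i * (t ^ (p i - 1) / Real.Gamma (p i))‖ ≤
      t ^ (p₀ - 1) * T ^ (1 - p₀) * ‖a i * (T ^ (p i - 1) / Real.Gamma (p i))‖ := by
    intro i
    have hG := Real.Gamma_pos_of_pos (hp0.trans_le (hp i))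
    have h1 : t ^ (p i - 1) ≤ t ^ (p₀ - 1) * T ^ (1 - p₀) * T ^ (p i - 1) := by
      rw [mul_assoc, ← Real.rpow_add hT, show p i - 1 = (p₀ - 1) + (p i - p₀) by ring,
        Real.rpow_add ht.1, show 1 - p₀ + (p₀ - 1 + (p i - p₀)) = p i - p₀ by ring]
      have := Real.rpow_nonneg ht.1.le (p₀ - 1)
      exact mul_le_mul_of_nonneg_left (Real.rpow_le_rpow ht.1.le ht.2 (by linarith [hp i])) this
    have e : ∀ x : ℝ, 0 < x → ‖a i * (x ^ (p i - 1) / Real.Gamma (p i))‖ =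
        |a i| * (x ^ (p i - 1) / Real.Gamma (p i)) := fun x hx => by
      rw [norm_mul, Real.norm_eq_abs, Real.norm_of_nonneg (by positivity)]
    rw [e t ht.1, e T hT]
    calc _ ≤ |a i| * (t ^ (p₀ - 1) * T ^ (1 - p₀) * T ^ (p i - 1) / Real.Gamma (p i)) := by
          gcongr
      _ = _ := by ring
  calc _ ≤ ∑' i, t ^ (p₀ - 1) * T ^ (1 - p₀) * ‖a i * (T ^ (p i - 1) / Real.Gamma (p i))‖ :=
        tsum_of_norm_bounded (hsT.mul_left _).hasSum hle
    _ = _ := by rw [tsum_mul_left]; ring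

/-- The numbers |a_i| c^{-p_i} are exactly the L¹ norms of the terms weighted by e^{-ct}, so the
hypothesis is what Fubini needs for sum and integral to commute. -/
theorem powerSeries_laplaceKernel [Countable ι] (hp0 : 0 < p₀) (hp : ∀ i, p₀ ≤ p i) (hc : 0 < c)
    (hs : Summable fun i => |a i| * c ^ (-(p i))) :
    LaplaceKernel p₀ c (fun t => (powerSeries a p t : ℂ)) ∧ ∀ s : ℂ, c ≤ s.re →
      HasSum (fun i => (a i : ℂ) * s ^ (-(p i : ℂ))) (laplace (fun t => (powerSeries a p t : ℂ)) s) := by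
  have hcont : ContinuousOn (fun t => (powerSeries a p t : ℂ)) (Ioi 0) :=
    Complex.continuous_ofReal.comp_continuousOn (powerSeries_continuousOn hp0 hp hc hs)
  have hG : ∀ i, 0 < Real.Gamma (p i) := fun i => Real.Gamma_pos_of_pos (hp0.trans_le (hp i))
  have hterm : ∀ i (s : ℂ), 0 < s.re → IntegrableOn (fun t : ℝ => Complex.exp (-(s * t)) *
      ((a i * (t ^ (p i - 1) / Real.Gamma (p i)) : ℝ) : ℂ)) (Ioi 0) := by
    intro i s h
    have : IntegrableOn (fun t : ℝ => Complex.exp (-(s * t)) * ((t ^ (p i - 1) : ℝ) : ℂ) *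
        ((a i / Real.Gamma (p i) : ℝ) : ℂ)) (Ioi 0) :=
      (laplace_integrableOn (s := s) (continuousOn_rpow_Ioi (p i - 1))
        (cexp_rpow_integrable (hp0.trans_le (hp i)) h) le_rfl).mul_const _
    refine this.congr_fun (fun t _ => ?_) measurableSet_Ioi
    push_cast
    ring
  have hnorm : ∀ i (s : ℂ), c ≤ s.re → ∫ t in Ioi (0:ℝ), ‖Complex.exp (-(s * t)) *
      ((a i * (t ^ (p i - 1) / Real.Gamma (p i)) : ℝ) : ℂ)‖ = |a i| * s.re ^ (-(p i)) := by
    intro i s h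
    have e : ∀ t ∈ Ioi (0:ℝ), ‖Complex.exp (-(s * t)) *
      ((a i * (t ^ (p i - 1) / Real.Gamma (p i)) : ℝ) : ℂ)‖ =
        |a i| / Real.Gamma (p i) * (Real.exp (-(s.re * t)) * t ^ (p i - 1)) := by
      intro t ht
      have ht0 : (0:ℝ) < t := ht
      have := hG i
      rw [norm_mul, Complex.norm_exp, Complex.norm_real, norm_mul, Real.norm_eq_abs,
        Real.norm_of_nonneg (by positivity)]
      simp only [Complex.neg_re, Complex.mul_re, Complex.ofReal_re, Complex.ofReal_im, mul_zero,
        sub_zero]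
      ring
    rw [setIntegral_congr_fun measurableSet_Ioi e, integral_const_mul,
      integral_exp_mul_rpow (hp0.trans_le (hp i)) (hc.trans_le h)]
    have := (hG i).ne'
    field_simp
  have hsum : ∀ s : ℂ, c ≤ s.re → Summable fun i => ∫ t in Ioi (0:ℝ), ‖Complex.exp (-(s * t)) *
      ((a i * (t ^ (p i - 1) / Real.Gamma (p i)) : ℝ) : ℂ)‖ := by
    intro s h
    simp_rw [hnorm _ s h]
    refine hs.of_nonneg_of_le (fun i => mul_nonneg (abs_nonneg _)
      (Real.rpow_nonneg (hc.le.trans h) _)) fun i => ?_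
    exact mul_le_mul_of_nonneg_left (Real.rpow_le_rpow_of_nonpos hc h
      (by linarith [hp i])) (abs_nonneg _)
  have hts : ∀ (s : ℂ), ∀ t ∈ Ioi (0:ℝ), ∑' i, Complex.exp (-(s * t)) *
      ((a i * (t ^ (p i - 1) / Real.Gamma (p i)) : ℝ) : ℂ) =
      Complex.exp (-(s * t)) * (powerSeries a p t : ℂ) := by
    intro s t ht
    rw [tsum_mul_left, powerSeries, Complex.ofReal_tsum]
  refine ⟨⟨hp0, hcont, fun T => ?_, ?_⟩, fun s h => ?_⟩
  · obtain ⟨C, hC, hb⟩ := powerSeries_bound hp0 hp hc hs T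
    exact ⟨C, hC, fun t ht => by rw [Complex.norm_real]; exact hb t ht⟩
  · have hcre : c ≤ (c : ℂ).re := le_rfl
    refine ⟨ContinuousOn.aestronglyMeasurable ((by fun_prop : Continuous fun t : ℝ =>
      Complex.exp (-((c:ℂ) * t))).continuousOn.mul hcont) measurableSet_Ioi, ?_⟩
    rw [hasFiniteIntegral_iff_enorm]
    calc ∫⁻ t in Ioi (0:ℝ), ‖Complex.exp (-((c:ℂ) * t)) * (powerSeries a p t : ℂ)‖ₑ
        ≤ ∫⁻ t in Ioi (0:ℝ), ∑' i, ‖Complex.exp (-((c:ℂ) * t)) *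
            ((a i * (t ^ (p i - 1) / Real.Gamma (p i)) : ℝ) : ℂ)‖ₑ := by
          refine lintegral_mono_ae ((ae_restrict_iff' measurableSet_Ioi).2
            (Eventually.of_forall fun t ht => ?_))
          rw [← hts c t ht]
          exact enorm_tsum_le_tsum_enorm
      _ = ∑' i, ∫⁻ t in Ioi (0:ℝ), ‖Complex.exp (-((c:ℂ) * t)) *
            ((a i * (t ^ (p i - 1) / Real.Gamma (p i)) : ℝ) : ℂ)‖ₑ :=
          lintegral_tsum fun i => (hterm i c (by simpa using hc)).aestronglyMeasurable.enorm
      _ = ∑' i, ENNReal.ofReal (∫ t in Ioi (0:ℝ), ‖Complex.exp (-((c:ℂ) * t)) *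
            ((a i * (t ^ (p i - 1) / Real.Gamma (p i)) : ℝ) : ℂ)‖) := by
          congr 1 with i
          rw [ofReal_integral_norm_eq_lintegral_enorm (hterm i c (by simpa using hc))]
      _ < ⊤ := by
          rw [← ENNReal.ofReal_tsum_of_nonneg (fun i => integral_nonneg fun t => norm_nonneg _)
            (hsum c hcre)]
          exact ENNReal.ofReal_lt_top
  · have hre : 0 < s.re := hc.trans_le h
    have := hasSum_integral_of_summable_integral_norm (fun i => hterm i s hre) (hsum s h)
    rw [setIntegral_congr_fun measurableSet_Ioi (hts s)] at this
    refine this.congr_fun fun i => ?_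
    have e := laplace_rpow (hp0.trans_le (hp i)) hre
    have hGi : (Real.Gamma (p i) : ℂ) ≠ 0 := by exact_mod_cast (hG i).ne'
    have e2 : ∫ t in Ioi (0:ℝ), Complex.exp (-(s * t)) *
        ((a i * (t ^ (p i - 1) / Real.Gamma (p i)) : ℝ) : ℂ) =
        (a i / Real.Gamma (p i) : ℂ) * laplace (fun t => ((t ^ (p i - 1) : ℝ) : ℂ)) s := by
      rw [laplace, ← integral_const_mul]
      congr 1 with t
      push_cast
      ring
    rw [e2, e]
    field_simp

end PowerSeries

/-! ### Binomial series and the symbol of the Prabhakar kernel. -/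

theorem abs_ascPochhammer_eval_le (γ : ℝ) (j : ℕ) :
    |(ascPochhammer ℝ j).eval γ| ≤ (ascPochhammer ℝ j).eval |γ| := by
  induction j with
  | zero => simp
  | succ j ih =>
    rw [ascPochhammer_succ_eval, ascPochhammer_succ_eval, abs_mul]
    refine mul_le_mul ih ?_ (abs_nonneg _) ((abs_nonneg _).trans ih)
    exact (abs_add_le _ _).trans (by simp)

theorem ascPochhammer_eval_nonneg {γ : ℝ} (hγ : 0 ≤ γ) (j : ℕ) :
    0 ≤ (ascPochhammer ℝ j).eval γ := by
  have := abs_ascPochhammer_eval_le γ j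
  rw [abs_of_nonneg hγ] at this
  exact (abs_nonneg _).trans this

theorem hasSum_binomial (γ : ℝ) {u : ℂ} (hu : ‖u‖ < 1) :
    HasSum (fun j : ℕ => (((ascPochhammer ℝ j).eval γ / (j.factorial : ℝ) : ℝ) : ℂ) * u ^ j)
      ((1 - u) ^ (-(γ : ℂ))) := by
  have h := (Complex.one_div_one_sub_cpow_hasFPowerSeriesOnBall_zero (γ : ℂ)).hasSum
    (y := u) (by simpa [← ofReal_norm, ENNReal.ofReal_lt_one] using hu)
  rw [zero_add] at h
  simp only [FormalMultilinearSeries.ofScalars_apply_eq, smul_eq_mul] at h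
  rw [Complex.cpow_neg, ← one_div]
  refine h.congr_fun fun j => ?_
  congr 1
  have h1 : (((ascPochhammer ℝ j).eval γ : ℝ) : ℂ) = (ascPochhammer ℂ j).eval (γ : ℂ) := by
    exact (Polynomial.eval₂_at_apply (algebraMap ℝ ℂ) γ).symm.trans
      (ascPochhammer_eval₂ (algebraMap ℝ ℂ) j (algebraMap ℝ ℂ γ)).symm
  have h2 := Ring.factorial_nsmul_multichoose_eq_ascPochhammer (γ : ℂ) j
  rw [Polynomial.ascPochhammer_smeval_eq_eval, ← h1, Ring.multichoose_eq, nsmul_eq_mul] at h2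
  have h3 : (j.factorial : ℂ) ≠ 0 := by exact_mod_cast j.factorial_ne_zero
  rw [Complex.ofReal_div, ← h2]
  push_cast
  field_simp

theorem hasSum_binomial_real (γ : ℝ) {x : ℝ} (hx : |x| < 1) :
    HasSum (fun j : ℕ => (ascPochhammer ℝ j).eval γ / (j.factorial : ℝ) * x ^ j)
      ((1 - x) ^ (-γ)) := by
  have h := hasSum_binomial γ (u := (x : ℂ)) (by simpa using hx)
  rw [← Complex.hasSum_ofReal]
  have h1 : (0 : ℝ) ≤ 1 - x := by linarith [(abs_lt.1 hx).2]
  rw [Complex.ofReal_cpow h1]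
  push_cast at h ⊢
  exact h

/-- The Laplace transform `s^{-μ} (1 - ω s^{-α})^{-γ}` of the Prabhakar kernel. -/
def prabhakarSymbol (α ω μ γ : ℝ) (s : ℂ) : ℂ :=
  s ^ (-(μ : ℂ)) * (1 - ω * s ^ (-(α : ℂ))) ^ (-(γ : ℂ))

theorem norm_mul_cpow_le {α ω c : ℝ} (hα : 0 < α) (hc : 0 < c) {s : ℂ} (hs : c ≤ s.re) :
    ‖(ω : ℂ) * s ^ (-(α : ℂ))‖ ≤ |ω| * c ^ (-α) := by
  rw [norm_mul, Complex.norm_real, Real.norm_eq_abs, ← Complex.ofReal_neg, Complex.norm_cpow_real]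
  exact mul_le_mul_of_nonneg_left (Real.rpow_le_rpow_of_nonpos hc
    (hs.trans (Complex.re_le_norm s)) (by linarith)) (abs_nonneg _)

theorem cpow_neg_add_mul {s : ℂ} (hs : s ≠ 0) (α μ : ℝ) (j : ℕ) :
    s ^ (-((α * j + μ : ℝ) : ℂ)) = s ^ (-(μ : ℂ)) * (s ^ (-(α : ℂ))) ^ j := by
  rw [← Complex.cpow_nat_mul, ← Complex.cpow_add _ _ hs]
  congr 1
  push_cast
  ring

theorem rpow_neg_add_mul {c : ℝ} (hc : 0 < c) (α μ : ℝ) (j : ℕ) :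
    c ^ (-(α * j + μ)) = c ^ (-μ) * (c ^ (-α)) ^ j := by
  rw [← Real.rpow_mul_natCast hc.le, ← Real.rpow_add hc]
  congr 1
  ring

theorem prabhakarKernel_eq_powerSeries (α μ ω γ : ℝ) {t : ℝ} (ht : 0 < t) :
    prabhakarKernel α μ ω γ t = powerSeries
      (fun j : ℕ => (ascPochhammer ℝ j).eval γ / (j.factorial : ℝ) * ω ^ j)
      (fun j : ℕ => α * j + μ) t := by
  rw [prabhakarKernel, mittagLeffler, powerSeries, ← tsum_mul_left]
  congr 1 with j
  have : t ^ (α * j + μ - 1) = t ^ (μ - 1) * (t ^ α) ^ j := by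
    rw [← Real.rpow_mul_natCast ht.le, ← Real.rpow_add ht]
    congr 1
    ring
  rw [this, mul_pow]
  ring

/-- Replacing γ by |γ| dominates the absolute values of the Pochhammer symbols, and leaves the
binomial series at |ω| c^{-α}. -/
theorem prabhakar_coeff_summable {α ω μ c : ℝ} (γ : ℝ) (hc : 0 < c)
    (hω : |ω| * c ^ (-α) < 1) : Summable fun j : ℕ =>
      |(ascPochhammer ℝ j).eval γ / (j.factorial : ℝ) * ω ^ j| * c ^ (-(α * j + μ)) := by
  have h0 : 0 ≤ |ω| * c ^ (-α) := by positivity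
  have h := (hasSum_binomial_real |γ| (x := |ω| * c ^ (-α))
    (by rwa [abs_of_nonneg h0])).summable.mul_left (c ^ (-μ))
  refine h.of_nonneg_of_le (fun j => by positivity) fun j => ?_
  rw [rpow_neg_add_mul hc, abs_mul, abs_div, abs_pow, Nat.abs_cast, mul_pow]
  calc _ = c ^ (-μ) * (|(ascPochhammer ℝ j).eval γ| / (j.factorial : ℝ) *
        (|ω| ^ j * (c ^ (-α)) ^ j)) := by ring
    _ ≤ _ := by
      gcongr
      exact abs_ascPochhammer_eval_le γ j

/-- Transforming term by term leaves s^{-μ} times the binomial series in u = ω s^{-α}, which sums to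
(1 - u)^{-γ}. -/
theorem prabhakarKernel_laplace {α ω μ c : ℝ} (γ : ℝ) (hα : 0 < α) (hμ : 0 < μ) (hc : 0 < c)
    (hω : |ω| * c ^ (-α) < 1) :
    LaplaceKernel μ c (fun t => (prabhakarKernel α μ ω γ t : ℂ)) ∧ ∀ s : ℂ, c ≤ s.re →
      laplace (fun t => (prabhakarKernel α μ ω γ t : ℂ)) s = prabhakarSymbol α ω μ γ s := by
  have h := powerSeries_laplaceKernel (p₀ := μ) (p := fun j : ℕ => α * j + μ) hμ
    (fun j => le_add_of_nonneg_left (by positivity)) hc (prabhakar_coeff_summable γ hc hω)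
  have he : EqOn (fun t => (prabhakarKernel α μ ω γ t : ℂ)) (fun t => (powerSeries
      (fun j : ℕ => (ascPochhammer ℝ j).eval γ / (j.factorial : ℝ) * ω ^ j)
      (fun j : ℕ => α * j + μ) t : ℂ)) (Ioi 0) := fun t ht => by
    simp only [prabhakarKernel_eq_powerSeries α μ ω γ ht]
  refine ⟨h.1.congr he, fun s hs => ?_⟩
  have hs0 : s ≠ 0 := by
    rintro rfl
    simp only [Complex.zero_re] at hs
    linarith
  rw [laplace_congr he]
  refine (h.2 s hs).unique ?_
  have hb := (hasSum_binomial γ ((norm_mul_cpow_le hα hc hs).trans_lt hω)).mul_left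
    (s ^ (-(μ : ℂ)))
  refine hb.congr_fun fun j => ?_
  rw [cpow_neg_add_mul hs0]
  push_cast
  ring

/-! ### The Fourier modes as double series. -/

/-- Time dependence `∑ (-l)^n e^{γ(n+1-ν)}_{α,ρ(n+1)+ν(1-ρ),ω}(t)` of the Fourier mode with
`l = M k²`. -/
def modeSeries (α ω γ ρ ν l t : ℝ) : ℝ :=
  ∑' n : ℕ, (-l) ^ n * prabhakarKernel α (ρ * (n + 1) + ν * (1 - ρ)) ω (γ * (n + 1 - ν)) t

section Mode

variable {α ω γ ρ ν c : ℝ}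

/-- For fixed n the sum over j is a binomial series equal to (1 - x)^{-γ(n+1-ν)} with x = |ω| c^{-α}
≤ 1/2. It costs at most a factor 2^γ per unit of n, so the sum over n is geometric with ratio l
c^{-ρ} 2^γ. The condition γ ≥ 0 makes all the Pochhammer symbols nonnegative. -/
theorem mode_coeff_summable (hγ : 0 ≤ γ) (hν : ν ∈ Icc (0 : ℝ) 1) (hc : 0 < c)
    (hω : |ω| * c ^ (-α) ≤ 1 / 2) {l : ℝ} (hl : 0 ≤ l) (hlc : l * c ^ (-ρ) * 2 ^ γ ≤ 1 / 2) :
    Summable fun i : ℕ × ℕ => |(-l) ^ i.1 * ((ascPochhammer ℝ i.2).eval (γ * (i.1 + 1 - ν)) /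
      (i.2.factorial : ℝ) * ω ^ i.2)| * c ^ (-(α * i.2 + (ρ * (i.1 + 1) + ν * (1 - ρ)))) := by
  set x := |ω| * c ^ (-α) with hx
  have hx0 : 0 ≤ x := by positivity
  have hx1 : |x| < 1 := by rw [abs_of_nonneg hx0]; linarith
  have hγn : ∀ n : ℕ, 0 ≤ γ * (n + 1 - ν) := fun n =>
    mul_nonneg hγ (by have := hν.2; have : (0:ℝ) ≤ n := n.cast_nonneg; linarith)
  have hterm : ∀ n j : ℕ, |(-l) ^ n * ((ascPochhammer ℝ j).eval (γ * (n + 1 - ν)) /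
      (j.factorial : ℝ) * ω ^ j)| * c ^ (-(α * j + (ρ * (n + 1) + ν * (1 - ρ)))) =
      l ^ n * c ^ (-(ρ * (n + 1) + ν * (1 - ρ))) *
        ((ascPochhammer ℝ j).eval (γ * (n + 1 - ν)) / (j.factorial : ℝ) * x ^ j) := by
    intro n j
    rw [rpow_neg_add_mul hc, abs_mul, abs_pow, abs_neg, abs_of_nonneg hl, abs_mul, abs_div,
      abs_of_nonneg (ascPochhammer_eval_nonneg (hγn n) j), Nat.abs_cast, abs_pow, hx, mul_pow]
    ring
  have hs : ∀ n : ℕ, HasSum (fun j : ℕ => |(-l) ^ n * ((ascPochhammer ℝ j).eval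
      (γ * (n + 1 - ν)) / (j.factorial : ℝ) * ω ^ j)| *
        c ^ (-(α * j + (ρ * (n + 1) + ν * (1 - ρ)))))
      (l ^ n * c ^ (-(ρ * (n + 1) + ν * (1 - ρ))) * (1 - x) ^ (-(γ * (n + 1 - ν)))) := by
    intro n
    simp_rw [hterm]
    exact (hasSum_binomial_real _ hx1).mul_left _
  refine (summable_prod_of_nonneg fun i => by positivity).2 ⟨fun n => (hs n).summable, ?_⟩
  simp only [(hs _).tsum_eq]
  have hgeo : Summable fun n : ℕ => c ^ (-(ρ + ν * (1 - ρ))) * 2 ^ γ * (1 / 2 : ℝ) ^ n :=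
    (summable_geometric_of_lt_one (by norm_num) (by norm_num)).mul_left _
  have hx2 : 0 < 1 - x := by linarith
  refine hgeo.of_nonneg_of_le (fun n => by positivity) fun n => ?_
  have h1 : (1 - x) ^ (-(γ * (n + 1 - ν))) ≤ 2 ^ γ * (2 ^ γ) ^ n := by
    calc (1 - x) ^ (-(γ * (n + 1 - ν))) ≤ (1 / 2 : ℝ) ^ (-(γ * (n + 1 - ν))) :=
          Real.rpow_le_rpow_of_nonpos (by norm_num) (by linarith) (by linarith [hγn n])
      _ = 2 ^ (γ * (n + 1 - ν)) := by
          rw [one_div, Real.inv_rpow (by norm_num), Real.rpow_neg (by norm_num), inv_inv]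
      _ ≤ 2 ^ (γ + γ * n) := by
          refine Real.rpow_le_rpow_of_exponent_le (by norm_num) ?_
          nlinarith [mul_nonneg hγ hν.1]
      _ = _ := by rw [Real.rpow_add (by norm_num), Real.rpow_mul_natCast (by norm_num)]
  have h2 : c ^ (-(ρ * (n + 1) + ν * (1 - ρ))) = c ^ (-(ρ + ν * (1 - ρ))) * (c ^ (-ρ)) ^ n := by
    rw [← rpow_neg_add_mul hc]
    congr 1
    ring
  rw [h2]
  calc _ ≤ l ^ n * (c ^ (-(ρ + ν * (1 - ρ))) * (c ^ (-ρ)) ^ n) * (2 ^ γ * (2 ^ γ) ^ n) := by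
        gcongr
    _ = c ^ (-(ρ + ν * (1 - ρ))) * 2 ^ γ * (l * c ^ (-ρ) * 2 ^ γ) ^ n := by
        rw [mul_pow, mul_pow]; ring
    _ ≤ _ := by gcongr

theorem mode_exponent_le (hα : 0 < α) (hρ : 0 < ρ) (i : ℕ × ℕ) :
    ρ + ν * (1 - ρ) ≤ α * i.2 + (ρ * (i.1 + 1) + ν * (1 - ρ)) := by
  have : 0 ≤ α * i.2 := by positivity
  have : 0 ≤ ρ * i.1 := by positivity
  nlinarith

theorem mode_order_pos (hρ : ρ ∈ Ioo (0 : ℝ) 1) (hν : ν ∈ Icc (0 : ℝ) 1) :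
    0 < ρ + ν * (1 - ρ) := by
  have := mul_nonneg hν.1 (by linarith [hρ.2] : 0 ≤ 1 - ρ)
  linarith [hρ.1]

theorem mode_summable (hα : 0 < α) (hγ : 0 ≤ γ) (hρ : ρ ∈ Ioo (0 : ℝ) 1)
    (hν : ν ∈ Icc (0 : ℝ) 1) (hc : 0 < c)
    (hω : |ω| * c ^ (-α) ≤ 1 / 2) {l : ℝ} (hl : 0 ≤ l) (hlc : l * c ^ (-ρ) * 2 ^ γ ≤ 1 / 2)
    {t : ℝ} (ht : 0 < t) :
    Summable (fun n : ℕ => (-l) ^ n *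
      prabhakarKernel α (ρ * (n + 1) + ν * (1 - ρ)) ω (γ * (n + 1 - ν)) t) ∧
    modeSeries α ω γ ρ ν l t = powerSeries (fun i : ℕ × ℕ =>
      (-l) ^ i.1 * ((ascPochhammer ℝ i.2).eval (γ * (i.1 + 1 - ν)) /
      (i.2.factorial : ℝ) * ω ^ i.2)) (fun i => α * i.2 + (ρ * (i.1 + 1) + ν * (1 - ρ))) t := by
  have h := powerSeries_summable (mode_order_pos hρ hν) (mode_exponent_le hα hρ.1) hc
    (mode_coeff_summable hγ hν hc hω hl hlc) ht
  have e : ∀ n : ℕ, (-l) ^ n *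
      prabhakarKernel α (ρ * (n + 1) + ν * (1 - ρ)) ω (γ * (n + 1 - ν)) t =
      ∑' j : ℕ, (-l) ^ n * ((ascPochhammer ℝ j).eval (γ * (n + 1 - ν)) /
        (j.factorial : ℝ) * ω ^ j) * (t ^ (α * j + (ρ * (n + 1) + ν * (1 - ρ)) - 1) /
          Real.Gamma (α * j + (ρ * (n + 1) + ν * (1 - ρ)))) := by
    intro n
    rw [prabhakarKernel_eq_powerSeries _ _ _ _ ht, powerSeries, ← tsum_mul_left]
    congr 1 with j
    ring
  constructor
  · simp_rw [e]
    exact h.prod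
  · rw [modeSeries, powerSeries, h.tsum_prod]
    exact tsum_congr e

/-- The condition on l and c forces the abscissa to grow with l. The series therefore serves only to
identify the transform; estimates uniform in l rest on the closed form `modeSymbol`. -/
theorem mode_laplace (hα : 0 < α) (hγ : 0 ≤ γ) (hρ : ρ ∈ Ioo (0 : ℝ) 1)
    (hν : ν ∈ Icc (0 : ℝ) 1) (hc : 0 < c)
    (hω : |ω| * c ^ (-α) ≤ 1 / 2) {l : ℝ} (hl : 0 ≤ l) (hlc : l * c ^ (-ρ) * 2 ^ γ ≤ 1 / 2) :
    LaplaceKernel (ρ + ν * (1 - ρ)) c (fun t => (modeSeries α ω γ ρ ν l t : ℂ)) ∧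
    ∀ s : ℂ, c ≤ s.re → HasSum (fun n : ℕ => (-l : ℂ) ^ n *
      prabhakarSymbol α ω (ρ * (n + 1) + ν * (1 - ρ)) (γ * (n + 1 - ν)) s)
      (laplace (fun t => (modeSeries α ω γ ρ ν l t : ℂ)) s) := by
  have h := powerSeries_laplaceKernel (mode_order_pos hρ hν) (mode_exponent_le hα hρ.1) hc
    (mode_coeff_summable (ω := ω) (α := α) hγ hν hc hω hl hlc)
  have he : EqOn (fun t => (modeSeries α ω γ ρ ν l t : ℂ)) (fun t => (powerSeries
      (fun i : ℕ × ℕ => (-l) ^ i.1 * ((ascPochhammer ℝ i.2).eval (γ * (i.1 + 1 - ν)) /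
      (i.2.factorial : ℝ) * ω ^ i.2))
      (fun i => α * i.2 + (ρ * (i.1 + 1) + ν * (1 - ρ))) t : ℂ)) (Ioi 0) := fun t ht => by
    simp only [(mode_summable hα hγ hρ hν hc hω hl hlc ht).2]
  refine ⟨h.1.congr he, fun s hs => ?_⟩
  have hs0 : s ≠ 0 := by
    rintro rfl
    simp only [Complex.zero_re] at hs
    linarith
  rw [laplace_congr he]
  refine HasSum.prod_fiberwise (h.2 s hs) fun n => ?_
  have hb := (hasSum_binomial (γ * (n + 1 - ν)) ((norm_mul_cpow_le hα hc hs).trans_lt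
    (hω.trans_lt (by norm_num)))).mul_left ((-l : ℂ) ^ n *
      s ^ (-((ρ * (n + 1) + ν * (1 - ρ) : ℝ) : ℂ)))
  rw [mul_assoc] at hb
  refine hb.congr_fun fun j => ?_
  rw [cpow_neg_add_mul hs0]
  push_cast
  ring

end Mode

/-! ### Admissible half-planes and the calculus of symbols. -/

/-- `c` is so large that on `Re s ≥ c` the symbol `s^ρ (1 - ω s^{-α})^γ` is comparable with `s^ρ`
and has positive real part. -/
structure Admissible (α ω γ ρ c : ℝ) : Prop where
  pos : 0 < c
  small : |ω| * c ^ (-α) ≤ 1 / 2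
  angle : γ * (2 * (|ω| * c ^ (-α))) < (1 - ρ) * (Real.pi / 2)

section Symbol

variable {α ω γ ρ ν c : ℝ}

theorem eventually_admissible (hα : 0 < α) (hρ : ρ < 1) :
    ∀ᶠ c in atTop, Admissible α ω γ ρ c := by
  have h : Tendsto (fun c : ℝ => |ω| * c ^ (-α)) atTop (𝓝 0) := by
    simpa using (tendsto_rpow_neg_atTop hα).const_mul |ω|
  have h2 : Tendsto (fun c : ℝ => γ * (2 * (|ω| * c ^ (-α)))) atTop (𝓝 0) := by
    simpa using (h.const_mul 2).const_mul γ
  have hpi := Real.pi_pos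
  filter_upwards [eventually_gt_atTop 0, h.eventually (gt_mem_nhds (by norm_num : (0:ℝ) < 1 / 2)),
    h2.eventually (gt_mem_nhds (by nlinarith : (0:ℝ) < (1 - ρ) * (Real.pi / 2)))] with c h1 h2 h3
  exact ⟨h1, h2.le, h3⟩

theorem Admissible.mono (hα : 0 < α) (hγ : 0 ≤ γ) (h : Admissible α ω γ ρ c) {d : ℝ}
    (hd : c ≤ d) : Admissible α ω γ ρ d := by
  have h1 : |ω| * d ^ (-α) ≤ |ω| * c ^ (-α) := mul_le_mul_of_nonneg_left
    (Real.rpow_le_rpow_of_nonpos h.pos hd (by linarith)) (abs_nonneg _)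
  refine ⟨h.pos.trans_le hd, h1.trans h.small, lt_of_le_of_lt ?_ h.angle⟩
  gcongr

/-- The factor `1 / (1 - ω s^{-α})`. -/
def symbolFactor (α ω : ℝ) (s : ℂ) : ℂ := (1 - ω * s ^ (-(α : ℂ)))⁻¹

theorem ne_zero_of_re {s : ℂ} (hc : 0 < c) (hs : c ≤ s.re) : s ≠ 0 := by
  rintro rfl
  simp only [Complex.zero_re] at hs
  linarith

theorem Admissible.norm_le (h : Admissible α ω γ ρ c) (hα : 0 < α) {s : ℂ} (hs : c ≤ s.re) :
    ‖(ω : ℂ) * s ^ (-(α : ℂ))‖ ≤ 1 / 2 :=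
  (norm_mul_cpow_le hα h.pos hs).trans h.small

theorem one_sub_mem_slitPlane {u : ℂ} (h : ‖u‖ ≤ 1 / 2) : 1 - u ∈ Complex.slitPlane := by
  refine Or.inl ?_
  have := (Complex.re_le_norm u).trans h
  rw [Complex.sub_re, Complex.one_re]
  linarith

theorem half_le_norm_one_sub {u : ℂ} (h : ‖u‖ ≤ 1 / 2) : 1 / 2 ≤ ‖1 - u‖ := by
  have := norm_sub_norm_le (1 : ℂ) u
  rw [norm_one] at this
  linarith

theorem norm_one_sub_le_two {u : ℂ} (h : ‖u‖ ≤ 1 / 2) : ‖1 - u‖ ≤ 2 := by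
  have := norm_sub_le (1 : ℂ) u
  rw [norm_one] at this
  linarith

theorem Admissible.factor_ne (h : Admissible α ω γ ρ c) (hα : 0 < α) {s : ℂ} (hs : c ≤ s.re) :
    1 - (ω : ℂ) * s ^ (-(α : ℂ)) ≠ 0 :=
  Complex.slitPlane_ne_zero (one_sub_mem_slitPlane (h.norm_le hα hs))

theorem Admissible.norm_symbolFactor_le (h : Admissible α ω γ ρ c) (hα : 0 < α) {s : ℂ}
    (hs : c ≤ s.re) : ‖symbolFactor α ω s‖ ≤ 2 := by
  rw [symbolFactor, norm_inv]
  calc _ ≤ (1 / 2 : ℝ)⁻¹ := inv_anti₀ (by norm_num) (half_le_norm_one_sub (h.norm_le hα hs))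
    _ = 2 := by norm_num

theorem prabhakarSymbol_mul (h : Admissible α ω γ ρ c) (hα : 0 < α) {s : ℂ} (hs : c ≤ s.re)
    (μ μ' g g' : ℝ) : prabhakarSymbol α ω μ g s * prabhakarSymbol α ω μ' g' s =
      prabhakarSymbol α ω (μ + μ') (g + g') s := by
  rw [prabhakarSymbol, prabhakarSymbol, prabhakarSymbol]
  have h1 : -((μ + μ' : ℝ) : ℂ) = -(μ : ℂ) + -(μ' : ℂ) := by push_cast; ring
  have h2 : -((g + g' : ℝ) : ℂ) = -(g : ℂ) + -(g' : ℂ) := by push_cast; ring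
  rw [h1, h2, Complex.cpow_add _ _ (ne_zero_of_re h.pos hs),
    Complex.cpow_add _ _ (h.factor_ne hα hs)]
  ring

theorem prabhakarSymbol_zero (s : ℂ) : prabhakarSymbol α ω 0 0 s = 1 := by
  simp [prabhakarSymbol]

theorem norm_prabhakarSymbol (μ g : ℝ) (s : ℂ) : ‖prabhakarSymbol α ω μ g s‖ =
    ‖s‖ ^ (-μ) * ‖1 - (ω : ℂ) * s ^ (-(α : ℂ))‖ ^ (-g) := by
  rw [prabhakarSymbol, norm_mul, ← Complex.ofReal_neg, ← Complex.ofReal_neg g,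
    Complex.norm_cpow_real, Complex.norm_cpow_real]

theorem norm_prabhakarSymbol_le (h : Admissible α ω γ ρ c) (hα : 0 < α) {s : ℂ} (hs : c ≤ s.re)
    {μ g : ℝ} (hg : g ≤ 0) : ‖prabhakarSymbol α ω μ g s‖ ≤ 2 ^ (-g) * ‖s‖ ^ (-μ) := by
  rw [norm_prabhakarSymbol, mul_comm]
  refine mul_le_mul_of_nonneg_right ?_ (by positivity)
  exact Real.rpow_le_rpow (norm_nonneg _) (norm_one_sub_le_two (h.norm_le hα hs)) (by linarith)

theorem le_norm_prabhakarSymbol (h : Admissible α ω γ ρ c) (hα : 0 < α) {s : ℂ} (hs : c ≤ s.re)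
    {μ g : ℝ} (hg : g ≤ 0) : (1 / 2) ^ (-g) * ‖s‖ ^ (-μ) ≤ ‖prabhakarSymbol α ω μ g s‖ := by
  rw [norm_prabhakarSymbol, mul_comm (‖s‖ ^ (-μ))]
  refine mul_le_mul_of_nonneg_right ?_ (by positivity)
  exact Real.rpow_le_rpow (by norm_num) (half_le_norm_one_sub (h.norm_le hα hs)) (by linarith)

/-- The argument of the symbol is ρ arg s + γ arg(1 - u). Since |arg s| ≤ π/2 the first part uses at
most ρπ/2, and the angle condition keeps the second below the remaining (1 - ρ)π/2. -/
theorem Admissible.symbol_re_pos (h : Admissible α ω γ ρ c) (hα : 0 < α) (hγ : 0 ≤ γ)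
    (hρ : ρ ∈ Ioo (0 : ℝ) 1) {s : ℂ} (hs : c ≤ s.re) :
    0 < (prabhakarSymbol α ω (-ρ) (-γ) s).re := by
  have hu := h.norm_le hα hs
  set u : ℂ := (ω : ℂ) * s ^ (-(α : ℂ)) with hu_def
  have e : prabhakarSymbol α ω (-ρ) (-γ) s =
      Complex.exp (ρ * Complex.log s + γ * Complex.log (1 - u)) := by
    rw [prabhakarSymbol, ← hu_def, Complex.cpow_def_of_ne_zero (ne_zero_of_re h.pos hs),
      Complex.cpow_def_of_ne_zero (h.factor_ne hα hs), ← Complex.exp_add]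
    congr 1
    push_cast
    ring
  rw [e, Complex.exp_re]
  refine mul_pos (Real.exp_pos _) ?_
  have h1 : |s.arg| ≤ Real.pi / 2 := Complex.abs_arg_le_pi_div_two_iff.2 (h.pos.le.trans hs)
  have h2 : |(1 - u).arg| ≤ 2 * (|ω| * c ^ (-α)) := by
    -- The logarithm estimate holds with constant 3/2; it is rounded up to the 2 that appears in the
    -- angle condition.
    have := Complex.norm_log_one_add_half_le_self (z := -u) (by simpa using hu)
    rw [norm_neg, ← sub_eq_add_neg] at this
    have h3 := Complex.abs_im_le_norm (Complex.log (1 - u))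
    rw [Complex.log_im] at h3
    have h4 := norm_mul_cpow_le (ω := ω) hα h.pos hs
    rw [← hu_def] at h4
    linarith [norm_nonneg u]
  have him : (ρ * Complex.log s + γ * Complex.log (1 - u) : ℂ).im =
      ρ * s.arg + γ * (1 - u).arg := by
    simp [Complex.log_im]
  rw [him]
  have h5 : |ρ * s.arg + γ * (1 - u).arg| < Real.pi / 2 := by
    refine (abs_add_le _ _).trans_lt ?_
    rw [abs_mul, abs_mul, abs_of_pos hρ.1, abs_of_nonneg hγ]
    have := mul_le_mul_of_nonneg_left h1 hρ.1.le
    have := mul_le_mul_of_nonneg_left h2 hγ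
    have := h.angle
    linarith
  exact Real.cos_pos_of_mem_Ioo (abs_lt.1 h5)

/-- Write v for the factor 1/(1 - u) with u = ω s^{-α}. Since u v = v - 1, derivatives of v and of
the symbols are polynomials in v, times the symbol itself, divided by s. The bounded quantity v thus
carries all dependence on ω. -/
theorem hasDerivAt_symbolFactor (h : Admissible α ω γ ρ c) (hα : 0 < α) {s : ℂ} (hs : c ≤ s.re) :
    HasDerivAt (symbolFactor α ω)
      (-α * symbolFactor α ω s * (symbolFactor α ω s - 1) / s) s := by
  have hs0 := ne_zero_of_re h.pos hs
  have hsl : s ∈ Complex.slitPlane := Or.inl (h.pos.trans_le hs)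
  have hne := h.factor_ne hα hs
  have h1 : HasDerivAt (fun s : ℂ => s ^ (-(α : ℂ))) (-(α : ℂ) * s ^ (-(α : ℂ) - 1) * 1) s :=
    (hasDerivAt_id s).cpow_const hsl
  have h2 := ((h1.const_mul (ω : ℂ)).const_sub 1).fun_inv hne
  refine h2.congr_deriv ?_
  rw [symbolFactor, Complex.cpow_sub _ _ hs0, Complex.cpow_one]
  field_simp
  ring

theorem hasDerivAt_prabhakarSymbol (h : Admissible α ω γ ρ c) (hα : 0 < α) {s : ℂ}
    (hs : c ≤ s.re) (μ g : ℝ) : HasDerivAt (prabhakarSymbol α ω μ g)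
      (prabhakarSymbol α ω μ g s * (-μ - g * α * (symbolFactor α ω s - 1)) / s) s := by
  have hs0 := ne_zero_of_re h.pos hs
  have hsl : s ∈ Complex.slitPlane := Or.inl (h.pos.trans_le hs)
  have hne := h.factor_ne hα hs
  have h1 : ∀ b : ℝ, HasDerivAt (fun s : ℂ => s ^ (-(b : ℂ)))
      (-(b : ℂ) * s ^ (-(b : ℂ) - 1) * 1) s := fun b => (hasDerivAt_id s).cpow_const hsl
  have h2 := (((h1 α).const_mul (ω : ℂ)).const_sub 1).cpow_const (c := -(g : ℂ))
    (one_sub_mem_slitPlane (h.norm_le hα hs))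
  refine ((h1 μ).mul h2).congr_deriv ?_
  rw [symbolFactor, prabhakarSymbol, Complex.cpow_sub _ _ hs0, Complex.cpow_sub _ _ hs0,
    Complex.cpow_sub _ _ hne, Complex.cpow_one, Complex.cpow_one]
  field_simp
  ring

/-- Coefficients of the second derivative of the resolvent symbol. -/
def coeffZero (α γ ρ ν : ℝ) (v : ℂ) : ℂ :=
  (-(ν * (1 - ρ)) + γ * ν * α * (v - 1)) ^ 2 - γ * ν * α ^ 2 * v * (v - 1) -
    (-(ν * (1 - ρ)) + γ * ν * α * (v - 1))

/-- Coefficients of the second derivative of the resolvent symbol. -/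
def coeffOne (α γ ρ ν : ℝ) (v : ℂ) : ℂ :=
  -2 * (-(ν * (1 - ρ)) + γ * ν * α * (v - 1)) * (ρ + γ * α * (v - 1)) -
    (ρ + γ * α * (v - 1)) ^ 2 + γ * α ^ 2 * v * (v - 1) + (ρ + γ * α * (v - 1))

/-- Coefficients of the second derivative of the resolvent symbol. -/
def coeffTwo (α γ ρ : ℝ) (v : ℂ) : ℂ := 2 * (ρ + γ * α * (v - 1)) ^ 2

/-- The Laplace transform of `modeSeries`. -/
def modeSymbol (α ω γ ρ ν l : ℝ) (s : ℂ) : ℂ :=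
  prabhakarSymbol α ω (ν * (1 - ρ)) (-(γ * ν)) s / (prabhakarSymbol α ω (-ρ) (-γ) s + l)

/-- The first derivative of `modeSymbol`. -/
def modeSymbolDeriv (α ω γ ρ ν l : ℝ) (s : ℂ) : ℂ :=
  modeSymbol α ω γ ρ ν l s * ((-(ν * (1 - ρ)) + γ * ν * α * (symbolFactor α ω s - 1)) -
    prabhakarSymbol α ω (-ρ) (-γ) s / (prabhakarSymbol α ω (-ρ) (-γ) s + l) *
      (ρ + γ * α * (symbolFactor α ω s - 1))) / s

/-- The second derivative of `modeSymbol`. -/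
def modeSymbolDeriv₂ (α ω γ ρ ν l : ℝ) (s : ℂ) : ℂ :=
  prabhakarSymbol α ω (ν * (1 - ρ)) (-(γ * ν)) s / s ^ 2 *
    (coeffZero α γ ρ ν (symbolFactor α ω s) * (1 / (prabhakarSymbol α ω (-ρ) (-γ) s + l)) +
     coeffOne α γ ρ ν (symbolFactor α ω s) * (prabhakarSymbol α ω (-ρ) (-γ) s *
      (1 / (prabhakarSymbol α ω (-ρ) (-γ) s + l)) ^ 2) +
     coeffTwo α γ ρ (symbolFactor α ω s) * (prabhakarSymbol α ω (-ρ) (-γ) s ^ 2 *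
      (1 / (prabhakarSymbol α ω (-ρ) (-γ) s + l)) ^ 3))

theorem symbol_add_ne_zero (h : Admissible α ω γ ρ c) (hα : 0 < α) (hγ : 0 ≤ γ)
    (hρ : ρ ∈ Ioo (0 : ℝ) 1) {s : ℂ} (hs : c ≤ s.re) {l : ℝ} (hl : 0 ≤ l) :
    prabhakarSymbol α ω (-ρ) (-γ) s + l ≠ 0 := by
  intro h0
  have h1 := h.symbol_re_pos hα hγ hρ hs
  have h2 := congrArg Complex.re h0
  rw [Complex.add_re, Complex.ofReal_re, Complex.zero_re] at h2
  linarith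

theorem hasDerivAt_modeSymbol (h : Admissible α ω γ ρ c) (hα : 0 < α) (hγ : 0 ≤ γ)
    (hρ : ρ ∈ Ioo (0 : ℝ) 1) {s : ℂ} (hs : c ≤ s.re) {l : ℝ} (hl : 0 ≤ l) :
    HasDerivAt (modeSymbol α ω γ ρ ν l) (modeSymbolDeriv α ω γ ρ ν l s) s := by
  have hs0 := ne_zero_of_re h.pos hs
  have hD := symbol_add_ne_zero h hα hγ hρ hs hl
  refine ((hasDerivAt_prabhakarSymbol h hα hs (ν * (1 - ρ)) (-(γ * ν))).div
    ((hasDerivAt_prabhakarSymbol h hα hs (-ρ) (-γ)).add_const (l : ℂ)) hD).congr_deriv ?_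
  rw [modeSymbolDeriv, modeSymbol]
  push_cast
  field_simp
  ring

/-- With D = Φ + l, s Φ' = (ρ + γα(v-1)) Φ and the analogous rule for A, the second derivative is A
s^{-2} times a combination of 1/D, Φ/D² and Φ²/D³ whose coefficients are polynomials in v. -/
theorem hasDerivAt_modeSymbolDeriv (h : Admissible α ω γ ρ c) (hα : 0 < α) (hγ : 0 ≤ γ)
    (hρ : ρ ∈ Ioo (0 : ℝ) 1) {s : ℂ} (hs : c ≤ s.re) {l : ℝ} (hl : 0 ≤ l) :
    HasDerivAt (modeSymbolDeriv α ω γ ρ ν l) (modeSymbolDeriv₂ α ω γ ρ ν l s) s := by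
  have hs0 := ne_zero_of_re h.pos hs
  have hD := symbol_add_ne_zero h hα hγ hρ hs hl
  have hv := (hasDerivAt_symbolFactor h hα hs).sub_const 1
  have hΦ := hasDerivAt_prabhakarSymbol h hα hs (-ρ) (-γ)
  have hP := hΦ.fun_div (hΦ.add_const (l : ℂ)) hD
  have hp := (hv.const_mul ((γ : ℂ) * ν * α)).const_add (-((ν : ℂ) * (1 - ρ)))
  have hq := (hv.const_mul ((γ : ℂ) * α)).const_add (ρ : ℂ)
  refine (((hasDerivAt_modeSymbol (ν := ν) h hα hγ hρ hs hl).fun_mul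
    (hp.fun_sub (hP.fun_mul hq))).fun_div (hasDerivAt_id s) hs0).congr_deriv ?_
  rw [modeSymbolDeriv₂, modeSymbolDeriv, modeSymbol, coeffZero, coeffOne, coeffTwo]
  simp only [id]
  generalize symbolFactor α ω s = v
  generalize prabhakarSymbol α ω (-ρ) (-γ) s = Φ at *
  generalize prabhakarSymbol α ω (ν * (1 - ρ)) (-(γ * ν)) s = A
  push_cast
  -- Taking D = Φ + l as the variable turns the denominators into powers of a single atom.
  obtain ⟨D, rfl⟩ : ∃ D, Φ = D - l := ⟨Φ + l, by ring⟩
  simp only [sub_add_cancel] at *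
  field_simp
  ring

end Symbol

/-! ### Integrals over vertical lines. -/

section Line

theorem norm_line (c y : ℝ) : ‖(c : ℂ) + y * Complex.I‖ = (c ^ 2 + y ^ 2) ^ (1 / 2 : ℝ) := by
  rw [← Real.sqrt_eq_rpow, Complex.norm_add_mul_I]

theorem le_norm_line (c y : ℝ) : c ≤ ‖(c : ℂ) + y * Complex.I‖ := by
  have := Complex.re_le_norm ((c : ℂ) + y * Complex.I)
  simpa using this

/-- The integral `∫ |1 + iy|^{-r} dy`. -/
def lineConst (r : ℝ) : ℝ := ∫ y : ℝ, ‖((1 : ℝ) : ℂ) + y * Complex.I‖ ^ (-r)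

theorem lineConst_nonneg (r : ℝ) : 0 ≤ lineConst r :=
  integral_nonneg fun _ => Real.rpow_nonneg (norm_nonneg _) _

theorem line_integrable {r c : ℝ} (hr : 1 < r) (hc : 0 < c) :
    Integrable (fun y : ℝ => ‖(c : ℂ) + y * Complex.I‖ ^ (-r)) ∧
    ∫ y : ℝ, ‖(c : ℂ) + y * Complex.I‖ ^ (-r) = c ^ (1 - r) * lineConst r := by
  have h1 : Integrable (fun y : ℝ => ‖((1 : ℝ) : ℂ) + y * Complex.I‖ ^ (-r)) := by
    have := integrable_rpow_neg_one_add_norm_sq (E := ℝ) (μ := volume) (r := r) (by simpa using hr)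
    refine this.congr (Eventually.of_forall fun y => ?_)
    simp only [norm_line, one_pow, Real.norm_eq_abs, sq_abs]
    rw [← Real.rpow_mul (by positivity)]
    congr 1
    ring
  have e : ∀ y : ℝ, ‖(c : ℂ) + y * Complex.I‖ ^ (-r) =
      c ^ (-r) * ‖((1 : ℝ) : ℂ) + ((c⁻¹ * y : ℝ) : ℂ) * Complex.I‖ ^ (-r) := by
    intro y
    rw [← Real.mul_rpow hc.le (norm_nonneg _)]
    congr 1
    have h2 : (c : ℂ) ≠ 0 := by exact_mod_cast hc.ne'
    have h3 : (c : ℂ) + y * Complex.I =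
        (c : ℂ) * (((1 : ℝ) : ℂ) + ((c⁻¹ * y : ℝ) : ℂ) * Complex.I) := by
      push_cast
      field_simp
    rw [h3, norm_mul, Complex.norm_real, Real.norm_of_nonneg hc.le]
  simp_rw [e]
  refine ⟨(h1.comp_mul_left' (inv_ne_zero hc.ne')).const_mul _, ?_⟩
  rw [integral_const_mul, Measure.integral_comp_mul_left (fun y : ℝ =>
    ‖((1 : ℝ) : ℂ) + y * Complex.I‖ ^ (-r)), inv_inv, abs_of_pos hc, smul_eq_mul, lineConst,
    sub_eq_add_neg, Real.rpow_add hc, Real.rpow_one]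
  ring

/-- Cauchy's theorem on the rectangle between the two lines; the horizontal sides at height ±Y
contribute O(Y^{-r}). -/
theorem integral_line_shift {F : ℂ → ℂ} {c₁ c₂ K r : ℝ} (hc : 0 < c₁) (h12 : c₁ ≤ c₂) (hr : 1 < r)
    (hF : ∀ s : ℂ, c₁ ≤ s.re → s.re ≤ c₂ → DifferentiableAt ℂ F s)
    (hb : ∀ s : ℂ, c₁ ≤ s.re → s.re ≤ c₂ → ‖F s‖ ≤ K * ‖s‖ ^ (-r)) :
    ∫ y : ℝ, F (c₁ + y * Complex.I) = ∫ y : ℝ, F (c₂ + y * Complex.I) := by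
  have hK : 0 ≤ K := by
    have h1 := (norm_nonneg _).trans (hb c₁ (by simp) (by simpa using h12))
    have : 0 < ‖(c₁ : ℂ)‖ ^ (-r) := Real.rpow_pos_of_pos (by simpa using hc.ne') _
    exact nonneg_of_mul_nonneg_left h1 this
  have hint : ∀ c, c₁ ≤ c → c ≤ c₂ → Integrable fun y : ℝ => F (c + y * Complex.I) := by
    intro c h1 h2
    refine Integrable.mono' ((line_integrable hr (hc.trans_le h1)).1.const_mul K) ?_
      (Eventually.of_forall fun y => hb _ (by simpa using h1) (by simpa using h2))
    refine Continuous.aestronglyMeasurable (continuous_iff_continuousAt.2 fun y => ?_)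
    exact ContinuousAt.comp (f := fun y : ℝ => (c : ℂ) + y * Complex.I)
      (hF _ (by simpa using h1) (by simpa using h2)).continuousAt (by fun_prop)
  have hlim : ∀ c, c₁ ≤ c → c ≤ c₂ → Tendsto (fun Y : ℝ => ∫ y in (-Y)..Y, F (c + y * Complex.I))
      atTop (𝓝 (∫ y : ℝ, F (c + y * Complex.I))) := fun c h1 h2 =>
    intervalIntegral_tendsto_integral (hint c h1 h2) tendsto_neg_atTop_atBot tendsto_id
  have hhor : ∀ ε : ℝ, |ε| = 1 → Tendsto (fun Y : ℝ => ∫ x in c₁..c₂, F (x + (ε * Y : ℝ) * Complex.I))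
      atTop (𝓝 0) := by
    intro ε hε
    have hz : Tendsto (fun Y : ℝ => K * Y ^ (-r) * |c₂ - c₁|) atTop (𝓝 0) := by
      simpa using ((tendsto_rpow_neg_atTop (by linarith : 0 < r)).const_mul K).mul_const |c₂ - c₁|
    refine squeeze_zero_norm' ?_ hz
    filter_upwards [eventually_gt_atTop 0] with Y hY
    refine intervalIntegral.norm_integral_le_of_norm_le_const fun x hx => ?_
    rw [uIoc_of_le h12] at hx
    refine (hb _ (by simpa using hx.1.le) (by simpa using hx.2)).trans ?_
    refine mul_le_mul_of_nonneg_left (Real.rpow_le_rpow_of_nonpos hY ?_ (by linarith)) hK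
    have := Complex.abs_im_le_norm ((x : ℂ) + (ε * Y : ℝ) * Complex.I)
    have e : ((x : ℂ) + (ε * Y : ℝ) * Complex.I).im = ε * Y := by simp
    rwa [e, abs_mul, hε, one_mul, abs_of_pos hY] at this
  have hrect : ∀ Y : ℝ, 0 < Y → (∫ x in c₁..c₂, F (x + ((-1) * Y : ℝ) * Complex.I)) -
      (∫ x in c₁..c₂, F (x + (1 * Y : ℝ) * Complex.I)) +
      Complex.I * (∫ y in (-Y)..Y, F (c₂ + y * Complex.I)) -
      Complex.I * (∫ y in (-Y)..Y, F (c₁ + y * Complex.I)) = 0 := by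
    intro Y hY
    have := Complex.integral_boundary_rect_eq_zero_of_differentiableOn F
      ((c₁ : ℂ) + (-Y : ℝ) * Complex.I) ((c₂ : ℂ) + Y * Complex.I) (fun s hs => ?_)
    · simpa using this
    · rw [Complex.mem_reProdIm] at hs
      have h1 := hs.1
      have e1 : ((c₁ : ℂ) + (-Y : ℝ) * Complex.I).re = c₁ := by simp
      have e2 : ((c₂ : ℂ) + Y * Complex.I).re = c₂ := by simp
      rw [e1, e2, uIcc_of_le h12] at h1
      exact (hF s h1.1 h1.2).differentiableWithinAt
  have htot := (((hhor (-1) (by simp)).sub (hhor 1 (by simp))).add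
    ((hlim c₂ h12 le_rfl).const_mul Complex.I)).sub ((hlim c₁ le_rfl h12).const_mul Complex.I)
  have h0 := tendsto_nhds_unique (htot.congr' ?_) (tendsto_const_nhds (x := (0 : ℂ)))
  · rw [sub_self, zero_add, ← mul_sub] at h0
    have := (mul_eq_zero.1 h0).resolve_left Complex.I_ne_zero
    exact (sub_eq_zero.1 this).symm
  · filter_upwards [eventually_gt_atTop 0] with Y hY
    exact hrect Y hY

end Line

/-! ### Estimates of the mode symbol uniform in l. -/

section Bounds

variable {α ω γ ρ ν c : ℝ}

/-- Adding l ≥ 0 to a number with positive real part cannot decrease its modulus, and the result is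
also at least l in modulus; the second bound is the average of these two facts. -/
theorem le_norm_symbol_add (h : Admissible α ω γ ρ c) (hα : 0 < α) (hγ : 0 ≤ γ)
    (hρ : ρ ∈ Ioo (0 : ℝ) 1) {s : ℂ} (hs : c ≤ s.re) {l : ℝ} (hl : 0 ≤ l) :
    ‖prabhakarSymbol α ω (-ρ) (-γ) s‖ ≤ ‖prabhakarSymbol α ω (-ρ) (-γ) s + l‖ ∧
    (1 / 2) ^ γ * (‖s‖ ^ ρ + l) / 2 ≤ ‖prabhakarSymbol α ω (-ρ) (-γ) s + l‖ := by
  have hre := h.symbol_re_pos hα hγ hρ hs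
  set Φ := prabhakarSymbol α ω (-ρ) (-γ) s with hΦ
  have h1 : ‖Φ‖ ≤ ‖Φ + l‖ := by
    rw [← sq_le_sq₀ (norm_nonneg _) (norm_nonneg _), Complex.sq_norm, Complex.sq_norm,
      Complex.normSq_apply, Complex.normSq_apply]
    simp only [Complex.add_re, Complex.ofReal_re, Complex.add_im, Complex.ofReal_im, add_zero]
    nlinarith [mul_nonneg hre.le hl]
  have h2 : l ≤ ‖Φ + l‖ := by
    refine le_trans ?_ (Complex.re_le_norm _)
    rw [Complex.add_re, Complex.ofReal_re]
    linarith
  refine ⟨h1, ?_⟩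
  have h3 := le_norm_prabhakarSymbol (μ := -ρ) h hα hs (neg_nonpos.2 hγ)
  rw [neg_neg, neg_neg, ← hΦ] at h3
  have h4 : (1 / 2 : ℝ) ^ γ * l ≤ l :=
    mul_le_of_le_one_left hl (Real.rpow_le_one (by norm_num) (by norm_num) hγ)
  linarith

/-- The coefficients are polynomials in v, and v stays in the disc of radius 2 on every admissible
half-plane. -/
theorem coeff_bound (hα : 0 < α) : ∃ B : ℝ, 0 ≤ B ∧
    ∀ s : ℂ, ∀ c, Admissible α ω γ ρ c → c ≤ s.re →
      ‖coeffZero α γ ρ ν (symbolFactor α ω s)‖ ≤ B ∧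
      ‖coeffOne α γ ρ ν (symbolFactor α ω s)‖ ≤ B ∧
      ‖coeffTwo α γ ρ (symbolFactor α ω s)‖ ≤ B := by
  have hcomp : IsCompact (Metric.closedBall (0 : ℂ) 2) := isCompact_closedBall 0 2
  obtain ⟨B0, h0⟩ := hcomp.exists_bound_of_continuousOn (f := coeffZero α γ ρ ν)
    (by unfold coeffZero; fun_prop)
  obtain ⟨B1, h1⟩ := hcomp.exists_bound_of_continuousOn (f := coeffOne α γ ρ ν)
    (by unfold coeffOne; fun_prop)
  obtain ⟨B2, h2⟩ := hcomp.exists_bound_of_continuousOn (f := coeffTwo α γ ρ)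
    (by unfold coeffTwo; fun_prop)
  refine ⟨max B0 (max B1 B2), ?_, fun s c h hs => ?_⟩
  · exact ((norm_nonneg _).trans (h0 0 (by simp))).trans (le_max_left _ _)
  · have hv : symbolFactor α ω s ∈ Metric.closedBall (0 : ℂ) 2 := by
      simpa using h.norm_symbolFactor_le hα hs
    exact ⟨(h0 _ hv).trans (le_max_left _ _),
      (h1 _ hv).trans ((le_max_left _ _).trans (le_max_right _ _)),
      (h2 _ hv).trans ((le_max_right _ _).trans (le_max_right _ _))⟩

theorem norm_symbol_prefactor_le (h : Admissible α ω γ ρ c) (hα : 0 < α) (hγ : 0 ≤ γ)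
    (hν : ν ∈ Icc (0 : ℝ) 1) {s : ℂ} (hs : c ≤ s.re) :
    ‖prabhakarSymbol α ω (ν * (1 - ρ)) (-(γ * ν)) s / s ^ 2‖ ≤
      2 ^ γ * ‖s‖ ^ (-(2 + ν * (1 - ρ))) := by
  have hs0 : 0 < ‖s‖ := norm_pos_iff.2 (ne_zero_of_re h.pos hs)
  have h1 := norm_prabhakarSymbol_le (μ := ν * (1 - ρ)) h hα hs
    (neg_nonpos.2 (mul_nonneg hγ hν.1))
  rw [norm_div, norm_pow, div_eq_mul_inv, neg_add, Real.rpow_add hs0, Real.rpow_neg hs0.le 2]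
  rw [neg_neg] at h1
  have h2 : (2 : ℝ) ^ (γ * ν) ≤ 2 ^ γ :=
    Real.rpow_le_rpow_of_exponent_le (by norm_num) (mul_le_of_le_one_right hγ hν.2)
  have h3 : ‖s‖ ^ (2:ℝ) = ‖s‖ ^ 2 := by norm_cast
  rw [h3]
  calc _ ≤ 2 ^ (γ * ν) * ‖s‖ ^ (-(ν * (1 - ρ))) * (‖s‖ ^ 2)⁻¹ := by gcongr
    _ ≤ 2 ^ γ * ‖s‖ ^ (-(ν * (1 - ρ))) * (‖s‖ ^ 2)⁻¹ := by gcongr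
    _ = _ := by ring

/-- Each of the three terms is 1/D times a power of Φ/D, and |Φ/D| ≤ 1, which gives one power of
decay in l. When ν = 0 the coefficient of the bare 1/D vanishes, so every term has a further factor
Φ/D = O(|s|^ρ/(c^ρ + l)): a loss of |s|^ρ buys a second power of decay in l. -/
theorem modeSymbolDeriv₂_bound (hα : 0 < α) (hγ : 0 ≤ γ) (hρ : ρ ∈ Ioo (0 : ℝ) 1)
    (hν : ν ∈ Icc (0 : ℝ) 1) : ∃ K : ℝ, 0 ≤ K ∧ ∀ s : ℂ, ∀ c, Admissible α ω γ ρ c → c ≤ s.re →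
      ∀ l : ℝ, 0 ≤ l →
      ‖modeSymbolDeriv₂ α ω γ ρ ν l s‖ ≤ K * ‖s‖ ^ (-(2 + ν * (1 - ρ))) / (c ^ ρ + l) ∧
      (ν = 0 → ‖modeSymbolDeriv₂ α ω γ ρ ν l s‖ ≤ K * ‖s‖ ^ (-(2 - ρ)) / (c ^ ρ + l) ^ 2) := by
  obtain ⟨B, hB0, hB⟩ := coeff_bound (α := α) (ω := ω) (γ := γ) (ρ := ρ) (ν := ν) hα
  set q : ℝ := 2 * 2 ^ γ with hq
  have hq1 : 1 ≤ q := by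
    have : (1:ℝ) ≤ 2 ^ γ := Real.one_le_rpow (by norm_num) hγ
    rw [hq]; linarith
  -- The last factor 2^γ q bounds the extra Φ/D of the case ν = 0; in the general case it is merely
  -- at least 1.
  refine ⟨2 ^ γ * (3 * B) * q * (2 ^ γ * q), by positivity, fun s c h hs l hl => ?_⟩
  obtain ⟨hb0, hb1, hb2⟩ := hB s c h hs
  have hs0 : 0 < ‖s‖ := norm_pos_iff.2 (ne_zero_of_re h.pos hs)
  have hpre := norm_symbol_prefactor_le h hα hγ hν hs
  obtain ⟨hP, hD⟩ := le_norm_symbol_add h hα hγ hρ hs hl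
  have hne := symbol_add_ne_zero h hα hγ hρ hs hl
  have hΦ := norm_prabhakarSymbol_le (μ := -ρ) h hα hs (neg_nonpos.2 hγ)
  rw [neg_neg, neg_neg] at hΦ
  rw [modeSymbolDeriv₂]
  set Φ := prabhakarSymbol α ω (-ρ) (-γ) s with hΦdef
  set D := 1 / (Φ + (l : ℂ)) with hDdef
  have hcs : c ^ ρ ≤ ‖s‖ ^ ρ :=
    Real.rpow_le_rpow h.pos.le (hs.trans (Complex.re_le_norm s)) hρ.1.le
  have hcl : 0 < c ^ ρ + l := by have := Real.rpow_pos_of_pos h.pos ρ; linarith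
  have hsl : 0 < ‖s‖ ^ ρ + l := by linarith
  have hDn : ‖D‖ ≤ q / (‖s‖ ^ ρ + l) := by
    rw [hDdef, norm_div, norm_one, div_le_div_iff₀ (norm_pos_iff.2 hne) hsl, one_mul]
    have e : (1 / 2 : ℝ) ^ γ = (2 ^ γ)⁻¹ := by
      rw [one_div, Real.inv_rpow (by norm_num)]
    rw [e] at hD
    have h2 : (0:ℝ) < 2 ^ γ := by positivity
    calc ‖s‖ ^ ρ + l = q * ((2 ^ γ)⁻¹ * (‖s‖ ^ ρ + l) / 2) := by rw [hq]; field_simp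
      _ ≤ _ := by gcongr
  have hPD : ‖Φ * D‖ ≤ 1 := by
    rw [hDdef, mul_one_div, norm_div, div_le_one (norm_pos_iff.2 hne)]
    exact hP
  have hDc : ‖D‖ ≤ q / (c ^ ρ + l) := hDn.trans (by gcongr)
  have e1 : Φ * D ^ 2 = D * (Φ * D) := by ring
  have e2 : Φ ^ 2 * D ^ 3 = D * (Φ * D) ^ 2 := by ring
  have hn1 : ‖Φ * D ^ 2‖ ≤ ‖D‖ * ‖Φ * D‖ := by rw [e1, norm_mul]
  have hn2 : ‖Φ ^ 2 * D ^ 3‖ ≤ ‖D‖ * ‖Φ * D‖ := by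
    rw [e2, norm_mul, norm_pow]
    refine mul_le_mul_of_nonneg_left ?_ (norm_nonneg _)
    exact pow_le_of_le_one (norm_nonneg _) hPD two_ne_zero
  have hw : 1 ≤ 2 ^ γ * q := one_le_mul_of_one_le_of_one_le
    (Real.one_le_rpow (by norm_num) hγ) hq1
  rw [norm_mul]
  constructor
  · have hb : ‖coeffZero α γ ρ ν (symbolFactor α ω s) * D +
        coeffOne α γ ρ ν (symbolFactor α ω s) * (Φ * D ^ 2) +
        coeffTwo α γ ρ (symbolFactor α ω s) * (Φ ^ 2 * D ^ 3)‖ ≤ 3 * B * ‖D‖ := by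
      have hn1' : ‖Φ * D ^ 2‖ ≤ ‖D‖ := hn1.trans (mul_le_of_le_one_right (norm_nonneg _) hPD)
      have hn2' : ‖Φ ^ 2 * D ^ 3‖ ≤ ‖D‖ := hn2.trans (mul_le_of_le_one_right (norm_nonneg _) hPD)
      refine (norm_add₃_le).trans ?_
      calc _ ≤ B * ‖D‖ + B * ‖D‖ + B * ‖D‖ := add_le_add (add_le_add
            (norm_mul_le_of_le hb0 le_rfl) (norm_mul_le_of_le hb1 hn1')) (norm_mul_le_of_le hb2 hn2')
        _ = _ := by ring
    calc _ ≤ (2 ^ γ * ‖s‖ ^ (-(2 + ν * (1 - ρ)))) * (3 * B * (q / (c ^ ρ + l))) := by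
          refine mul_le_mul hpre (hb.trans ?_) (norm_nonneg _) (by positivity)
          gcongr
      _ = 2 ^ γ * (3 * B) * q * 1 * ‖s‖ ^ (-(2 + ν * (1 - ρ))) / (c ^ ρ + l) := by ring
      _ ≤ _ := by gcongr
  · intro hν0
    subst hν0
    have h00 : coeffZero α γ ρ 0 (symbolFactor α ω s) = 0 := by simp [coeffZero]
    have hPn : ‖Φ * D‖ ≤ 2 ^ γ * q * ‖s‖ ^ ρ / (c ^ ρ + l) := by
      rw [norm_mul]
      calc _ ≤ (2 ^ γ * ‖s‖ ^ ρ) * (q / (c ^ ρ + l)) := by gcongr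
        _ = _ := by ring
    have hb : ‖coeffZero α γ ρ 0 (symbolFactor α ω s) * D +
        coeffOne α γ ρ 0 (symbolFactor α ω s) * (Φ * D ^ 2) +
        coeffTwo α γ ρ (symbolFactor α ω s) * (Φ ^ 2 * D ^ 3)‖ ≤ 3 * B * (‖D‖ * ‖Φ * D‖) := by
      rw [h00, zero_mul, zero_add]
      refine (norm_add_le _ _).trans ?_
      calc _ ≤ B * (‖D‖ * ‖Φ * D‖) + B * (‖D‖ * ‖Φ * D‖) :=
            add_le_add (norm_mul_le_of_le hb1 hn1) (norm_mul_le_of_le hb2 hn2)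
        _ ≤ _ := by nlinarith [mul_nonneg hB0 (mul_nonneg (norm_nonneg D) (norm_nonneg (Φ * D)))]
    have hsr : ‖s‖ ^ (-(2 - ρ)) = ‖s‖ ^ (-(2 + 0 * (1 - ρ))) * ‖s‖ ^ ρ := by
      rw [← Real.rpow_add hs0]; congr 1; ring
    calc _ ≤ (2 ^ γ * ‖s‖ ^ (-(2 + 0 * (1 - ρ)))) * (3 * B * ((q / (c ^ ρ + l)) *
            (2 ^ γ * q * ‖s‖ ^ ρ / (c ^ ρ + l)))) := by
          refine mul_le_mul hpre (hb.trans ?_) (norm_nonneg _) (by positivity)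
          gcongr
      _ = _ := by rw [hsr]; field_simp

theorem modeSymbolDeriv₂_differentiableAt (h : Admissible α ω γ ρ c) (hα : 0 < α) (hγ : 0 ≤ γ)
    (hρ : ρ ∈ Ioo (0 : ℝ) 1) {s : ℂ} (hs : c ≤ s.re) {l : ℝ} (hl : 0 ≤ l) :
    DifferentiableAt ℂ (modeSymbolDeriv₂ α ω γ ρ ν l) s := by
  have hv := (hasDerivAt_symbolFactor h hα hs).differentiableAt
  have hΦ := (hasDerivAt_prabhakarSymbol h hα hs (-ρ) (-γ)).differentiableAt
  have hA := (hasDerivAt_prabhakarSymbol h hα hs (ν * (1 - ρ)) (-(γ * ν))).differentiableAt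
  have hD := symbol_add_ne_zero h hα hγ hρ hs hl
  have hs2 : s ^ 2 ≠ 0 := pow_ne_zero 2 (ne_zero_of_re h.pos hs)
  unfold modeSymbolDeriv₂ coeffZero coeffOne coeffTwo
  fun_prop (disch := assumption)

theorem modeSymbolDeriv₂_continuous (h : Admissible α ω γ ρ c) (hα : 0 < α) (hγ : 0 ≤ γ)
    (hρ : ρ ∈ Ioo (0 : ℝ) 1) : ContinuousOn (fun p : ℝ × ℝ =>
      modeSymbolDeriv₂ α ω γ ρ ν p.1 (c + p.2 * Complex.I)) (Ici 0 ×ˢ univ) := by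
  have hre : ∀ y : ℝ, c ≤ ((c : ℂ) + y * Complex.I).re := fun y => by simp
  have hcomp : ∀ {f : ℂ → ℂ}, (∀ s : ℂ, c ≤ s.re → DifferentiableAt ℂ f s) →
      Continuous fun p : ℝ × ℝ => f (c + p.2 * Complex.I) := by
    intro f hf
    refine continuous_iff_continuousAt.2 fun p => ?_
    exact ContinuousAt.comp (f := fun p : ℝ × ℝ => (c : ℂ) + p.2 * Complex.I)
      (hf _ (hre _)).continuousAt (by fun_prop)
  have hv := hcomp fun s hs => (hasDerivAt_symbolFactor h hα hs).differentiableAt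
  have hΦ := hcomp fun s hs => (hasDerivAt_prabhakarSymbol h hα hs (-ρ) (-γ)).differentiableAt
  have hA := hcomp fun s hs =>
    (hasDerivAt_prabhakarSymbol h hα hs (ν * (1 - ρ)) (-(γ * ν))).differentiableAt
  have hs2 : ∀ p : ℝ × ℝ, ((c : ℂ) + p.2 * Complex.I) ^ 2 ≠ 0 := fun p =>
    pow_ne_zero 2 (ne_zero_of_re h.pos (hre p.2))
  have hD : ContinuousOn (fun p : ℝ × ℝ => 1 /
      (prabhakarSymbol α ω (-ρ) (-γ) (c + p.2 * Complex.I) + p.1)) (Ici 0 ×ˢ univ) := by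
    refine continuousOn_const.div (hΦ.add (by fun_prop)).continuousOn fun p hp => ?_
    exact symbol_add_ne_zero h hα hγ hρ (hre _) hp.1
  unfold modeSymbolDeriv₂
  have hc0 := (show Continuous (coeffZero α γ ρ ν) by unfold coeffZero; fun_prop).comp hv
  have hc1 := (show Continuous (coeffOne α γ ρ ν) by unfold coeffOne; fun_prop).comp hv
  have hc2 := (show Continuous (coeffTwo α γ ρ) by unfold coeffTwo; fun_prop).comp hv
  refine ContinuousOn.mul (hA.div (by fun_prop) hs2).continuousOn ?_
  exact ((hc0.continuousOn.mul hD).add (hc1.continuousOn.mul (hΦ.continuousOn.mul (hD.pow 2)))).add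
    (hc2.continuousOn.mul ((hΦ.pow 2).continuousOn.mul (hD.pow 3)))

end Bounds

/-! ### Inversion on a line independent of l, and decay of the modes. -/

section Bromwich

variable {α ω γ ρ ν c : ℝ}

theorem prabhakarSymbol_pow (h : Admissible α ω γ ρ c) (hα : 0 < α) {s : ℂ} (hs : c ≤ s.re)
    (μ g : ℝ) (n : ℕ) : prabhakarSymbol α ω μ g s ^ n = prabhakarSymbol α ω (μ * n) (g * n) s := by
  induction n with
  | zero => simp [prabhakarSymbol_zero]
  | succ n ih =>
    rw [pow_succ, ih, prabhakarSymbol_mul h hα hs]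
    push_cast
    congr 1 <;> ring

theorem eventually_mode_admissible (hα : 0 < α) (hρ : ρ ∈ Ioo (0 : ℝ) 1) (l : ℝ) :
    ∀ᶠ c in atTop, Admissible α ω γ ρ c ∧ l * c ^ (-ρ) * 2 ^ γ ≤ 1 / 2 := by
  refine (eventually_admissible hα hρ.2).and ?_
  have h : Tendsto (fun c : ℝ => l * c ^ (-ρ) * 2 ^ γ) atTop (𝓝 0) := by
    simpa using ((tendsto_rpow_neg_atTop hρ.1).const_mul l).mul_const (2 ^ γ)
  exact (h.eventually (gt_mem_nhds (by norm_num : (0:ℝ) < 1 / 2))).mono fun c hc => hc.le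

/-- With R = 1/Φ the n-th term has symbol A R (-l R)^n. The condition on l and c gives |l R| < 1,
and the geometric sum A R/(1 + l R) is the closed form. -/
theorem laplace_modeSeries (h : Admissible α ω γ ρ c) (hα : 0 < α) (hγ : 0 ≤ γ)
    (hρ : ρ ∈ Ioo (0 : ℝ) 1) (hν : ν ∈ Icc (0 : ℝ) 1) {l : ℝ} (hl : 0 ≤ l)
    (hlc : l * c ^ (-ρ) * 2 ^ γ ≤ 1 / 2) {s : ℂ} (hs : c ≤ s.re) :
    laplace (fun t => (modeSeries α ω γ ρ ν l t : ℂ)) s = modeSymbol α ω γ ρ ν l s := by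
  have hL := (mode_laplace hα hγ hρ hν h.pos h.small hl hlc).2 s hs
  set R := prabhakarSymbol α ω ρ γ s with hR
  have hs0 : 0 < ‖s‖ := norm_pos_iff.2 (ne_zero_of_re h.pos hs)
  have hRn : ‖-(l : ℂ) * R‖ < 1 := by
    have h1 := half_le_norm_one_sub (h.norm_le hα hs)
    have h2 : ‖R‖ ≤ c ^ (-ρ) * 2 ^ γ := by
      rw [hR, norm_prabhakarSymbol]
      refine mul_le_mul (Real.rpow_le_rpow_of_nonpos h.pos (hs.trans (Complex.re_le_norm s))
        (by linarith [hρ.1])) ?_ (by positivity) (by have := h.pos.le; positivity)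
      refine (Real.rpow_le_rpow_of_nonpos (by norm_num) h1 (by linarith)).trans (le_of_eq ?_)
      rw [one_div, Real.inv_rpow (by norm_num), Real.rpow_neg (by norm_num), inv_inv]
    rw [norm_mul, norm_neg, Complex.norm_real, Real.norm_of_nonneg hl]
    calc l * ‖R‖ ≤ l * (c ^ (-ρ) * 2 ^ γ) := by gcongr
      _ = l * c ^ (-ρ) * 2 ^ γ := by ring
      _ < 1 := by linarith
  have hg := (hasSum_geometric_of_norm_lt_one hRn).mul_left
    (prabhakarSymbol α ω (ν * (1 - ρ)) (-(γ * ν)) s * R)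
  have e : ∀ n : ℕ, (-l : ℂ) ^ n *
      prabhakarSymbol α ω (ρ * (n + 1) + ν * (1 - ρ)) (γ * (n + 1 - ν)) s =
      prabhakarSymbol α ω (ν * (1 - ρ)) (-(γ * ν)) s * R * (-(l : ℂ) * R) ^ n := by
    intro n
    rw [mul_pow, hR, prabhakarSymbol_mul h hα hs, prabhakarSymbol_pow h hα hs,
      mul_left_comm, prabhakarSymbol_mul h hα hs]
    congr 2 <;> ring
  simp_rw [e] at hL
  rw [hL.unique hg, modeSymbol]
  have hΦR : prabhakarSymbol α ω (-ρ) (-γ) s * R = 1 := by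
    rw [hR, prabhakarSymbol_mul h hα hs, neg_add_cancel, neg_add_cancel, prabhakarSymbol_zero]
  have hD := symbol_add_ne_zero h hα hγ hρ hs hl
  have hR0 : R ≠ 0 := right_ne_zero_of_mul_eq_one hΦR
  have hΦ : prabhakarSymbol α ω (-ρ) (-γ) s = R⁻¹ := eq_inv_of_mul_eq_one_left hΦR
  rw [hΦ] at hD ⊢
  have hD2 : 1 - -(l : ℂ) * R ≠ 0 := by
    intro h0
    apply hD
    have : R⁻¹ + l = R⁻¹ * (1 - -(l : ℂ) * R) := by field_simp; ring
    rw [this, h0, mul_zero]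
  have : R⁻¹ + l = R⁻¹ * (1 - -(l : ℂ) * R) := by field_simp; ring
  rw [this]
  field_simp

theorem integrable_modeSymbolDeriv₂ (h : Admissible α ω γ ρ c) (hα : 0 < α) (hγ : 0 ≤ γ)
    (hρ : ρ ∈ Ioo (0 : ℝ) 1) (hν : ν ∈ Icc (0 : ℝ) 1) {l : ℝ} (hl : 0 ≤ l) :
    Integrable fun y : ℝ => modeSymbolDeriv₂ α ω γ ρ ν l (c + y * Complex.I) := by
  obtain ⟨K, hK0, hK⟩ := modeSymbolDeriv₂_bound (ω := ω) hα hγ hρ hν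
  have hν0 : 0 ≤ ν * (1 - ρ) := mul_nonneg hν.1 (by linarith [hρ.2])
  refine Integrable.mono' (((line_integrable (r := 2 + ν * (1 - ρ)) (by linarith) h.pos).1.const_mul
    K).div_const (c ^ ρ + l)) ?_ (Eventually.of_forall fun y => (hK _ c h (by simp) l hl).1)
  refine Continuous.aestronglyMeasurable (continuous_iff_continuousAt.2 fun y => ?_)
  exact ContinuousAt.comp (f := fun y : ℝ => (c : ℂ) + y * Complex.I)
    (modeSymbolDeriv₂_differentiableAt h hα hγ hρ (by simp) hl).continuousAt (by fun_prop)

/-- Inversion formula for `t² modeSeries t` on any admissible vertical line. -/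
theorem modeSeries_eq_integral (h : Admissible α ω γ ρ c) (hα : 0 < α) (hγ : 0 ≤ γ)
    (hρ : ρ ∈ Ioo (0 : ℝ) 1) (hν : ν ∈ Icc (0 : ℝ) 1) {l : ℝ} (hl : 0 ≤ l) {t : ℝ} (ht : 0 < t) :
    (t : ℂ) ^ 2 * modeSeries α ω γ ρ ν l t = (1 / (2 * Real.pi) : ℂ) *
      ∫ y : ℝ, Complex.exp ((c + y * Complex.I) * t) *
        modeSymbolDeriv₂ α ω γ ρ ν l (c + y * Complex.I) := by
  -- The inversion is carried out far to the right, where the series converges for this particular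
  -- l. Afterwards the contour moves back to c, where only the closed form is known.
  obtain ⟨d, ⟨hd, hld⟩, hcd⟩ := ((eventually_mode_admissible (ω := ω) (γ := γ) hα hρ l).and
    (eventually_ge_atTop c)).exists
  set f : ℝ → ℂ := fun t => (modeSeries α ω γ ρ ν l t : ℂ) with hf
  have hker := (mode_laplace (α := α) (ω := ω) hα hγ hρ hν hd.pos hd.small hl hld).1
  have hopen : ∀ r : ℝ, IsOpen {z : ℂ | r < z.re} := fun r =>
    isOpen_lt continuous_const Complex.continuous_re
  have h1 : ∀ s : ℂ, d < s.re →
      IntegrableOn (fun t : ℝ => Complex.exp (-(s * t)) * (-t * f t)) (Ioi 0) ∧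
      laplace (fun t => -t * f t) s = modeSymbolDeriv α ω γ ρ ν l s := by
    intro s hs
    obtain ⟨i1, i2⟩ := hasDerivAt_laplace hker.cont hker.integrable hs
    refine ⟨i1, i2.unique ?_⟩
    refine (hasDerivAt_modeSymbol hd hα hγ hρ hs.le hl).congr_of_eventuallyEq ?_
    filter_upwards [(hopen d).mem_nhds hs] with z hz
    exact laplace_modeSeries hd hα hγ hρ hν hl hld (le_of_lt hz)
  have hcont1 : ContinuousOn (fun t : ℝ => -(t : ℂ) * f t) (Ioi 0) :=
    (by fun_prop : Continuous fun t : ℝ => -(t : ℂ)).continuousOn.mul hker.cont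
  have hint1 : IntegrableOn (fun t : ℝ => Complex.exp (-(((d + 1 : ℝ) : ℂ) * t)) * (-t * f t))
      (Ioi 0) := (h1 ((d + 1 : ℝ) : ℂ) (by simp)).1
  have h2 : ∀ s : ℂ, d + 1 < s.re →
      IntegrableOn (fun t : ℝ => Complex.exp (-(s * t)) * (-t * (-t * f t))) (Ioi 0) ∧
      laplace (fun t => -t * (-t * f t)) s = modeSymbolDeriv₂ α ω γ ρ ν l s := by
    intro s hs
    obtain ⟨i1, i2⟩ := hasDerivAt_laplace hcont1 hint1 hs
    refine ⟨i1, i2.unique ?_⟩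
    refine (hasDerivAt_modeSymbolDeriv hd hα hγ hρ (by linarith) hl).congr_of_eventuallyEq ?_
    filter_upwards [(hopen (d + 1)).mem_nhds hs] with z hz
    have hz' : d + 1 < z.re := hz
    exact (h1 z (by linarith)).2
  have hcont2 : ContinuousOn (fun t : ℝ => -(t : ℂ) * (-(t : ℂ) * f t)) (Ioi 0) :=
    (by fun_prop : Continuous fun t : ℝ => -(t : ℂ)).continuousOn.mul hcont1
  -- Each differentiation of the transform needs room to the left of the point, hence the two steps
  -- from d through d + 1 to d + 2.
  have hd2 : Admissible α ω γ ρ (d + 2) := hd.mono hα hγ (by linarith)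
  have hline : ∀ y : ℝ, laplace (fun t => -(t : ℂ) * (-(t : ℂ) * f t))
      (((d + 2 : ℝ) : ℂ) + y * Complex.I) =
      modeSymbolDeriv₂ α ω γ ρ ν l (((d + 2 : ℝ) : ℂ) + y * Complex.I) := fun y =>
    (h2 _ (by simp)).2
  have hinv := laplace_inversion (f := fun t : ℝ => -(t : ℂ) * (-(t : ℂ) * f t)) (c := d + 2)
    (h2 ((d + 2 : ℝ) : ℂ) (by simp)).1 ht (hcont2.continuousAt (Ioi_mem_nhds ht))
    (by simp_rw [hline]; exact integrable_modeSymbolDeriv₂ hd2 hα hγ hρ hν hl)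
  simp_rw [hline] at hinv
  have e : (t : ℂ) ^ 2 * modeSeries α ω γ ρ ν l t = -(t : ℂ) * (-(t : ℂ) * f t) := by
    rw [hf]; ring
  rw [e, hinv]
  congr 1
  obtain ⟨K, hK0, hK⟩ := modeSymbolDeriv₂_bound (ω := ω) hα hγ hρ hν
  have hν0 : 0 ≤ ν * (1 - ρ) := mul_nonneg hν.1 (by linarith [hρ.2])
  refine (integral_line_shift (F := fun s => Complex.exp (s * t) * modeSymbolDeriv₂ α ω γ ρ ν l s)
    (K := Real.exp ((d + 2) * t) * (K / (c ^ ρ + l))) (r := 2 + ν * (1 - ρ)) h.pos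
    (by linarith : c ≤ d + 2) (by linarith) (fun s hs1 hs2 => ?_) fun s hs1 hs2 => ?_).symm
  · have := modeSymbolDeriv₂_differentiableAt (ν := ν) h hα hγ hρ hs1 hl
    fun_prop
  · rw [norm_mul, Complex.norm_exp]
    have e3 : (s * t).re = s.re * t := by simp
    rw [e3]
    have h3 := (hK s c h hs1 l hl).1
    have h4 : Real.exp (s.re * t) ≤ Real.exp ((d + 2) * t) := by gcongr
    calc _ ≤ Real.exp ((d + 2) * t) * (K * ‖s‖ ^ (-(2 + ν * (1 - ρ))) / (c ^ ρ + l)) := by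
          gcongr
      _ = _ := by ring

theorem norm_modeSeries_le_of_bound (h : Admissible α ω γ ρ c) (hα : 0 < α) (hγ : 0 ≤ γ)
    (hρ : ρ ∈ Ioo (0 : ℝ) 1) (hν : ν ∈ Icc (0 : ℝ) 1) {l : ℝ} (hl : 0 ≤ l) {t B r : ℝ} (ht : 0 < t)
    (hr : 1 < r) (hB : ∀ y : ℝ, ‖modeSymbolDeriv₂ α ω γ ρ ν l (c + y * Complex.I)‖ ≤
      B * ‖(c : ℂ) + y * Complex.I‖ ^ (-r)) :
    t ^ 2 * |modeSeries α ω γ ρ ν l t| ≤ Real.exp (c * t) * (B * (c ^ (1 - r) * lineConst r)) := by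
  have e := congrArg norm (modeSeries_eq_integral h hα hγ hρ hν hl ht)
  rw [norm_mul, norm_pow, Complex.norm_real, Complex.norm_real, Real.norm_of_nonneg ht.le,
    Real.norm_eq_abs] at e
  rw [e]
  obtain ⟨hi, hiv⟩ := line_integrable hr h.pos
  have h1 : ‖∫ y : ℝ, Complex.exp ((c + y * Complex.I) * t) *
        modeSymbolDeriv₂ α ω γ ρ ν l (c + y * Complex.I)‖ ≤
      ∫ y : ℝ, Real.exp (c * t) * (B * ‖(c : ℂ) + y * Complex.I‖ ^ (-r)) := by
    refine norm_integral_le_of_norm_le ((hi.const_mul B).const_mul _)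
      (Eventually.of_forall fun y => ?_)
    rw [norm_mul, Complex.norm_exp]
    have : (((c : ℂ) + y * Complex.I) * t).re = c * t := by simp
    rw [this]
    gcongr
    exact hB y
  rw [integral_const_mul, integral_const_mul, hiv] at h1
  rw [norm_mul]
  have h2 : ‖(1 / (2 * Real.pi) : ℂ)‖ ≤ 1 := by
    rw [norm_div, norm_one, norm_mul, Complex.norm_real, Real.norm_of_nonneg Real.pi_pos.le]
    rw [div_le_one (by norm_num; exact Real.pi_pos)]
    have := Real.pi_gt_three
    norm_num
    linarith
  calc _ ≤ 1 * ‖∫ y : ℝ, Complex.exp ((c + y * Complex.I) * t) *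
        modeSymbolDeriv₂ α ω γ ρ ν l (c + y * Complex.I)‖ := by gcongr
    _ ≤ _ := by rw [one_mul]; exact h1

/-- Uniform decay of the Fourier modes. -/
theorem modeSeries_bound (hα : 0 < α) (hγ : 0 ≤ γ) (hρ : ρ ∈ Ioo (0 : ℝ) 1)
    (hν : ν ∈ Icc (0 : ℝ) 1) (ω T : ℝ) : ∃ C : ℝ, 0 ≤ C ∧ ∀ l : ℝ, 0 ≤ l → ∀ t ∈ Ioc 0 T,
      |modeSeries α ω γ ρ ν l t| ≤ C * t ^ (ν * (1 - ρ) - 1) / (t ^ (-ρ) + l) ∧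
      (ν = 0 → |modeSeries α ω γ ρ ν l t| ≤ C * t ^ (-ρ - 1) / (t ^ (-ρ) + l) ^ 2) := by
  obtain ⟨c₀, hc₀⟩ := (eventually_admissible (ω := ω) (γ := γ) hα hρ.2).exists
  obtain ⟨K, hK0, hK⟩ := modeSymbolDeriv₂_bound (ω := ω) hα hγ hρ hν
  set a := ν * (1 - ρ) with ha
  have ha0 : 0 ≤ a := mul_nonneg hν.1 (by linarith [hρ.2])
  -- The line used at time t has abscissa κ/t: then e^{ct} is the constant e^κ and powers of c
  -- become powers of t. The bound κ ≥ c₀T makes κ/t at least c₀, hence admissible, for all t ≤ T; κ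
  -- ≥ 1 lets powers of κ be dropped.
  set κ : ℝ := max 1 (c₀ * T) with hκ
  have hκ1 : 1 ≤ κ := le_max_left _ _
  have hL1 := lineConst_nonneg (2 + a)
  have hL2 := lineConst_nonneg (2 - ρ)
  refine ⟨Real.exp κ * (K * (lineConst (2 + a) + lineConst (2 - ρ))), by positivity,
    fun l hl t ht => ?_⟩
  have ht0 := ht.1
  have hκ0 : 0 < κ := by linarith
  have hc : c₀ ≤ κ / t := by
    rw [le_div_iff₀ ht0]
    exact (mul_le_mul_of_nonneg_left ht.2 hc₀.pos.le).trans (le_max_right _ _)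
  have hadm := hc₀.mono hα hγ hc
  have hct : κ / t * t = κ := by field_simp
  have hcρ : t ^ (-ρ) ≤ (κ / t) ^ ρ := by
    rw [Real.div_rpow hκ0.le ht0.le, Real.rpow_neg ht0.le, div_eq_mul_inv]
    exact le_mul_of_one_le_left (by positivity) (Real.one_le_rpow hκ1 hρ.1.le)
  have hden : 0 < t ^ (-ρ) + l := by have := Real.rpow_pos_of_pos ht0 (-ρ); linarith
  -- The factor t² is split off to cancel the one in the inversion formula.
  have hpow : ∀ r : ℝ, 1 < r → (κ / t) ^ (1 - r) ≤ t ^ 2 * t ^ (r - 1 - 2) := by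
    intro r hr
    have e1 : t ^ 2 * t ^ (r - 1 - 2) = t ^ (r - 1) := by
      rw [Real.rpow_sub ht0 (r - 1), show t ^ (2:ℝ) = t ^ 2 by norm_cast]
      field_simp
    rw [e1, Real.div_rpow hκ0.le ht0.le, show 1 - r = -(r - 1) by ring, Real.rpow_neg hκ0.le,
      Real.rpow_neg ht0.le, div_inv_eq_mul]
    exact mul_le_of_le_one_left (by positivity)
      (inv_le_one_of_one_le₀ (Real.one_le_rpow hκ1 (by linarith)))
  have ht2 : 0 < t ^ 2 := by positivity
  constructor
  · have h1 := norm_modeSeries_le_of_bound (B := K / (t ^ (-ρ) + l)) (r := 2 + a) hadm hα hγ hρ hν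
      hl ht0 (by linarith) (fun y => by
        refine ((hK _ _ hadm (by simp) l hl).1).trans ?_
        rw [div_mul_eq_mul_div]
        gcongr)
    rw [hct] at h1
    have h2 := hpow (2 + a) (by linarith)
    rw [show 2 + a - 1 - 2 = a - 1 by ring] at h2
    refine le_of_mul_le_mul_left (h1.trans ?_) ht2
    calc _ ≤ Real.exp κ * (K / (t ^ (-ρ) + l) *
          ((t ^ 2 * t ^ (a - 1)) * (lineConst (2 + a) + lineConst (2 - ρ)))) := by
          gcongr
          linarith
      _ = _ := by ring
  · intro hν0
    have h1 := norm_modeSeries_le_of_bound (B := K / (t ^ (-ρ) + l) ^ 2) (r := 2 - ρ) hadm hα hγ hρ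
      hν hl ht0 (by linarith [hρ.2]) (fun y => by
        refine ((hK _ _ hadm (by simp) l hl).2 hν0).trans ?_
        rw [div_mul_eq_mul_div]
        gcongr)
    rw [hct] at h1
    have h2 := hpow (2 - ρ) (by linarith [hρ.2])
    rw [show 2 - ρ - 1 - 2 = -ρ - 1 by ring] at h2
    refine le_of_mul_le_mul_left (h1.trans ?_) ht2
    calc _ ≤ Real.exp κ * (K / (t ^ (-ρ) + l) ^ 2 *
          ((t ^ 2 * t ^ (-ρ - 1)) * (lineConst (2 + a) + lineConst (2 - ρ)))) := by
          gcongr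
          linarith
      _ = _ := by ring

/-- Joint continuity is read off the inversion integral: a single line serves every l, and the
integrand has a majorant locally uniform in t. -/
theorem modeSeries_continuousOn (hα : 0 < α) (hγ : 0 ≤ γ) (hρ : ρ ∈ Ioo (0 : ℝ) 1)
    (hν : ν ∈ Icc (0 : ℝ) 1) (ω : ℝ) :
    ContinuousOn (fun p : ℝ × ℝ => modeSeries α ω γ ρ ν p.1 p.2) (Ici 0 ×ˢ Ioi 0) := by
  obtain ⟨c, h⟩ := (eventually_admissible (ω := ω) (γ := γ) hα hρ.2).exists
  obtain ⟨K, hK0, hK⟩ := modeSymbolDeriv₂_bound (ω := ω) hα hγ hρ hν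
  set a := ν * (1 - ρ) with ha
  have ha0 : 0 ≤ a := mul_nonneg hν.1 (by linarith [hρ.2])
  have hQ := modeSymbolDeriv₂_continuous (ν := ν) h hα hγ hρ
  have hc0 : 0 < c ^ ρ := Real.rpow_pos_of_pos h.pos ρ
  have hI : ∀ T : ℝ, ContinuousOn (fun p : ℝ × ℝ => ∫ y : ℝ, Complex.exp ((c + y * Complex.I) * p.2) *
      modeSymbolDeriv₂ α ω γ ρ ν p.1 (c + y * Complex.I)) (Ici 0 ×ˢ Ioo 0 T) := by
    intro T
    refine continuousOn_of_dominated (bound := fun y : ℝ => Real.exp (c * T) *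
      (K / c ^ ρ * ‖(c : ℂ) + y * Complex.I‖ ^ (-(2 + a)))) (fun p hp => ?_) (fun p hp => ?_)
      (((line_integrable (by linarith) h.pos).1.const_mul _).const_mul _) ?_
    · refine Continuous.aestronglyMeasurable (Continuous.mul (by fun_prop) ?_)
      exact hQ.comp_continuous (f := fun y : ℝ => (p.1, y)) (by fun_prop) fun y => ⟨hp.1, trivial⟩
    · refine Eventually.of_forall fun y => ?_
      rw [norm_mul, Complex.norm_exp]
      have e : (((c : ℂ) + y * Complex.I) * p.2).re = c * p.2 := by simp
      rw [e]
      have h1 : (0:ℝ) ≤ p.1 := hp.1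
      have h2 := (hK ((c : ℂ) + y * Complex.I) c h (by simp) p.1 h1).1
      have h3 := hp.2.2
      have h4 := h.pos
      refine mul_le_mul (by gcongr) (h2.trans ?_) (norm_nonneg _) (Real.exp_pos _).le
      rw [div_mul_eq_mul_div]
      gcongr
      linarith
    · refine Eventually.of_forall fun y => ContinuousOn.mul (by fun_prop) ?_
      exact hQ.comp (f := fun p : ℝ × ℝ => (p.1, y)) (by fun_prop) fun p hp => ⟨hp.1, trivial⟩
  have hre : ContinuousOn (fun p : ℝ × ℝ => ((p.2 : ℂ) ^ 2)⁻¹ * ((1 / (2 * Real.pi) : ℂ) *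
      ∫ y : ℝ, Complex.exp ((c + y * Complex.I) * p.2) *
      modeSymbolDeriv₂ α ω γ ρ ν p.1 (c + y * Complex.I))) (Ici 0 ×ˢ Ioi 0) := by
    refine ContinuousOn.mul (ContinuousOn.inv₀ (by fun_prop) fun p hp => ?_)
      (continuousOn_const.mul ?_)
    · have : (0:ℝ) < p.2 := hp.2
      exact pow_ne_zero 2 (by exact_mod_cast this.ne')
    · intro p hp
      have hp2 : (0:ℝ) < p.2 := hp.2
      have := hI (p.2 + 1) p ⟨hp.1, hp2, by linarith⟩
      refine this.mono_of_mem_nhdsWithin ?_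
      have h1 : (univ ×ˢ Iio (p.2 + 1) : Set (ℝ × ℝ)) ∈ 𝓝 p :=
        prod_mem_nhds univ_mem (Iio_mem_nhds (by linarith))
      filter_upwards [mem_nhdsWithin_of_mem_nhds h1, self_mem_nhdsWithin] with x hx1 hx2
      exact ⟨hx2.1, hx2.2, hx1.2⟩
  have hfin := Complex.continuous_re.comp_continuousOn hre
  refine hfin.congr fun p hp => ?_
  have hp2 : (0:ℝ) < p.2 := hp.2
  have e := modeSeries_eq_integral (ν := ν) h hα hγ hρ hν hp.1 hp2
  have hne : (p.2 : ℂ) ^ 2 ≠ 0 := pow_ne_zero 2 (by exact_mod_cast hp2.ne')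
  simp only [Function.comp]
  rw [← e, inv_mul_cancel_left₀ hne, Complex.ofReal_re]

end Bromwich

/-! ### Fourier transforms on the line and the resolvent kernel. -/

section Fourier

open FourierTransform

theorem norm_cexp_I_mul (k x : ℝ) : ‖Complex.exp (Complex.I * k * x)‖ = 1 := by
  rw [Complex.norm_exp]; simp

theorem norm_cexp_neg_I_mul (k x : ℝ) : ‖Complex.exp (-Complex.I * k * x)‖ = 1 := by
  rw [Complex.norm_exp]; simp

theorem fourierTransform_eq_fourier (g : ℝ → ℂ) (k : ℝ) :
    fourierTransform g k = 𝓕 g (-(2 * Real.pi)⁻¹ * k) := by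
  rw [fourierTransform, Real.fourier_eq']
  congr 1 with x
  rw [smul_eq_mul, mul_comm]
  congr 2
  have : (Real.pi : ℂ) ≠ 0 := by exact_mod_cast Real.pi_ne_zero
  simp
  field_simp

theorem fourierTransform_eq_fourierInv (g : ℝ → ℂ) :
    𝓕⁻ g = fun w => fourierTransform g (2 * Real.pi * w) := by
  ext w
  rw [fourierTransform, Real.fourierInv_eq']
  congr 1 with x
  rw [smul_eq_mul, mul_comm]
  congr 2
  simp
  ring

theorem inverseFourierTransform_eq_fourier_scaled (h : ℝ → ℂ) (x : ℝ) :
    inverseFourierTransform h x = 𝓕 (fun w => h (2 * Real.pi * w)) x := by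
  have h1 := Measure.integral_comp_mul_left
    (fun k : ℝ => h k * Complex.exp (-Complex.I * k * x)) (2 * Real.pi)
  rw [abs_of_pos (by positivity), Complex.real_smul] at h1
  rw [inverseFourierTransform, Real.fourier_eq']
  convert h1.symm using 1
  · push_cast; rw [one_div]
  · congr 1 with k
    rw [smul_eq_mul, mul_comm]
    congr 2
    simp
    ring

theorem inverseFourierTransform_fourierTransform {g : ℝ → ℂ} (hc : Continuous g)
    (hi : Integrable g) (hf : Integrable (fourierTransform g)) (x : ℝ) :
    inverseFourierTransform (fourierTransform g) x = g x := by
  rw [inverseFourierTransform_eq_fourier_scaled, ← fourierTransform_eq_fourierInv]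
  refine hi.fourier_fourierInv_eq ?_ hc.continuousAt
  have h1 : 𝓕 g = fun w => fourierTransform g (-(2 * Real.pi) * w) := by
    ext w
    rw [fourierTransform_eq_fourier]
    have := Real.pi_ne_zero
    field_simp
  rw [h1]
  exact hf.comp_mul_left' (by simp)

theorem norm_inverseFourierTransform_le (h : ℝ → ℂ) (x : ℝ) :
    ‖inverseFourierTransform h x‖ ≤ ∫ k : ℝ, ‖h k‖ := by
  rw [inverseFourierTransform, norm_mul]
  have h2 : ‖(1 / (2 * Real.pi) : ℂ)‖ ≤ 1 := by
    rw [norm_div, norm_one, norm_mul, Complex.norm_real, Real.norm_of_nonneg Real.pi_pos.le,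
      div_le_one (by norm_num; exact Real.pi_pos)]
    have := Real.pi_gt_three
    norm_num
    linarith
  calc _ ≤ 1 * ‖∫ k : ℝ, h k * Complex.exp (-Complex.I * k * x)‖ := by gcongr
    _ ≤ ∫ k : ℝ, ‖h k * Complex.exp (-Complex.I * k * x)‖ := by
        rw [one_mul]; exact norm_integral_le_integral_norm _
    _ = _ := by simp_rw [norm_mul, norm_cexp_neg_I_mul, mul_one]

theorem fourierTransform_continuous {g : ℝ → ℂ} (hi : Integrable g) :
    Continuous (fourierTransform g) := by
  refine continuous_of_dominated (bound := fun x => ‖g x‖) (fun k => ?_) (fun k => ?_) hi.norm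
    (Eventually.of_forall fun x => by fun_prop)
  · exact hi.aestronglyMeasurable.mul (by fun_prop : Continuous fun x : ℝ =>
      Complex.exp (Complex.I * k * x)).aestronglyMeasurable
  · exact Eventually.of_forall fun x => by rw [norm_mul, norm_cexp_I_mul, mul_one]

theorem fourierTransform_convolution {f g : ℝ → ℂ} (hf : Integrable f) (hg : Integrable g)
    (k : ℝ) : fourierTransform (convolution f g (ContinuousLinearMap.mul ℂ ℂ) volume) k =
      fourierTransform f k * fourierTransform g k := by
  rw [fourierTransform_eq_fourier, fourierTransform_eq_fourier, fourierTransform_eq_fourier]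
  exact Real.fourier_mul_convolution_eq hf hg _

theorem integral_norm_convolution_le {f g : ℝ → ℂ} (hf : Integrable f) (hg : Integrable g) :
    ∫ x, ‖convolution f g (ContinuousLinearMap.mul ℂ ℂ) volume x‖ ≤
      (∫ x, ‖f x‖) * ∫ x, ‖g x‖ := by
  have h := integral_convolution (ContinuousLinearMap.mul ℝ ℝ) hf.norm hg.norm
  rw [ContinuousLinearMap.mul_apply'] at h
  rw [← h]
  refine integral_mono_ae (hf.integrable_convolution _ hg).norm
    (hf.norm.integrable_convolution _ hg.norm) (Eventually.of_forall fun x => ?_)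
  refine (norm_integral_le_integral_norm _).trans (le_of_eq ?_)
  simp [convolution]

/-- The fundamental solution `e^{-σ|x|}` of the resolvent equation, unnormalised. -/
def expKernel (σ : ℂ) (x : ℝ) : ℂ := Complex.exp (-σ * |x|)

/-- A general exponent τ covers both uses: τ = ik gives the Fourier transform, τ = 0 the integral.
-/
theorem expKernel_integral {σ τ : ℂ} (h1 : 0 < (σ - τ).re) (h2 : 0 < (σ + τ).re) :
    Integrable (fun x : ℝ => expKernel σ x * Complex.exp (τ * x)) ∧
    ∫ x : ℝ, expKernel σ x * Complex.exp (τ * x) = 1 / (σ - τ) + 1 / (σ + τ) := by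
  have e1 : EqOn (fun x : ℝ => expKernel σ x * Complex.exp (τ * x))
      (fun x : ℝ => Complex.exp ((τ - σ) * x)) (Ioi 0) := by
    intro x hx
    have : (0:ℝ) < x := hx
    simp only [expKernel]
    rw [abs_of_pos this, ← Complex.exp_add]
    congr 1
    ring
  have e2 : EqOn (fun x : ℝ => expKernel σ x * Complex.exp (τ * x))
      (fun x : ℝ => Complex.exp ((σ + τ) * x)) (Iic 0) := by
    intro x hx
    have : x ≤ 0 := hx
    simp only [expKernel]
    rw [abs_of_nonpos this, ← Complex.exp_add]
    congr 1
    push_cast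
    ring
  have h1' : (τ - σ).re < 0 := by
    rw [Complex.sub_re] at h1 ⊢
    linarith
  have i1 := (integrableOn_exp_mul_complex_Ioi h1' 0).congr_fun e1.symm measurableSet_Ioi
  have i2 := (integrableOn_exp_mul_complex_Iic h2 0).congr_fun e2.symm measurableSet_Iic
  have hint : Integrable (fun x : ℝ => expKernel σ x * Complex.exp (τ * x)) := by
    rw [← integrableOn_univ, ← Iic_union_Ioi (a := (0:ℝ))]
    exact i2.union i1
  refine ⟨hint, ?_⟩
  rw [← intervalIntegral.integral_Iic_add_Ioi i2 i1, setIntegral_congr_fun measurableSet_Ioi e1,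
    setIntegral_congr_fun measurableSet_Iic e2, integral_exp_mul_complex_Ioi h1',
    integral_exp_mul_complex_Iic h2]
  simp only [Complex.ofReal_zero, mul_zero, Complex.exp_zero]
  rw [← neg_sub σ τ, neg_div_neg_eq, add_comm]

theorem expKernel_fourierTransform {σ : ℂ} (hσ : 0 < σ.re) (k : ℝ) :
    fourierTransform (expKernel σ) k = 2 * σ / (σ ^ 2 + (k : ℂ) ^ 2) := by
  have h1 : 0 < (σ - Complex.I * k).re := by simpa using hσ
  have h2 : 0 < (σ + Complex.I * k).re := by simpa using hσ
  rw [fourierTransform, (expKernel_integral h1 h2).2]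
  have n1 : σ - Complex.I * k ≠ 0 := fun h => by rw [h] at h1; simp at h1
  have n2 : σ + Complex.I * k ≠ 0 := fun h => by rw [h] at h2; simp at h2
  have e : σ ^ 2 + (k : ℂ) ^ 2 = (σ - Complex.I * k) * (σ + Complex.I * k) := by
    linear_combination (k : ℂ) ^ 2 * Complex.I_sq
  rw [e]
  field_simp
  ring

theorem expKernel_norm {σ : ℂ} (hσ : 0 < σ.re) :
    Integrable (expKernel σ) ∧ ∫ x : ℝ, ‖expKernel σ x‖ = 2 / σ.re := by
  have hi : Integrable (expKernel σ) := by
    have := (expKernel_integral (σ := σ) (τ := 0) (by simpa using hσ) (by simpa using hσ)).1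
    simpa using this
  refine ⟨hi, ?_⟩
  have h := (expKernel_integral (σ := (σ.re : ℂ)) (τ := 0) (by simpa using hσ)
    (by simpa using hσ)).2
  have e : ∀ x : ℝ, expKernel (σ.re : ℂ) x * Complex.exp (0 * x) = ((‖expKernel σ x‖ : ℝ) : ℂ) := by
    intro x
    rw [expKernel, expKernel, Complex.norm_exp]
    simp
  simp_rw [e] at h
  rw [integral_complex_ofReal] at h
  have h3 : (1 / ((σ.re : ℂ) - 0) + 1 / ((σ.re : ℂ) + 0)) = ((2 / σ.re : ℝ) : ℂ) := by
    push_cast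
    ring
  rw [h3] at h
  exact_mod_cast h

/-- The principal square root of w has argument within π/4 of 0, so its modulus is comparable with
its real part. -/
theorem sqrt_facts {w : ℂ} (hw : 0 < w.re) : ∃ σ : ℂ, σ ^ 2 = w ∧ 0 < σ.re ∧
    1 / (‖σ‖ * σ.re) ≤ 2 / ‖w‖ := by
  have hw0 : w ≠ 0 := fun h => by rw [h] at hw; simp at hw
  set σ := w ^ (1 / 2 : ℂ) with hσ
  have hsq : σ ^ 2 = w := by
    rw [hσ, ← Complex.cpow_nat_mul]
    norm_num
  have hre : 0 < σ.re := by
    rw [hσ, Complex.cpow_def_of_ne_zero hw0, Complex.exp_re]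
    refine mul_pos (Real.exp_pos _) (Real.cos_pos_of_mem_Ioo ?_)
    have him : (Complex.log w * (1 / 2)).im = w.arg / 2 := by
      rw [mul_one_div, Complex.div_ofNat_im, Complex.log_im]
    rw [him]
    have h1 := Complex.abs_arg_le_pi_div_two_iff.2 hw.le
    have := Real.pi_pos
    rw [abs_le] at h1
    constructor <;> linarith
  refine ⟨σ, hsq, hre, ?_⟩
  have hn : 0 < ‖σ‖ := norm_pos_iff.2 fun h => by rw [h] at hre; simp at hre
  have hw2 : ‖w‖ = ‖σ‖ ^ 2 := by rw [← hsq, norm_pow]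
  have h3 : ‖σ‖ ≤ 2 * σ.re := by
    have h4 : 0 < σ.re ^ 2 - σ.im ^ 2 := by
      have : w.re = σ.re ^ 2 - σ.im ^ 2 := by rw [← hsq, sq]; simp [Complex.mul_re]; ring
      linarith
    have h5 : ‖σ‖ ^ 2 = σ.re ^ 2 + σ.im ^ 2 := by
      rw [Complex.sq_norm, Complex.normSq_apply]; ring
    nlinarith
  rw [hw2, div_le_div_iff₀ (by positivity) (by positivity)]
  nlinarith

/-- Continuous integrable functions with integrable Fourier transform. -/
structure FourierPair (g : ℝ → ℂ) : Prop where
  cont : Continuous g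
  int : Integrable g
  fourier : Integrable (fourierTransform g)

theorem FourierPair.bddAbove {g : ℝ → ℂ} (hg : FourierPair g) :
    BddAbove (range fun x => ‖g x‖) := by
  refine ⟨∫ k, ‖fourierTransform g k‖, ?_⟩
  rintro _ ⟨x, rfl⟩
  simp only
  rw [← inverseFourierTransform_fourierTransform hg.cont hg.int hg.fourier x]
  exact norm_inverseFourierTransform_le _ _

/-- With σ² = z/M and Re σ > 0, e^{-σ|x|}/(2Mσ) is the Green function of z - M ∂ₓ², and f is its
convolution with g. Its L¹ norm is 1/(M |σ| Re σ) ≤ 2/|z|. As f is again a `FourierPair`, the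
construction can be iterated. -/
theorem resolvent_l1 {M : ℝ} (hM : 0 < M) {z : ℂ} (hz : 0 < z.re) {g : ℝ → ℂ}
    (hg : FourierPair g) : ∃ f : ℝ → ℂ, FourierPair f ∧
      (∀ k : ℝ, fourierTransform f k = fourierTransform g k * (1 / (z + (M * k ^ 2 : ℝ)))) ∧
      ∫ x, ‖f x‖ ≤ 2 / ‖z‖ * ∫ x, ‖g x‖ := by
  have hMc : (M : ℂ) ≠ 0 := by exact_mod_cast hM.ne'
  have hzM : 0 < (z / M).re := by rw [Complex.div_ofReal_re]; positivity
  obtain ⟨σ, hsq, hre, hσ⟩ := sqrt_facts hzM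
  have hσ0 : σ ≠ 0 := fun h => by rw [h] at hre; simp at hre
  obtain ⟨he1, he2⟩ := expKernel_norm hre
  set e : ℝ → ℂ := fun x => 1 / (2 * M * σ) * expKernel σ x with he
  have hei : Integrable e := he1.const_mul _
  have hz0 : ∀ k : ℝ, z + (M * k ^ 2 : ℝ) ≠ 0 := by
    intro k h
    have := congrArg Complex.re h
    rw [Complex.add_re, Complex.ofReal_re, Complex.zero_re] at this
    have : 0 ≤ M * k ^ 2 := by positivity
    linarith
  have hft : ∀ k : ℝ, fourierTransform e k = 1 / (z + (M * k ^ 2 : ℝ)) := by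
    intro k
    have h1 : fourierTransform e k = 1 / (2 * M * σ) * fourierTransform (expKernel σ) k := by
      rw [fourierTransform, fourierTransform, ← integral_const_mul]
      congr 1 with x
      rw [he]; ring
    have h2 : z + (M * k ^ 2 : ℝ) = M * (σ ^ 2 + (k : ℂ) ^ 2) := by
      rw [hsq]; push_cast; field_simp
    have h3 := hz0 k
    rw [h1, expKernel_fourierTransform hre, h2]
    rw [h2] at h3
    have h4 := right_ne_zero_of_mul h3
    field_simp
  have hnorm : ∫ x, ‖e x‖ ≤ 2 / ‖z‖ := by
    have h1 : ∫ x, ‖e x‖ = 1 / M * (1 / (‖σ‖ * σ.re)) := by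
      simp_rw [he, norm_mul]
      rw [integral_const_mul, he2]
      rw [norm_div, norm_one, norm_mul, norm_mul, Complex.norm_real, Real.norm_of_nonneg hM.le]
      norm_num
      field_simp
    rw [h1]
    rw [norm_div, Complex.norm_real, Real.norm_of_nonneg hM.le] at hσ
    calc _ ≤ 1 / M * (2 / (‖z‖ / M)) := by gcongr
      _ = _ := by field_simp
  refine ⟨convolution e g (ContinuousLinearMap.mul ℂ ℂ) volume, ⟨?_, ?_, ?_⟩, ?_, ?_⟩
  · exact hg.bddAbove.continuous_convolution_right_of_integrable _ hei hg.cont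
  · exact hei.integrable_convolution _ hg.int
  · have h1 : ∀ k, fourierTransform (convolution e g (ContinuousLinearMap.mul ℂ ℂ) volume) k =
        fourierTransform e k * fourierTransform g k := fourierTransform_convolution hei hg.int
    refine Integrable.mono' (hg.fourier.norm.const_mul (∫ x, ‖e x‖))
      (fourierTransform_continuous (hei.integrable_convolution _ hg.int)).aestronglyMeasurable
      (Eventually.of_forall fun k => ?_)
    rw [h1, norm_mul]
    gcongr
    refine (norm_integral_le_integral_norm _).trans (le_of_eq ?_)
    simp_rw [norm_mul, norm_cexp_I_mul, mul_one]
  · intro k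
    rw [fourierTransform_convolution hei hg.int, hft, mul_comm]
  · refine (integral_norm_convolution_le hei hg.int).trans ?_
    gcongr

end Fourier

/-! ### L¹ bounds in space for the inverse transformed symbol. -/

section SpatialL1

variable {α ω γ ρ ν c M : ℝ}

theorem integrable_fourier_mul {g : ℝ → ℂ} (hg : FourierPair g) {m : ℝ → ℂ} {B : ℝ}
    (hm : AEStronglyMeasurable m) (hB : ∀ k, ‖m k‖ ≤ B) :
    Integrable fun k => fourierTransform g k * m k := by
  refine Integrable.mono' (hg.fourier.norm.mul_const B)
    (hg.fourier.aestronglyMeasurable.mul hm) (Eventually.of_forall fun k => ?_)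
  rw [norm_mul]
  gcongr
  exact hB k

theorem inverseFourierTransform_add {f g : ℝ → ℂ} (hf : Integrable f) (hg : Integrable g) (x : ℝ) :
    inverseFourierTransform (fun k => f k + g k) x =
      inverseFourierTransform f x + inverseFourierTransform g x := by
  have h : ∀ {f : ℝ → ℂ}, Integrable f →
      Integrable fun k : ℝ => f k * Complex.exp (-Complex.I * k * x) := by
    intro f hf
    refine Integrable.mono' hf.norm (hf.aestronglyMeasurable.mul (by fun_prop : Continuous
      fun k : ℝ => Complex.exp (-Complex.I * k * x)).aestronglyMeasurable)
      (Eventually.of_forall fun k => ?_)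
    rw [norm_mul, norm_cexp_neg_I_mul, mul_one]
  simp_rw [inverseFourierTransform, add_mul]
  rw [integral_add (h hf) (h hg), mul_add]

theorem inverseFourierTransform_const_mul (a : ℂ) (f : ℝ → ℂ) (x : ℝ) :
    inverseFourierTransform (fun k => a * f k) x = a * inverseFourierTransform f x := by
  simp_rw [inverseFourierTransform, mul_assoc]
  rw [integral_const_mul, mul_left_comm]

/-- The powers of 1/(Φ + M k²) up to the third correspond to iterated resolvents of g. Each
resolvent costs 2/|Φ| and the accompanying powers of Φ cancel all but one of these, so |s|^{-ρ} is
gained over the prefactor. -/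
theorem modeSymbolDeriv₂_l1 (hα : 0 < α) (hγ : 0 ≤ γ) (hρ : ρ ∈ Ioo (0 : ℝ) 1)
    (hν : ν ∈ Icc (0 : ℝ) 1) (hM : 0 < M) {g : ℝ → ℂ} (hg : FourierPair g) :
    ∃ K : ℝ, 0 ≤ K ∧ ∀ s : ℂ, ∀ c, Admissible α ω γ ρ c → c ≤ s.re →
      Integrable (inverseFourierTransform fun k => fourierTransform g k *
        modeSymbolDeriv₂ α ω γ ρ ν (M * k ^ 2) s) ∧
      ∫ x, ‖inverseFourierTransform (fun k => fourierTransform g k *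
        modeSymbolDeriv₂ α ω γ ρ ν (M * k ^ 2) s) x‖ ≤ K * ‖s‖ ^ (-(2 + ν * (1 - ρ) + ρ)) := by
  obtain ⟨B, hB0, hB⟩ := coeff_bound (α := α) (ω := ω) (γ := γ) (ρ := ρ) (ν := ν) hα
  -- 14 = 2 + 4 + 8, from one, two and three resolvents.
  refine ⟨2 ^ γ * (14 * B * 2 ^ γ * ∫ x, ‖g x‖), by positivity, fun s c h hs => ?_⟩
  obtain ⟨hb0, hb1, hb2⟩ := hB s c h hs
  have hpre := norm_symbol_prefactor_le h hα hγ hν hs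
  have hre := h.symbol_re_pos hα hγ hρ hs
  have hΦn := le_norm_prabhakarSymbol (μ := -ρ) h hα hs (neg_nonpos.2 hγ)
  rw [neg_neg, neg_neg] at hΦn
  have hs0 : 0 < ‖s‖ := norm_pos_iff.2 (ne_zero_of_re h.pos hs)
  simp_rw [modeSymbolDeriv₂]
  set Φ := prabhakarSymbol α ω (-ρ) (-γ) s with hΦ
  set A := prabhakarSymbol α ω (ν * (1 - ρ)) (-(γ * ν)) s / s ^ 2 with hA
  set b0 := coeffZero α γ ρ ν (symbolFactor α ω s)
  set b1 := coeffOne α γ ρ ν (symbolFactor α ω s)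
  set b2 := coeffTwo α γ ρ (symbolFactor α ω s)
  have hΦ0 : 0 < ‖Φ‖ := norm_pos_iff.2 fun h => by rw [h] at hre; simp at hre
  obtain ⟨f1, hf1, hf1t, hf1n⟩ := resolvent_l1 hM hre hg
  obtain ⟨f2, hf2, hf2t, hf2n⟩ := resolvent_l1 hM hre hf1
  obtain ⟨f3, hf3, hf3t, hf3n⟩ := resolvent_l1 hM hre hf2
  have e : (inverseFourierTransform fun k => fourierTransform g k * (A *
      (b0 * (1 / (Φ + (M * k ^ 2 : ℝ))) + b1 * (Φ * (1 / (Φ + (M * k ^ 2 : ℝ))) ^ 2) +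
        b2 * (Φ ^ 2 * (1 / (Φ + (M * k ^ 2 : ℝ))) ^ 3)))) =
      fun x => A * b0 * f1 x + A * b1 * Φ * f2 x + A * b2 * Φ ^ 2 * f3 x := by
    ext x
    have e1 : ∀ k : ℝ, fourierTransform g k * (A *
      (b0 * (1 / (Φ + (M * k ^ 2 : ℝ))) + b1 * (Φ * (1 / (Φ + (M * k ^ 2 : ℝ))) ^ 2) +
        b2 * (Φ ^ 2 * (1 / (Φ + (M * k ^ 2 : ℝ))) ^ 3))) =
        A * b0 * fourierTransform f1 k + A * b1 * Φ * fourierTransform f2 k +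
          A * b2 * Φ ^ 2 * fourierTransform f3 k := by
      intro k
      rw [hf3t, hf2t, hf1t]
      ring
    simp_rw [e1]
    have j : Integrable fun k => A * b0 * fourierTransform f1 k +
        A * b1 * Φ * fourierTransform f2 k :=
      (hf1.fourier.const_mul _).add (hf2.fourier.const_mul _)
    rw [inverseFourierTransform_add j (hf3.fourier.const_mul _), inverseFourierTransform_add (hf1.fourier.const_mul _)
      (hf2.fourier.const_mul _), inverseFourierTransform_const_mul,
      inverseFourierTransform_const_mul, inverseFourierTransform_const_mul,
      inverseFourierTransform_fourierTransform hf1.cont hf1.int hf1.fourier,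
      inverseFourierTransform_fourierTransform hf2.cont hf2.int hf2.fourier,
      inverseFourierTransform_fourierTransform hf3.cont hf3.int hf3.fourier]
  rw [e]
  have i1 := hf1.int.const_mul (A * b0)
  have i2 := hf2.int.const_mul (A * b1 * Φ)
  have i3 := hf3.int.const_mul (A * b2 * Φ ^ 2)
  refine ⟨(i1.add i2).add i3, ?_⟩
  have hle : ∫ x, ‖A * b0 * f1 x + A * b1 * Φ * f2 x + A * b2 * Φ ^ 2 * f3 x‖ ≤
      ‖A * b0‖ * (∫ x, ‖f1 x‖) + ‖A * b1 * Φ‖ * (∫ x, ‖f2 x‖) +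
        ‖A * b2 * Φ ^ 2‖ * ∫ x, ‖f3 x‖ := by
    have j : Integrable fun x => ‖A * b0‖ * ‖f1 x‖ + ‖A * b1 * Φ‖ * ‖f2 x‖ :=
      (hf1.int.norm.const_mul _).add (hf2.int.norm.const_mul _)
    rw [← integral_const_mul, ← integral_const_mul, ← integral_const_mul,
      ← integral_add (hf1.int.norm.const_mul _) (hf2.int.norm.const_mul _),
      ← integral_add j (hf3.int.norm.const_mul _)]
    refine integral_mono ((i1.add i2).add i3).norm (((hf1.int.norm.const_mul _).add
      (hf2.int.norm.const_mul _)).add (hf3.int.norm.const_mul _)) fun x => ?_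
    refine norm_add₃_le.trans (le_of_eq ?_)
    simp only [norm_mul]
  refine hle.trans ?_
  set N := ∫ x, ‖g x‖ with hN
  have hN0 : 0 ≤ N := integral_nonneg fun _ => norm_nonneg _
  have n1 : ∫ x, ‖f1 x‖ ≤ 2 / ‖Φ‖ * N := hf1n
  have n2 : ∫ x, ‖f2 x‖ ≤ 2 / ‖Φ‖ * (2 / ‖Φ‖ * N) := hf2n.trans (by gcongr)
  have n3 : ∫ x, ‖f3 x‖ ≤ 2 / ‖Φ‖ * (2 / ‖Φ‖ * (2 / ‖Φ‖ * N)) := hf3n.trans (by gcongr)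
  have hΦi : 1 / ‖Φ‖ ≤ 2 ^ γ * ‖s‖ ^ (-ρ) := by
    rw [Real.rpow_neg hs0.le]
    have h1 : (1 / 2 : ℝ) ^ γ = (2 ^ γ)⁻¹ := by rw [one_div, Real.inv_rpow (by norm_num)]
    rw [h1] at hΦn
    have h2 : (0:ℝ) < 2 ^ γ := by positivity
    have h3 : 0 < ‖s‖ ^ ρ := by positivity
    calc 1 / ‖Φ‖ ≤ 1 / ((2 ^ γ)⁻¹ * ‖s‖ ^ ρ) := by gcongr
      _ = _ := by field_simp
  calc _ ≤ ‖A‖ * B * (2 / ‖Φ‖ * N) + ‖A‖ * B * ‖Φ‖ * (2 / ‖Φ‖ * (2 / ‖Φ‖ * N)) +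
        ‖A‖ * B * ‖Φ‖ ^ 2 * (2 / ‖Φ‖ * (2 / ‖Φ‖ * (2 / ‖Φ‖ * N))) := by
        simp only [norm_mul, norm_pow]
        gcongr
    _ = ‖A‖ * (14 * B * N * (1 / ‖Φ‖)) := by field_simp; ring
    _ ≤ (2 ^ γ * ‖s‖ ^ (-(2 + ν * (1 - ρ)))) * (14 * B * N * (2 ^ γ * ‖s‖ ^ (-ρ))) := by gcongr
    _ = 2 ^ γ * (14 * B * 2 ^ γ * N) * ‖s‖ ^ (-(2 + ν * (1 - ρ) + ρ)) := by
        rw [neg_add _ ρ, Real.rpow_add hs0]; ring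

end SpatialL1

/-! ### Time-dependent Fourier multipliers. -/

section Multipliers

/-- Time-dependent Fourier multipliers, continuous for `t > 0` and bounded uniformly in the
frequency for `t` in compact subsets of `(0, ∞)`. -/
structure TimeMultiplier (m : ℝ → ℝ → ℂ) : Prop where
  cont : ContinuousOn (fun p : ℝ × ℝ => m p.1 p.2) (univ ×ˢ Ioi 0)
  bound : ∀ s T : ℝ, 0 < s → ∃ C : ℝ, ∀ k, ∀ t ∈ Icc s T, ‖m k t‖ ≤ C

/-- The function with spatial Fourier transform `g*(k) m(k, t)`. -/
def multiplierIntegral (g : ℝ → ℂ) (m : ℝ → ℝ → ℂ) (x t : ℝ) : ℂ :=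
  inverseFourierTransform (fun k => fourierTransform g k * m k t) x

variable {g : ℝ → ℂ} {m : ℝ → ℝ → ℂ}

theorem TimeMultiplier.continuous_left (hm : TimeMultiplier m) {t : ℝ} (ht : 0 < t) :
    Continuous fun k => m k t :=
  hm.cont.comp_continuous (f := fun k : ℝ => (k, t)) (by fun_prop) fun _ => ⟨mem_univ _, ht⟩

theorem TimeMultiplier.continuousOn_right (hm : TimeMultiplier m) (k : ℝ) :
    ContinuousOn (m k) (Ioi 0) :=
  hm.cont.comp (f := fun t : ℝ => (k, t)) (by fun_prop) fun _ ht => ⟨mem_univ _, ht⟩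

theorem TimeMultiplier.integrable (hm : TimeMultiplier m) (hg : FourierPair g) {t : ℝ}
    (ht : 0 < t) : Integrable fun k => fourierTransform g k * m k t := by
  obtain ⟨C, hC⟩ := hm.bound t t ht
  exact integrable_fourier_mul hg (hm.continuous_left ht).aestronglyMeasurable
    fun k => hC k t ⟨le_rfl, le_rfl⟩

theorem TimeMultiplier.continuousOn_integral (hm : TimeMultiplier m) (hg : FourierPair g) :
    ContinuousOn (fun p : ℝ × ℝ => multiplierIntegral g m p.1 p.2) (univ ×ˢ Ioi 0) := by
  rintro ⟨x, t⟩ ⟨-, ht⟩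
  have ht : 0 < t := ht
  obtain ⟨C, hC⟩ := hm.bound (t / 2) (2 * t) (by linarith)
  have hnear : ∀ᶠ p : ℝ × ℝ in 𝓝 (x, t), p.2 ∈ Icc (t / 2) (2 * t) :=
    continuous_snd.continuousAt (Icc_mem_nhds (by linarith : t / 2 < t) (by linarith : t < 2 * t))
  refine ContinuousAt.continuousWithinAt ?_
  refine ContinuousAt.mul continuousAt_const ?_
  refine continuousAt_of_dominated (bound := fun k => ‖fourierTransform g k‖ * C) ?_ ?_
    (hg.fourier.norm.mul_const C) ?_
  · filter_upwards [hnear] with p hp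
    exact ((hm.integrable hg (by linarith [hp.1])).aestronglyMeasurable).mul
      (by fun_prop : Continuous fun k : ℝ =>
        Complex.exp (-Complex.I * k * p.1)).aestronglyMeasurable
  · filter_upwards [hnear] with p hp
    refine Eventually.of_forall fun k => ?_
    rw [norm_mul, norm_mul, norm_cexp_neg_I_mul, mul_one]
    gcongr
    exact hC k p.2 hp
  · refine Eventually.of_forall fun k => ?_
    have h1 : ContinuousAt (fun p : ℝ × ℝ => m p.1 p.2) (k, t) :=
      hm.cont.continuousAt ((isOpen_univ.prod isOpen_Ioi).mem_nhds ⟨mem_univ _, ht⟩)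
    have h2 : ContinuousAt (fun p : ℝ × ℝ => m k p.2) (x, t) :=
      ContinuousAt.comp (f := fun p : ℝ × ℝ => (k, p.2)) (x := (x, t)) h1 (by fun_prop)
    exact (continuousAt_const.mul h2).mul (by fun_prop)

/-- Convolution in time commutes with the inverse Fourier integral. -/
theorem TimeMultiplier.causalConv_integral (hm : TimeMultiplier m) (hg : FourierPair g)
    {w : ℝ → ℂ} (hw : ContinuousOn w (Ioi 0)) {t C : ℝ} (ht : 0 < t)
    (hi : ∀ k, IntervalIntegrable (fun τ => w (t - τ) * m k τ) volume 0 t)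
    (hC : ∀ k, ∫ τ in (0 : ℝ)..t, ‖w (t - τ) * m k τ‖ ≤ C) (x : ℝ) :
    IntervalIntegrable (fun τ => w (t - τ) * multiplierIntegral g m x τ) volume 0 t ∧
    causalConv w (multiplierIntegral g m x) t =
      inverseFourierTransform (fun k => fourierTransform g k * causalConv w (m k) t) x := by
  set Φ : ℝ → ℝ → ℂ := fun k τ => fourierTransform g k * Complex.exp (-Complex.I * k * x) *
    (w (t - τ) * m k τ) with hΦ
  have hmeas : AEStronglyMeasurable (Function.uncurry Φ)
      (volume.prod (volume.restrict (Ioo 0 t))) := by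
    have e : (volume : Measure ℝ).prod (volume.restrict (Ioo 0 t)) =
        (volume.prod volume).restrict (univ ×ˢ Ioo 0 t) := by
      rw [← Measure.prod_restrict, Measure.restrict_univ]
    rw [e]
    refine ContinuousOn.aestronglyMeasurable ?_ (MeasurableSet.univ.prod measurableSet_Ioo)
    refine ContinuousOn.mul ?_ (ContinuousOn.mul ?_ ?_)
    · have := fourierTransform_continuous hg.int
      fun_prop
    · exact hw.comp (f := fun p : ℝ × ℝ => t - p.2) (by fun_prop)
        fun p hp => by simpa using hp.2.2
    · exact hm.cont.mono (prod_mono_right Ioo_subset_Ioi_self)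
  have hi' : ∀ k, IntegrableOn (fun τ => w (t - τ) * m k τ) (Ioo 0 t) := fun k =>
    (intervalIntegrable_iff_integrableOn_Ioo_of_le ht.le).1 (hi k)
  have hint : Integrable (Function.uncurry Φ) (volume.prod (volume.restrict (Ioo 0 t))) := by
    rw [integrable_prod_iff hmeas]
    refine ⟨Eventually.of_forall fun k => by
      simp only [hΦ, Function.uncurry_apply_pair]
      exact (hi' k).const_mul _, ?_⟩
    refine Integrable.mono' (hg.fourier.norm.mul_const C) hmeas.norm.integral_prod_right'
      (Eventually.of_forall fun k => ?_)
    rw [Real.norm_of_nonneg (integral_nonneg fun _ => norm_nonneg _)]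
    simp only [hΦ, Function.uncurry_apply_pair, norm_mul _ (w _ * _)]
    rw [integral_const_mul, norm_mul, norm_cexp_neg_I_mul, mul_one,
      ← integral_Ioc_eq_integral_Ioo, ← intervalIntegral.integral_of_le ht.le]
    gcongr
    exact hC k
  have e1 : ∀ τ, ∫ k, Φ k τ = w (t - τ) * ∫ k : ℝ, fourierTransform g k * m k τ *
      Complex.exp (-Complex.I * k * x) := by
    intro τ
    rw [← integral_const_mul]
    congr 1 with k
    rw [hΦ]; ring
  have e2 : ∀ k, ∫ τ in Ioo 0 t, Φ k τ = fourierTransform g k * causalConv w (m k) t *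
      Complex.exp (-Complex.I * k * x) := by
    intro k
    rw [hΦ, integral_const_mul, causalConv, intervalIntegral.integral_of_le ht.le,
      integral_Ioc_eq_integral_Ioo]
    ring
  have e3 : ∀ τ, w (t - τ) * multiplierIntegral g m x τ =
      (1 / (2 * Real.pi) : ℂ) * ∫ k, Φ k τ := by
    intro τ
    rw [e1, multiplierIntegral, inverseFourierTransform]
    ring
  constructor
  · simp_rw [e3]
    rw [intervalIntegrable_iff_integrableOn_Ioo_of_le ht.le]
    exact hint.integral_prod_right.const_mul _
  · rw [causalConv]
    simp_rw [e3]
    rw [intervalIntegral.integral_const_mul, intervalIntegral.integral_of_le ht.le,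
      integral_Ioc_eq_integral_Ioo, ← integral_integral_swap hint, inverseFourierTransform]
    simp_rw [e2]

end Multipliers

/-! ### The modes as multipliers, with bounds uniform in frequency. -/

section ModeMultipliers

variable {α ω γ ρ ν M : ℝ}

theorem rpow_div_rpow_neg_add_le {a r l t : ℝ} (hl : 0 ≤ l) (ht : 0 < t) :
    t ^ (a - 1) / (t ^ (-r) + l) ≤ t ^ (r + a - 1) ∧
    l * (t ^ (a - 1) / (t ^ (-r) + l)) ≤ t ^ (a - 1) := by
  have h1 : 0 < t ^ (-r) := by positivity
  have h2 : 0 < t ^ (a - 1) := by positivity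
  constructor
  · rw [div_le_iff₀ (by positivity), mul_add, ← Real.rpow_add ht,
      show r + a - 1 + -r = a - 1 by ring]
    have : 0 ≤ t ^ (r + a - 1) * l := by positivity
    linarith
  · rw [← mul_div_assoc, div_le_iff₀ (by positivity)]
    nlinarith

theorem modeSeries_rpow_bound (hα : 0 < α) (hγ : 0 ≤ γ) (hρ : ρ ∈ Ioo (0 : ℝ) 1)
    (hν : ν ∈ Icc (0 : ℝ) 1) (ω T : ℝ) : ∃ C : ℝ, 0 ≤ C ∧ ∀ l : ℝ, 0 ≤ l → ∀ t ∈ Ioc 0 T,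
      |modeSeries α ω γ ρ ν l t| ≤ C * t ^ (ρ + ν * (1 - ρ) - 1) ∧
      l * |modeSeries α ω γ ρ ν l t| ≤ C * t ^ (ν * (1 - ρ) - 1) := by
  obtain ⟨C, hC0, hC⟩ := modeSeries_bound hα hγ hρ hν ω T
  refine ⟨C, hC0, fun l hl t ht => ?_⟩
  have h1 := (hC l hl t ht).1
  obtain ⟨h2, h3⟩ := rpow_div_rpow_neg_add_le (a := ν * (1 - ρ)) (r := ρ) hl ht.1
  rw [mul_div_assoc] at h1
  constructor
  · exact h1.trans (by gcongr)
  · calc _ ≤ l * (C * (t ^ (ν * (1 - ρ) - 1) / (t ^ (-ρ) + l))) := by gcongr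
      _ = C * (l * (t ^ (ν * (1 - ρ) - 1) / (t ^ (-ρ) + l))) := by ring
      _ ≤ _ := by gcongr

theorem modeSeries_continuousOn_right (hα : 0 < α) (hγ : 0 ≤ γ) (hρ : ρ ∈ Ioo (0 : ℝ) 1)
    (hν : ν ∈ Icc (0 : ℝ) 1) (ω : ℝ) {l : ℝ} (hl : 0 ≤ l) :
    ContinuousOn (modeSeries α ω γ ρ ν l) (Ioi 0) :=
  (modeSeries_continuousOn hα hγ hρ hν ω).comp (f := fun t : ℝ => (l, t)) (by fun_prop)
    fun _ ht => ⟨hl, ht⟩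

theorem modeSeries_intervalIntegrable (hα : 0 < α) (hγ : 0 ≤ γ) (hρ : ρ ∈ Ioo (0 : ℝ) 1)
    (hν : ν ∈ Icc (0 : ℝ) 1) (ω : ℝ) {l : ℝ} (hl : 0 ≤ l) {T : ℝ} (hT : 0 < T) :
    IntervalIntegrable (modeSeries α ω γ ρ ν l) volume 0 T := by
  obtain ⟨C, hC0, hC⟩ := modeSeries_rpow_bound hα hγ hρ hν ω T
  have hp := mode_order_pos hρ hν
  have h := (intervalIntegral.intervalIntegrable_rpow' (a := 0) (b := T)
    (by linarith : -1 < ρ + ν * (1 - ρ) - 1)).const_mul C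
  rw [intervalIntegrable_iff_integrableOn_Ioc_of_le hT.le] at h ⊢
  refine Integrable.mono' h (((modeSeries_continuousOn_right hα hγ hρ hν ω hl).mono
    Ioc_subset_Ioi_self).aestronglyMeasurable measurableSet_Ioc) ?_
  exact (ae_restrict_iff' measurableSet_Ioc).2 (Eventually.of_forall fun t ht => (hC l hl t ht).1)

/-- The integrand has primitive -(1/ρ)/(1 + l t^ρ), whose total variation is at most 1/ρ whatever l
and T are. -/
theorem integral_rational_rpow_le (hρ : 0 < ρ) {l T : ℝ} (hl : 0 ≤ l) (hT : 0 < T) :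
    IntervalIntegrable (fun t : ℝ => l * t ^ (ρ - 1) / (1 + l * t ^ ρ) ^ 2) volume 0 T ∧
    ∫ t in (0 : ℝ)..T, l * t ^ (ρ - 1) / (1 + l * t ^ ρ) ^ 2 ≤ 1 / ρ := by
  have hpos : ∀ t : ℝ, 0 ≤ t → 1 ≤ 1 + l * t ^ ρ := fun t ht => by
    have : 0 ≤ l * t ^ ρ := by positivity
    linarith
  have hi : IntervalIntegrable (fun t : ℝ => l * t ^ (ρ - 1) / (1 + l * t ^ ρ) ^ 2) volume 0 T := by
    have h := (intervalIntegral.intervalIntegrable_rpow' (a := 0) (b := T)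
      (by linarith : -1 < ρ - 1)).const_mul l
    simp_rw [div_eq_mul_inv]
    refine h.mul_continuousOn (ContinuousOn.inv₀ ?_ fun t ht => ?_)
    · exact ((continuous_const.add (continuous_const.mul
        (Real.continuous_rpow_const hρ.le))).pow 2).continuousOn
    · rw [uIcc_of_le hT.le] at ht
      have := hpos t ht.1
      positivity
  refine ⟨hi, ?_⟩
  have h := intervalIntegral.integral_eq_sub_of_hasDerivAt_of_le (a := 0) (b := T)
    (f := fun t : ℝ => -(1 / ρ) * (1 + l * t ^ ρ)⁻¹) hT.le ?_ (fun t ht => ?_) hi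
  · rw [h, Real.zero_rpow hρ.ne']
    have h1 := hpos T hT.le
    have h2 : 0 ≤ 1 / ρ * (1 + l * T ^ ρ)⁻¹ := by positivity
    simp only [mul_zero, add_zero, inv_one, mul_one]
    linarith
  · refine ContinuousOn.mul continuousOn_const (ContinuousOn.inv₀ ?_ fun t ht => ?_)
    · exact (continuous_const.add (continuous_const.mul
        (Real.continuous_rpow_const hρ.le))).continuousOn
    · have := hpos t ht.1
      positivity
  · have h1 := hpos t ht.1.le
    have h2 := (((Real.hasDerivAt_rpow_const (p := ρ) (Or.inl ht.1.ne')).const_mul l).const_add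
      1).inv (by positivity)
    refine (h2.const_mul (-(1 / ρ))).congr_deriv ?_
    field_simp

/-- For ν > 0 the pointwise bound C t^{ν(1-ρ)-1} is already integrable at 0. For ν = 0 it
degenerates to C/t, and the estimate with quadratic decay in l is needed: it yields the integrand of
`integral_rational_rpow_le`. -/
theorem mul_modeSeries_l1_bound (hα : 0 < α) (hγ : 0 ≤ γ) (hρ : ρ ∈ Ioo (0 : ℝ) 1)
    (hν : ν ∈ Icc (0 : ℝ) 1) (ω : ℝ) {T : ℝ} (hT : 0 < T) : ∃ C : ℝ, 0 ≤ C ∧ ∀ l : ℝ, 0 ≤ l →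
      ∫ t in (0 : ℝ)..T, l * |modeSeries α ω γ ρ ν l t| ≤ C := by
  have hi := fun {l : ℝ} (hl : 0 ≤ l) =>
    (modeSeries_intervalIntegrable (ν := ν) hα hγ hρ hν ω hl hT).abs.const_mul l
  rcases hν.1.eq_or_lt with h0 | h0
  · obtain ⟨C, hC0, hC⟩ := modeSeries_bound hα hγ hρ hν ω T
    refine ⟨C * (1 / ρ), by have := hρ.1; positivity, fun l hl => ?_⟩
    obtain ⟨i1, i2⟩ := integral_rational_rpow_le hρ.1 hl hT
    calc _ ≤ ∫ t in (0 : ℝ)..T, C * (l * t ^ (ρ - 1) / (1 + l * t ^ ρ) ^ 2) := by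
          refine intervalIntegral.integral_mono_on_of_le_Ioo hT.le (hi hl) (i1.const_mul C)
            fun t ht => ?_
          have ht0 := ht.1
          have h1 := (hC l hl t ⟨ht.1, ht.2.le⟩).2 h0.symm
          have e : C * t ^ (-ρ - 1) / (t ^ (-ρ) + l) ^ 2 =
              C * (t ^ (ρ - 1) / (1 + l * t ^ ρ) ^ 2) := by
            have e1 : t ^ (ρ - 1) = t ^ (-ρ - 1) * (t ^ ρ) ^ 2 := by
              rw [← Real.rpow_natCast, ← Real.rpow_mul ht0.le, ← Real.rpow_add ht0]
              congr 1; push_cast; ring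
            have e2 : 1 + l * t ^ ρ = (t ^ (-ρ) + l) * t ^ ρ := by
              rw [add_mul, ← Real.rpow_add ht0]; simp
            have : 0 < t ^ ρ := by positivity
            have : 0 < t ^ (-ρ) + l := by positivity
            rw [e1, e2]
            field_simp
          rw [e] at h1
          calc _ ≤ l * (C * (t ^ (ρ - 1) / (1 + l * t ^ ρ) ^ 2)) := by gcongr
            _ = _ := by ring
      _ ≤ _ := by
          rw [intervalIntegral.integral_const_mul]
          gcongr
  · obtain ⟨C, hC0, hC⟩ := modeSeries_rpow_bound hα hγ hρ hν ω T
    have ha : 0 < ν * (1 - ρ) := mul_pos h0 (by linarith [hρ.2])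
    refine ⟨∫ t in (0 : ℝ)..T, C * t ^ (ν * (1 - ρ) - 1), ?_, fun l hl => ?_⟩
    · refine intervalIntegral.integral_nonneg hT.le fun t ht => ?_
      have := ht.1
      positivity
    · exact intervalIntegral.integral_mono_on_of_le_Ioo hT.le (hi hl)
        ((intervalIntegral.intervalIntegrable_rpow' (by linarith)).const_mul C)
        fun t ht => (hC l hl t ⟨ht.1, ht.2.le⟩).2

/-- The multiplier of the solution operator. -/
def modeMultiplier (α ω γ ρ ν M k t : ℝ) : ℂ := modeSeries α ω γ ρ ν (M * k ^ 2) t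

/-- The multiplier of `-M ∂ₓ²` applied to the solution operator. -/
def heatMultiplier (α ω γ ρ ν M k t : ℝ) : ℂ :=
  ((M * k ^ 2 : ℝ) : ℂ) * modeSeries α ω γ ρ ν (M * k ^ 2) t

theorem exists_rpow_le (p s T : ℝ) (hs : 0 < s) : ∃ B : ℝ, ∀ t ∈ Icc s T, t ^ p ≤ B := by
  obtain ⟨B, hB⟩ := isCompact_Icc.bddAbove_image (K := Icc s T) (f := fun t : ℝ => t ^ p)
    (ContinuousOn.rpow_const (by fun_prop) fun t ht => Or.inl (by linarith [ht.1]))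
  exact ⟨B, fun t ht => hB ⟨t, ht, rfl⟩⟩

theorem norm_heatMultiplier (hM : 0 < M) (k t : ℝ) : ‖heatMultiplier α ω γ ρ ν M k t‖ =
    M * k ^ 2 * |modeSeries α ω γ ρ ν (M * k ^ 2) t| := by
  rw [heatMultiplier, norm_mul, Complex.norm_real, Complex.norm_real,
    Real.norm_of_nonneg (by positivity), Real.norm_eq_abs]

theorem modeMultiplier_timeMultiplier (hα : 0 < α) (hγ : 0 ≤ γ) (hρ : ρ ∈ Ioo (0 : ℝ) 1)
    (hν : ν ∈ Icc (0 : ℝ) 1) (hM : 0 < M) (ω : ℝ) :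
    TimeMultiplier (modeMultiplier α ω γ ρ ν M) := by
  constructor
  · refine Complex.continuous_ofReal.comp_continuousOn ((modeSeries_continuousOn hα hγ hρ hν ω).comp
      (f := fun p : ℝ × ℝ => (M * p.1 ^ 2, p.2)) (by fun_prop) fun p hp => ⟨?_, hp.2⟩)
    exact mul_nonneg hM.le (sq_nonneg _)
  · intro s T hs
    obtain ⟨C, hC0, hC⟩ := modeSeries_rpow_bound hα hγ hρ hν ω T
    obtain ⟨B, hB⟩ := exists_rpow_le (ρ + ν * (1 - ρ) - 1) s T hs
    refine ⟨C * B, fun k t ht => ?_⟩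
    rw [modeMultiplier, Complex.norm_real]
    refine (hC (M * k ^ 2) (by positivity) t ⟨hs.trans_le ht.1, ht.2⟩).1.trans ?_
    gcongr
    exact hB t ht

theorem heatMultiplier_timeMultiplier (hα : 0 < α) (hγ : 0 ≤ γ) (hρ : ρ ∈ Ioo (0 : ℝ) 1)
    (hν : ν ∈ Icc (0 : ℝ) 1) (hM : 0 < M) (ω : ℝ) :
    TimeMultiplier (heatMultiplier α ω γ ρ ν M) := by
  constructor
  · exact ContinuousOn.mul (by fun_prop) (modeMultiplier_timeMultiplier hα hγ hρ hν hM ω).cont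
  · intro s T hs
    obtain ⟨C, hC0, hC⟩ := modeSeries_rpow_bound hα hγ hρ hν ω T
    obtain ⟨B, hB⟩ := exists_rpow_le (ν * (1 - ρ) - 1) s T hs
    refine ⟨C * B, fun k t ht => ?_⟩
    rw [norm_heatMultiplier hM]
    refine (hC (M * k ^ 2) (by positivity) t ⟨hs.trans_le ht.1, ht.2⟩).2.trans ?_
    gcongr
    exact hB t ht

theorem heatMultiplier_intervalIntegrable (hα : 0 < α) (hγ : 0 ≤ γ) (hρ : ρ ∈ Ioo (0 : ℝ) 1)
    (hν : ν ∈ Icc (0 : ℝ) 1) (hM : 0 < M) (ω : ℝ) {T : ℝ} (hT : 0 < T) (k : ℝ) :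
    IntervalIntegrable (heatMultiplier α ω γ ρ ν M k) volume 0 T :=
  have h := modeSeries_intervalIntegrable hα hγ hρ hν ω (by positivity : 0 ≤ M * k ^ 2) hT
  IntervalIntegrable.const_mul ⟨h.1.ofReal, h.2.ofReal⟩ _

theorem heatMultiplier_l1_bound (hα : 0 < α) (hγ : 0 ≤ γ) (hρ : ρ ∈ Ioo (0 : ℝ) 1)
    (hν : ν ∈ Icc (0 : ℝ) 1) (hM : 0 < M) (ω : ℝ) {T : ℝ} (hT : 0 < T) : ∃ C : ℝ, 0 ≤ C ∧
      ∀ k, ∫ t in (0 : ℝ)..T, ‖heatMultiplier α ω γ ρ ν M k t‖ ≤ C := by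
  obtain ⟨C, hC0, hC⟩ := mul_modeSeries_l1_bound hα hγ hρ hν ω hT
  refine ⟨C, hC0, fun k => ?_⟩
  simp_rw [norm_heatMultiplier hM]
  exact hC _ (by positivity)

end ModeMultipliers

/-! ### Regularity and decay in space of inverse Fourier integrals. -/

section SpatialDerivatives

open FourierTransform

theorem inverseFourierTransform_eq (f : ℝ → ℂ) :
    inverseFourierTransform f = 𝓕 (fun w => f (2 * Real.pi * w)) :=
  funext fun x => inverseFourierTransform_eq_fourier_scaled f x

theorem inverseFourierTransform_contDiff {f : ℝ → ℂ} (h0 : Integrable f)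
    (h2 : Integrable fun k : ℝ => (k : ℂ) ^ 2 * f k) :
    ContDiff ℝ 2 (inverseFourierTransform f) ∧ iteratedDeriv 2 (inverseFourierTransform f) =
      inverseFourierTransform fun k => -((k : ℂ) ^ 2 * f k) := by
  have hpi : 2 * Real.pi ≠ 0 := by positivity
  set φ : ℝ → ℂ := fun w => f (2 * Real.pi * w) with hφ
  have i0 : Integrable φ := h0.comp_mul_left' hpi
  have i2 : Integrable fun w : ℝ => w ^ 2 • φ w := by
    have := (h2.comp_mul_left' hpi).const_mul ((1 / (2 * Real.pi) ^ 2 : ℝ) : ℂ)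
    refine this.congr (Eventually.of_forall fun w => ?_)
    simp only [hφ, Complex.real_smul]
    have h : (Real.pi : ℂ) ≠ 0 := by exact_mod_cast Real.pi_ne_zero
    push_cast
    field_simp
  have hn : ∀ n : ℕ, n ≤ ((2 : ℕ) : ℕ∞) → Integrable fun w : ℝ => w ^ n • φ w := by
    intro n hn
    have hn : n ≤ 2 := by exact_mod_cast hn
    refine Integrable.mono' (i0.norm.add i2.norm)
      ((by fun_prop : Continuous fun w : ℝ => w ^ n).aestronglyMeasurable.smul
        i0.aestronglyMeasurable) (Eventually.of_forall fun w => ?_)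
    simp only [Pi.add_apply]
    rw [norm_smul, norm_smul, norm_pow, norm_pow]
    have h1 : ‖w‖ ^ n ≤ 1 + ‖w‖ ^ 2 := by
      have := norm_nonneg w
      interval_cases n <;> nlinarith [sq_nonneg (‖w‖ - 1)]
    nlinarith [norm_nonneg (φ w)]
  rw [inverseFourierTransform_eq, inverseFourierTransform_eq]
  refine ⟨Real.contDiff_fourier (N := (2 : ℕ)) fun n h => ?_, ?_⟩
  · refine (hn n h).norm.congr (Eventually.of_forall fun w => ?_)
    simp only [norm_smul, norm_pow, hφ]
  · rw [Real.iteratedDeriv_fourier (N := (2 : ℕ)) hn le_rfl]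
    congr 1
    ext w
    simp only [hφ, smul_eq_mul]
    push_cast
    linear_combination (2 * Real.pi * w : ℂ) ^ 2 * f (2 * Real.pi * w) * Complex.I_sq

theorem inverseFourierTransform_tendsto_zero (f : ℝ → ℂ) :
    Tendsto (inverseFourierTransform f) atTop (𝓝 0) := by
  rw [inverseFourierTransform_eq]
  exact (Real.zero_at_infty_fourier _).mono_left atTop_le_cocompact

end SpatialDerivatives

/-! ### Absolute continuity of complex-valued functions. -/

section AbsoluteContinuity

theorem absolutelyContinuousOnInterval_of_re_im {f : ℝ → ℂ} {a b : ℝ}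
    (hr : AbsolutelyContinuousOnInterval (fun t => (f t).re) a b)
    (hi : AbsolutelyContinuousOnInterval (fun t => (f t).im) a b) :
    AbsolutelyContinuousOnInterval f a b := by
  rw [AbsolutelyContinuousOnInterval] at *
  have h := hr.add hi
  rw [add_zero] at h
  refine squeeze_zero (fun _ => Finset.sum_nonneg fun _ _ => dist_nonneg) (fun I => ?_) h
  rw [← Finset.sum_add_distrib]
  refine Finset.sum_le_sum fun i _ => ?_
  rw [dist_eq_norm, Real.dist_eq, Real.dist_eq, ← Complex.sub_re, ← Complex.sub_im]
  exact Complex.norm_le_abs_re_add_abs_im _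

theorem absolutelyContinuousOnInterval_re_im {f : ℝ → ℂ} {a b : ℝ}
    (h : AbsolutelyContinuousOnInterval f a b) :
    AbsolutelyContinuousOnInterval (fun t => (f t).re) a b ∧
    AbsolutelyContinuousOnInterval (fun t => (f t).im) a b := by
  constructor <;>
  · rw [AbsolutelyContinuousOnInterval] at *
    refine squeeze_zero (fun _ => Finset.sum_nonneg fun _ _ => dist_nonneg) (fun I => ?_) h
    refine Finset.sum_le_sum fun i _ => ?_
    rw [Complex.dist_eq, Real.dist_eq]
    first
    | exact (Complex.abs_re_le_norm (_ - _))
    | exact (Complex.abs_im_le_norm (_ - _))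

theorem absolutelyContinuousOnInterval_const_sub_integral {f : ℝ → ℂ} {b : ℝ} (c : ℂ)
    (hf : IntervalIntegrable f volume 0 b) :
    AbsolutelyContinuousOnInterval (fun t => c - ∫ τ in (0 : ℝ)..t, f τ) 0 b := by
  have hfr : IntervalIntegrable (fun t => (f t).re) volume 0 b := ⟨hf.1.re, hf.2.re⟩
  have hfi : IntervalIntegrable (fun t => (f t).im) volume 0 b := ⟨hf.1.im, hf.2.im⟩
  have hc : ∀ r : ℝ, AbsolutelyContinuousOnInterval (fun _ : ℝ => r) 0 b := fun r =>
    ((LipschitzWith.const r).lipschitzOnWith (s := uIcc 0 b)).absolutelyContinuousOnInterval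
  have key : ∀ {φ : ℝ → ℝ}, IntervalIntegrable φ volume 0 b → ∀ r : ℝ,
      AbsolutelyContinuousOnInterval (fun t => r - ∫ τ in (0 : ℝ)..t, φ τ) 0 b := fun hφ r =>
    (hc r).sub (hφ.absolutelyContinuousOnInterval_intervalIntegral left_mem_uIcc)
  have hsub : ∀ t ∈ uIcc 0 b, IntervalIntegrable f volume 0 t := fun t ht =>
    hf.mono_set (uIcc_subset_uIcc_left ht)
  have congr : ∀ {φ ψ : ℝ → ℝ}, EqOn φ ψ (uIcc 0 b) → AbsolutelyContinuousOnInterval φ 0 b →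
      AbsolutelyContinuousOnInterval ψ 0 b := by
    intro φ ψ h hφ
    rw [absolutelyContinuousOnInterval_iff] at hφ ⊢
    intro ε hε
    obtain ⟨δ, hδ, H⟩ := hφ ε hε
    refine ⟨δ, hδ, fun E hE hlt => ?_⟩
    refine lt_of_eq_of_lt (Finset.sum_congr rfl fun i hi => ?_) (H E hE hlt)
    have := hE.1 i hi
    rw [h this.1, h this.2]
  refine absolutelyContinuousOnInterval_of_re_im (congr ?_ (key hfr c.re)) (congr ?_ (key hfi c.im))
  · intro t ht
    simp only [Complex.sub_re]
    have := (Complex.reCLM.intervalIntegral_comp_comm (hsub t ht))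
    simp only [Complex.reCLM_apply] at this
    rw [this]
  · intro t ht
    simp only [Complex.sub_im]
    have := (Complex.imCLM.intervalIntegral_comp_comm (hsub t ht))
    simp only [Complex.imCLM_apply] at this
    rw [this]

end AbsoluteContinuity

/-! ### Action of the inner and outer integrals on the modes. -/

section ModeIdentities

variable {α ω γ ρ ν M : ℝ}

theorem mittagLeffler_zero (α μ z : ℝ) : mittagLeffler α μ 0 z = 1 / Real.Gamma μ := by
  rw [mittagLeffler, tsum_eq_single 0]
  · simp
  · intro k hk
    rw [ascPochhammer_eval_zero, if_neg hk]
    simp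

/-- Here 1/Γ(0) = 0, so the integral part of the operator of order 0 vanishes and only the explicit
Dirac term of `prabhakarIntegral` remains. -/
theorem prabhakarKernel_zero (α ω t : ℝ) : prabhakarKernel α 0 ω 0 t = 0 := by
  rw [prabhakarKernel, mittagLeffler_zero]
  simp

theorem prabhakarKernel_one (α ω t : ℝ) : prabhakarKernel α 1 ω 0 t = 1 := by
  rw [prabhakarKernel, mittagLeffler_zero]
  simp

theorem Admissible.small_lt {c : ℝ} (h : Admissible α ω γ ρ c) : |ω| * c ^ (-α) < 1 :=
  h.small.trans_lt (by norm_num)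

/-- The product of the kernel symbol with A is Φ/s, so the left side transforms to Φ/(s(Φ + l)) =
1/s - (l/s) · 1/(Φ + l), and 1/(Φ + l) belongs to the mode with ν = 0. For ν = 1 the kernel has
order 0 and the Dirac term takes its place. -/
theorem inner_mode_identity (hα : 0 < α) (hγ : 0 ≤ γ) (hρ : ρ ∈ Ioo (0 : ℝ) 1)
    (hν : ν ∈ Icc (0 : ℝ) 1) (ω : ℝ) {l : ℝ} (hl : 0 ≤ l) {t : ℝ} (ht : 0 < t) :
    (if (1 - ν) * (1 - ρ) = 0 then (modeSeries α ω γ ρ ν l t : ℂ) else 0) +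
      causalConv (fun t => (prabhakarKernel α ((1 - ν) * (1 - ρ)) ω (-γ * (1 - ν)) t : ℂ))
        (fun t => (modeSeries α ω γ ρ ν l t : ℂ)) t =
      1 - l * ∫ τ in (0 : ℝ)..t, (modeSeries α ω γ ρ 0 l τ : ℂ) := by
  obtain ⟨c, h, hlc⟩ := (eventually_mode_admissible (ω := ω) (γ := γ) hα hρ l).exists
  have h00 : (0 : ℝ) ∈ Icc (0 : ℝ) 1 := by simp
  have k0 := (mode_laplace (α := α) (ω := ω) hα hγ hρ h00 h.pos h.small hl hlc).1
  have kν := (mode_laplace (α := α) (ω := ω) hα hγ hρ hν h.pos h.small hl hlc).1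
  obtain ⟨k1, l1⟩ := prabhakarKernel_laplace (μ := 1) 0 hα one_pos h.pos h.small_lt
  have k10 := k1.conv k0
  set f2 : ℝ → ℂ := fun t => (prabhakarKernel α 1 ω 0 t : ℂ) -
    l * causalConv (fun t => (prabhakarKernel α 1 ω 0 t : ℂ))
      (fun t => (modeSeries α ω γ ρ 0 l t : ℂ)) t with hf2
  have e2 : f2 t = 1 - l * ∫ τ in (0 : ℝ)..t, (modeSeries α ω γ ρ 0 l τ : ℂ) := by
    simp [hf2, causalConv, prabhakarKernel_one]
  have c2 : ContinuousOn f2 (Ioi 0) := k1.cont.sub (continuousOn_const.mul k10.cont)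
  have i2a : ∀ s : ℂ, c ≤ s.re → IntegrableOn (fun t : ℝ => Complex.exp (-(s * t)) *
      (l * causalConv (fun t => (prabhakarKernel α 1 ω 0 t : ℂ))
      (fun t => (modeSeries α ω γ ρ 0 l t : ℂ)) t)) (Ioi 0) := fun s hs => by
    refine ((laplace_integrableOn k10.cont k10.integrable hs).const_mul l).congr
      (Eventually.of_forall fun t => ?_)
    simp only []
    ring
  have i2 : IntegrableOn (fun t : ℝ => Complex.exp (-((c : ℂ) * t)) * f2 t) (Ioi 0) := by
    simp only [hf2, mul_sub]
    exact k1.integrable.sub (i2a c (by simp))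
  have l2 : ∀ s : ℂ, c ≤ s.re → laplace f2 s = prabhakarSymbol α ω (1 - ρ) (-γ) s *
      (1 / (prabhakarSymbol α ω (-ρ) (-γ) s + l)) := by
    intro s hs
    have e : laplace f2 s = laplace (fun t => (prabhakarKernel α 1 ω 0 t : ℂ)) s -
        l * laplace (causalConv (fun t => (prabhakarKernel α 1 ω 0 t : ℂ))
          (fun t => (modeSeries α ω γ ρ 0 l t : ℂ))) s := by
      rw [laplace, laplace, laplace, ← integral_const_mul, ← integral_sub
        (laplace_integrableOn k1.cont k1.integrable hs)
        ((laplace_integrableOn k10.cont k10.integrable hs).const_mul _)]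
      congr 1 with t
      rw [hf2]
      ring
    have hD := symbol_add_ne_zero h hα hγ hρ hs hl
    have hm := prabhakarSymbol_mul h hα hs 1 (-ρ) 0 (-γ)
    rw [zero_add, ← sub_eq_add_neg] at hm
    rw [e, k1.laplace_conv k0 hs, l1 s hs, laplace_modeSeries h hα hγ hρ h00 hl hlc hs, modeSymbol,
      zero_mul, mul_zero, neg_zero, prabhakarSymbol_zero, ← hm]
    field_simp
    ring
  have hsym := fun {s : ℂ} (hs : c ≤ s.re) =>
    laplace_modeSeries h hα hγ hρ hν hl hlc hs
  rcases hν.2.eq_or_lt with h1 | h1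
  · subst h1
    rw [if_pos (by ring)]
    have e0 : causalConv (fun t => (prabhakarKernel α ((1 - 1) * (1 - ρ)) ω (-γ * (1 - 1)) t : ℂ))
        (fun t => (modeSeries α ω γ ρ 1 l t : ℂ)) t = 0 := by
      simp [causalConv, prabhakarKernel_zero]
    rw [e0, add_zero, ← e2]
    refine laplace_injective kν.cont c2 kν.integrable i2 (fun s hs => ?_) ht
    rw [l2 s hs.ge, hsym hs.ge, modeSymbol, one_mul, mul_one, mul_one_div]
  · have hμ : 0 < (1 - ν) * (1 - ρ) := mul_pos (by linarith) (by linarith [hρ.2])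
    rw [if_neg hμ.ne', zero_add, ← e2]
    obtain ⟨ka, la⟩ := prabhakarKernel_laplace (-γ * (1 - ν)) hα hμ h.pos h.small_lt
    refine laplace_injective (ka.conv kν).cont c2 (ka.conv kν).integrable i2 (fun s hs => ?_) ht
    rw [l2 s hs.ge, ka.laplace_conv kν hs.ge, la s hs.ge, hsym hs.ge, modeSymbol, ← mul_one_div,
      ← mul_assoc, prabhakarSymbol_mul h hα hs.ge]
    congr 2 <;> ring

/-- The kernel has symbol A, and A · 1/(Φ + l) is the transform of the mode with parameter ν. For ν
= 0 the operator is the identity. -/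
theorem outer_mode_identity (hα : 0 < α) (hγ : 0 ≤ γ) (hρ : ρ ∈ Ioo (0 : ℝ) 1)
    (hν : ν ∈ Icc (0 : ℝ) 1) (ω : ℝ) {l : ℝ} (hl : 0 ≤ l) {t : ℝ} (ht : 0 < t) :
    (if ν * (1 - ρ) = 0 then (modeSeries α ω γ ρ 0 l t : ℂ) else 0) +
      causalConv (fun t => (prabhakarKernel α (ν * (1 - ρ)) ω (-γ * ν) t : ℂ))
        (fun t => (modeSeries α ω γ ρ 0 l t : ℂ)) t = modeSeries α ω γ ρ ν l t := by
  obtain ⟨c, h, hlc⟩ := (eventually_mode_admissible (ω := ω) (γ := γ) hα hρ l).exists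
  have h00 : (0 : ℝ) ∈ Icc (0 : ℝ) 1 := by simp
  have k0 := (mode_laplace (α := α) (ω := ω) hα hγ hρ h00 h.pos h.small hl hlc).1
  have kν := (mode_laplace (α := α) (ω := ω) hα hγ hρ hν h.pos h.small hl hlc).1
  rcases hν.1.eq_or_lt with h1 | h1
  · subst h1
    simp [causalConv, prabhakarKernel_zero]
  · have hμ : 0 < ν * (1 - ρ) := mul_pos h1 (by linarith [hρ.2])
    rw [if_neg hμ.ne', zero_add]
    obtain ⟨ka, la⟩ := prabhakarKernel_laplace (-γ * ν) hα hμ h.pos h.small_lt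
    refine (ka.conv k0).ext kν (fun s hs => ?_) ht
    rw [ka.laplace_conv k0 hs.ge, la s hs.ge, laplace_modeSeries h hα hγ hρ h00 hl hlc hs.ge,
      laplace_modeSeries h hα hγ hρ hν hl hlc hs.ge, modeSymbol, modeSymbol,
      zero_mul, mul_zero, neg_zero, prabhakarSymbol_zero, neg_mul, mul_one_div]

end ModeIdentities

/-! ### The series solves the problem. -/

section Existence

variable {α ω γ ρ ν M : ℝ} {g : ℝ → ℂ}

theorem seriesTerm_eq (t k : ℝ) (n : ℕ) : seriesTerm α ω γ ρ ν M g t k n =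
    fourierTransform g k * (((-(M * k ^ 2)) ^ n *
      prabhakarKernel α (ρ * (n + 1) + ν * (1 - ρ)) ω (γ * (n + 1 - ν)) t : ℝ) : ℂ) := by
  rw [seriesTerm, prabhakarKernel, neg_mul, mul_assoc]

theorem tsum_seriesTerm (t k : ℝ) : ∑' n : ℕ, seriesTerm α ω γ ρ ν M g t k n =
    fourierTransform g k * modeMultiplier α ω γ ρ ν M k t := by
  simp_rw [seriesTerm_eq]
  rw [tsum_mul_left, modeMultiplier, modeSeries, Complex.ofReal_tsum]

theorem summable_seriesTerm (hα : 0 < α) (hγ : 0 ≤ γ) (hρ : ρ ∈ Ioo (0 : ℝ) 1)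
    (hν : ν ∈ Icc (0 : ℝ) 1) (hM : 0 < M) {t : ℝ} (ht : 0 < t) (k : ℝ) :
    Summable (seriesTerm α ω γ ρ ν M g t k) := by
  obtain ⟨c, h, hlc⟩ := (eventually_mode_admissible (ω := ω) (γ := γ) hα hρ (M * k ^ 2)).exists
  have hs := (mode_summable hα hγ hρ hν h.pos h.small (by positivity) hlc ht).1
  refine ((Complex.summable_ofReal.2 hs).mul_left (fourierTransform g k)).congr fun n => ?_
  exact (seriesTerm_eq t k n).symm

theorem solution_eq (x : ℝ) : solution α ω γ ρ ν M g x =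
    multiplierIntegral g (modeMultiplier α ω γ ρ ν M) x := by
  ext t
  simp only [solution, multiplierIntegral, tsum_seriesTerm]

theorem multiplierIntegral_continuousOn_right {m : ℝ → ℝ → ℂ} (hm : TimeMultiplier m)
    (hg : FourierPair g) (x : ℝ) : ContinuousOn (multiplierIntegral g m x) (Ioi 0) :=
  (hm.continuousOn_integral hg).comp (f := fun t : ℝ => (x, t)) (by fun_prop)
    fun _ ht => ⟨mem_univ _, ht⟩

theorem solution_contDiff (hα : 0 < α) (hγ : 0 ≤ γ) (hρ : ρ ∈ Ioo (0 : ℝ) 1)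
    (hν : ν ∈ Icc (0 : ℝ) 1) (hM : 0 < M) (hg : FourierPair g) {t : ℝ} (ht : 0 < t) :
    ContDiff ℝ 2 (fun x => solution α ω γ ρ ν M g x t) ∧ ∀ x,
      (M : ℂ) * iteratedDeriv 2 (fun y => solution α ω γ ρ ν M g y t) x =
        -multiplierIntegral g (heatMultiplier α ω γ ρ ν M) x t := by
  have hMc : (M : ℂ) ≠ 0 := by exact_mod_cast hM.ne'
  have h0 := (modeMultiplier_timeMultiplier hα hγ hρ hν hM ω).integrable hg ht
  have h2 := (heatMultiplier_timeMultiplier hα hγ hρ hν hM ω).integrable hg ht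
  have e2 : ∀ k : ℝ, fourierTransform g k * heatMultiplier α ω γ ρ ν M k t =
      M * ((k : ℂ) ^ 2 * (fourierTransform g k * modeMultiplier α ω γ ρ ν M k t)) := by
    intro k
    rw [heatMultiplier, modeMultiplier]
    push_cast
    ring
  have h2' : Integrable fun k : ℝ =>
      (k : ℂ) ^ 2 * (fourierTransform g k * modeMultiplier α ω γ ρ ν M k t) := by
    refine (h2.const_mul (M : ℂ)⁻¹).congr (Eventually.of_forall fun k => ?_)
    simp only [e2]
    rw [inv_mul_cancel_left₀ hMc]
  obtain ⟨c1, c2⟩ := inverseFourierTransform_contDiff h0 h2'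
  simp_rw [solution_eq]
  refine ⟨c1, fun x => ?_⟩
  have e : (fun y => multiplierIntegral g (modeMultiplier α ω γ ρ ν M) y t) =
    inverseFourierTransform fun k => fourierTransform g k * modeMultiplier α ω γ ρ ν M k t := rfl
  rw [e, c2, multiplierIntegral, ← inverseFourierTransform_const_mul]
  simp_rw [e2]
  have e3 : ∀ k : ℝ,
      (M : ℂ) * -((k : ℂ) ^ 2 * (fourierTransform g k * modeMultiplier α ω γ ρ ν M k t)) =
      (-1) * ((M : ℂ) * ((k : ℂ) ^ 2 * (fourierTransform g k * modeMultiplier α ω γ ρ ν M k t))) :=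
    fun k => by ring
  simp_rw [e3]
  rw [inverseFourierTransform_const_mul]
  ring

/-- Integration over [0, t] is causal convolution with the constant 1, so the exchange with the
inverse Fourier integral is a case of `causalConv_integral`. It rests on the L¹ bound in time,
because for ν = 0 the pointwise bound is not integrable at 0. -/
theorem heat_integral (hα : 0 < α) (hγ : 0 ≤ γ) (hρ : ρ ∈ Ioo (0 : ℝ) 1)
    (hν : ν ∈ Icc (0 : ℝ) 1) (hM : 0 < M) (hg : FourierPair g) (ω : ℝ) {t : ℝ} (ht : 0 < t)
    (x : ℝ) :
    IntervalIntegrable (multiplierIntegral g (heatMultiplier α ω γ ρ ν M) x) volume 0 t ∧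
    ∫ τ in (0 : ℝ)..t, multiplierIntegral g (heatMultiplier α ω γ ρ ν M) x τ =
      inverseFourierTransform (fun k => fourierTransform g k *
        ∫ τ in (0 : ℝ)..t, heatMultiplier α ω γ ρ ν M k τ) x := by
  obtain ⟨C, -, hC⟩ := heatMultiplier_l1_bound hα hγ hρ hν hM ω ht
  have h := (heatMultiplier_timeMultiplier hα hγ hρ hν hM ω).causalConv_integral hg
    (w := fun _ => 1) continuousOn_const (C := C) ht (fun k => by
      simpa using heatMultiplier_intervalIntegrable hα hγ hρ hν hM ω ht k)
    (fun k => by simpa using hC k) x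
  simpa [causalConv] using h

theorem prabhakarKernel_continuousOn (hα : 0 < α) {μ : ℝ} (hμ : 0 < μ) (ω β : ℝ) :
    ContinuousOn (fun t => (prabhakarKernel α μ ω β t : ℂ)) (Ioi 0) ∧
    ∀ T, ∃ C : ℝ, 0 ≤ C ∧ ∀ t ∈ Ioc 0 T, ‖(prabhakarKernel α μ ω β t : ℂ)‖ ≤ C * t ^ (μ - 1) := by
  -- With γ = ρ = 0 the angle condition is void, and only smallness of |ω| c^{-α} is being asked
  -- for.
  obtain ⟨c, h⟩ := (eventually_admissible (ω := ω) (γ := 0) hα (by norm_num : (0:ℝ) < 1)).exists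
  have := (prabhakarKernel_laplace β hα hμ h.pos h.small_lt).1
  exact ⟨this.cont, this.bound⟩

/-- Integrate `inner_mode_identity` against g*(k) e^{-ikx}: the constant 1 returns g by Fourier
inversion, and the rest is the time integral of the heat multiplier with ν = 0. A Beta integral
independent of k dominates the convolution. -/
theorem solution_inner (hα : 0 < α) (hγ : 0 ≤ γ) (hρ : ρ ∈ Ioo (0 : ℝ) 1)
    (hν : ν ∈ Icc (0 : ℝ) 1) (hM : 0 < M) (hg : FourierPair g) (ω : ℝ) {t : ℝ} (ht : 0 < t)
    (x : ℝ) :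
    PrabhakarIntegrable α ((1 - ν) * (1 - ρ)) ω (-γ * (1 - ν)) (solution α ω γ ρ ν M g x) t ∧
    innerIntegral α ω γ ρ ν (solution α ω γ ρ ν M g x) t = g x -
      ∫ τ in (0 : ℝ)..t, multiplierIntegral g (heatMultiplier α ω γ ρ 0 M) x τ := by
  have h00 : (0 : ℝ) ∈ Icc (0 : ℝ) 1 := by simp
  have hmode := modeMultiplier_timeMultiplier hα hγ hρ hν hM ω
  set w : ℝ → ℂ := fun t => (prabhakarKernel α ((1 - ν) * (1 - ρ)) ω (-γ * (1 - ν)) t : ℂ) with hw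
  obtain ⟨C0, hC0, hb0⟩ := heatMultiplier_l1_bound hα hγ hρ h00 hM ω ht
  have hid : ∀ k, (if (1 - ν) * (1 - ρ) = 0 then modeMultiplier α ω γ ρ ν M k t else 0) +
      causalConv w (modeMultiplier α ω γ ρ ν M k) t =
      1 - ∫ τ in (0 : ℝ)..t, heatMultiplier α ω γ ρ 0 M k τ := by
    intro k
    have := inner_mode_identity hα hγ hρ hν ω (by positivity : 0 ≤ M * k ^ 2) ht
    rw [← intervalIntegral.integral_const_mul] at this
    exact this
  have hH : Integrable fun k => fourierTransform g k *
      ∫ τ in (0 : ℝ)..t, heatMultiplier α ω γ ρ 0 M k τ := by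
    refine integrable_fourier_mul hg (B := C0) ?_ fun k => ?_
    · have hc := (heatMultiplier_timeMultiplier hα hγ hρ h00 hM ω).cont
      simp_rw [intervalIntegral.integral_of_le ht.le]
      have hm : AEStronglyMeasurable (fun p : ℝ × ℝ => heatMultiplier α ω γ ρ 0 M p.1 p.2)
          (volume.prod (volume.restrict (Ioc 0 t))) := by
        have e : (volume : Measure ℝ).prod (volume.restrict (Ioc 0 t)) =
            (volume.prod volume).restrict (univ ×ˢ Ioc 0 t) := by
          rw [← Measure.prod_restrict, Measure.restrict_univ]
        rw [e]
        exact (hc.mono (prod_mono_right Ioc_subset_Ioi_self)).aestronglyMeasurable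
          (MeasurableSet.univ.prod measurableSet_Ioc)
      exact hm.integral_prod_right'
    · exact (intervalIntegral.norm_integral_le_integral_norm ht.le).trans (hb0 k)
  have hfin : inverseFourierTransform (fun k => fourierTransform g k *
      (1 - ∫ τ in (0 : ℝ)..t, heatMultiplier α ω γ ρ 0 M k τ)) x = g x -
      ∫ τ in (0 : ℝ)..t, multiplierIntegral g (heatMultiplier α ω γ ρ 0 M) x τ := by
    rw [(heat_integral hα hγ hρ h00 hM hg ω ht x).2]
    have e : ∀ k, fourierTransform g k *
        (1 - ∫ τ in (0 : ℝ)..t, heatMultiplier α ω γ ρ 0 M k τ) = fourierTransform g k +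
        (-1) * (fourierTransform g k * ∫ τ in (0 : ℝ)..t, heatMultiplier α ω γ ρ 0 M k τ) :=
      fun k => by ring
    simp_rw [e]
    rw [inverseFourierTransform_add hg.fourier (hH.const_mul _),
      inverseFourierTransform_const_mul,
      inverseFourierTransform_fourierTransform hg.cont hg.int hg.fourier]
    ring
  simp_rw [← hid] at hfin
  rw [← hfin, PrabhakarIntegrable, innerIntegral, prabhakarIntegral, solution_eq]
  rcases hν.2.eq_or_lt with h1 | h1
  · subst h1
    have e0 : ∀ τ, w τ = 0 := fun τ => by simp [hw, prabhakarKernel_zero]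
    have e1 : ∀ τ, (prabhakarKernel α ((1 - 1) * (1 - ρ)) ω (-γ * (1 - 1)) τ : ℂ) = 0 := e0
    simp_rw [causalConv, e0, e1]
    simp [multiplierIntegral]
  · have hμ : 0 < (1 - ν) * (1 - ρ) := mul_pos (by linarith) (by linarith [hρ.2])
    simp_rw [if_neg hμ.ne', zero_add]
    obtain ⟨hwc, hwb⟩ := prabhakarKernel_continuousOn hα hμ ω (-γ * (1 - ν))
    obtain ⟨Cw, hCw0, hCw⟩ := hwb t
    obtain ⟨Ch, hCh0, hCh⟩ := modeSeries_rpow_bound hα hγ hρ hν ω t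
    have hp := mode_order_pos hρ hν
    have hmb : ∀ k, ∀ τ ∈ Ioc 0 t, ‖modeMultiplier α ω γ ρ ν M k τ‖ ≤
        Ch * τ ^ (ρ + ν * (1 - ρ) - 1) := fun k τ hτ => by
      rw [modeMultiplier, Complex.norm_real]
      exact (hCh (M * k ^ 2) (by positivity) τ hτ).1
    have hi := fun k => causalConv_integrable_of_bound hμ hp hwc (hmode.continuousOn_right k) ht
      hCw (hmb k)
    have hbeta := intervalIntegrable_beta hμ hp t ht
    refine hmode.causalConv_integral hg hwc (C := ∫ τ in (0 : ℝ)..t, Cw * Ch *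
      ((t - τ) ^ ((1 - ν) * (1 - ρ) - 1) * τ ^ (ρ + ν * (1 - ρ) - 1))) ht hi (fun k => ?_) x
    refine intervalIntegral.integral_mono_on_of_le_Ioo ht.le (hi k).norm (hbeta.const_mul _)
      fun τ hτ => ?_
    rw [norm_mul]
    have h1 := hCw (t - τ) ⟨by linarith [hτ.2], by linarith [hτ.1]⟩
    have h2 := hmb k τ ⟨hτ.1, hτ.2.le⟩
    calc _ ≤ (Cw * (t - τ) ^ ((1 - ν) * (1 - ρ) - 1)) * (Ch * τ ^ (ρ + ν * (1 - ρ) - 1)) :=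
          mul_le_mul h1 h2 (norm_nonneg _) ((norm_nonneg _).trans h1)
      _ = _ := by ring

theorem solution_inner_hasDerivAt (hα : 0 < α) (hγ : 0 ≤ γ) (hρ : ρ ∈ Ioo (0 : ℝ) 1)
    (hν : ν ∈ Icc (0 : ℝ) 1) (hM : 0 < M) (hg : FourierPair g) (ω : ℝ) {t : ℝ} (ht : 0 < t)
    (x : ℝ) : HasDerivAt (innerIntegral α ω γ ρ ν (solution α ω γ ρ ν M g x))
      (-multiplierIntegral g (heatMultiplier α ω γ ρ 0 M) x t) t := by
  have h00 : (0 : ℝ) ∈ Icc (0 : ℝ) 1 := by simp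
  have hc := multiplierIntegral_continuousOn_right
    (heatMultiplier_timeMultiplier hα hγ hρ h00 hM ω) hg x
  have h := (intervalIntegral.integral_hasDerivAt_right
    (heat_integral hα hγ hρ h00 hM hg ω ht x).1
    (hc.stronglyMeasurableAtFilter isOpen_Ioi t ht) (hc.continuousAt (Ioi_mem_nhds ht))).const_sub
      (g x)
  refine h.congr_of_eventuallyEq ?_
  filter_upwards [Ioi_mem_nhds ht] with s hs
  exact (solution_inner hα hγ hρ hν hM hg ω hs x).2

theorem heat_le_inv (hα : 0 < α) (hγ : 0 ≤ γ) (hρ : ρ ∈ Ioo (0 : ℝ) 1) (hM : 0 < M) (ω T : ℝ) :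
    ∃ C : ℝ, 0 ≤ C ∧ ∀ k, ∀ t ∈ Ioc 0 T, ‖heatMultiplier α ω γ ρ 0 M k t‖ ≤ C / t := by
  obtain ⟨C, hC0, hC⟩ := modeSeries_rpow_bound (ν := 0) hα hγ hρ (by simp) ω T
  refine ⟨C, hC0, fun k t ht => ?_⟩
  have := (hC (M * k ^ 2) (by positivity) t ht).2
  rw [zero_mul, zero_sub, Real.rpow_neg_one] at this
  rw [norm_heatMultiplier hM, div_eq_mul_inv]
  exact this

/-- The integrated form of `outer_mode_identity`. The function u stands for the derivative of the
inner integral, which is known at positive times only. -/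
theorem solution_outer (hα : 0 < α) (hγ : 0 ≤ γ) (hρ : ρ ∈ Ioo (0 : ℝ) 1)
    (hν : ν ∈ Icc (0 : ℝ) 1) (hM : 0 < M) (hg : FourierPair g) (ω : ℝ) {t : ℝ} (ht : 0 < t)
    (x : ℝ) {u : ℝ → ℂ} (hu : ∀ τ, 0 < τ →
      u τ = -multiplierIntegral g (heatMultiplier α ω γ ρ 0 M) x τ) :
    PrabhakarIntegrable α (ν * (1 - ρ)) ω (-γ * ν) u t ∧
    prabhakarIntegral α (ν * (1 - ρ)) ω (-γ * ν) u t =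
      -multiplierIntegral g (heatMultiplier α ω γ ρ ν M) x t := by
  have h00 : (0 : ℝ) ∈ Icc (0 : ℝ) 1 := by simp
  set w : ℝ → ℂ := fun t => (prabhakarKernel α (ν * (1 - ρ)) ω (-γ * ν) t : ℂ) with hw
  have hheat := heatMultiplier_timeMultiplier hα hγ hρ h00 hM ω
  rcases hν.1.eq_or_lt with h1 | h1
  · subst h1
    simp [PrabhakarIntegrable, prabhakarIntegral, prabhakarKernel_zero, hu t ht]
  · have hμ : 0 < ν * (1 - ρ) := mul_pos h1 (by linarith [hρ.2])
    have hid : ∀ k, causalConv w (heatMultiplier α ω γ ρ 0 M k) t =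
        heatMultiplier α ω γ ρ ν M k t := by
      intro k
      have := outer_mode_identity hα hγ hρ hν ω (by positivity : 0 ≤ M * k ^ 2) ht
      rw [if_neg hμ.ne', zero_add] at this
      rw [heatMultiplier, ← this, causalConv, causalConv, ← intervalIntegral.integral_const_mul]
      congr 1 with τ
      rw [heatMultiplier]
      ring
    obtain ⟨hwc, hwb⟩ := prabhakarKernel_continuousOn hα hμ ω (-γ * ν)
    obtain ⟨Cw, hCw0, hCw⟩ := hwb t
    obtain ⟨C1, hC10, hC1⟩ := heatMultiplier_l1_bound hα hγ hρ h00 hM ω ht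
    obtain ⟨C2, hC20, hC2⟩ := heat_le_inv hα hγ hρ hM ω t
    have hμ1 : ν * (1 - ρ) - 1 ≤ 0 := by nlinarith [hρ.1, hρ.2, hν.2]
    set b := ν * (1 - ρ) - 1 with hb
    -- Cut at t/2. Near τ = 0 the multiplier is controlled only in L¹ uniformly in k, but there the
    -- kernel is bounded; near τ = t the kernel is singular but integrable, and the pointwise bound
    -- C₂/τ is harmless.
    have hpt : ∀ k, ∀ τ ∈ Ioo 0 t, ‖w (t - τ) * heatMultiplier α ω γ ρ 0 M k τ‖ ≤
        Cw * (t / 2) ^ b * ‖heatMultiplier α ω γ ρ 0 M k τ‖ +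
          Cw * (C2 / (t / 2)) * (t - τ) ^ b := by
      intro k τ hτ
      have hp1 := hCw (t - τ) ⟨by linarith [hτ.2], by linarith [hτ.1]⟩
      have hp2 := hC2 k τ ⟨hτ.1, hτ.2.le⟩
      have ht2 : 0 < t / 2 := by linarith
      have htτ : 0 < t - τ := by linarith [hτ.2]
      rw [norm_mul]
      rcases le_total τ (t / 2) with hle | hle
      · have h3 : (t - τ) ^ b ≤ (t / 2) ^ b :=
          Real.rpow_le_rpow_of_nonpos ht2 (by linarith) hμ1
        calc _ ≤ Cw * (t - τ) ^ b * ‖heatMultiplier α ω γ ρ 0 M k τ‖ := by gcongr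
          _ ≤ Cw * (t / 2) ^ b * ‖heatMultiplier α ω γ ρ 0 M k τ‖ := by gcongr
          _ ≤ _ := le_add_of_nonneg_right (by positivity)
      · have h3 : C2 / τ ≤ C2 / (t / 2) := by gcongr
        calc _ ≤ Cw * (t - τ) ^ b * (C2 / (t / 2)) :=
              mul_le_mul hp1 (hp2.trans h3) (norm_nonneg _) (by positivity)
          _ = Cw * (C2 / (t / 2)) * (t - τ) ^ b := by ring
          _ ≤ _ := le_add_of_nonneg_left (by positivity)
    have ib : IntervalIntegrable (fun τ : ℝ => (t - τ) ^ b) volume 0 t := by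
      have := (intervalIntegral.intervalIntegrable_rpow' (a := 0) (b := t)
        (by linarith : -1 < b)).comp_sub_left t
      rw [sub_zero, sub_self] at this
      exact this.symm
    have ih := fun k => heatMultiplier_intervalIntegrable hα hγ hρ h00 hM ω ht k
    have iB := fun k => ((ih k).norm.const_mul (Cw * (t / 2) ^ b)).add
      (ib.const_mul (Cw * (C2 / (t / 2))))
    have hi : ∀ k, IntervalIntegrable (fun τ => w (t - τ) * heatMultiplier α ω γ ρ 0 M k τ)
        volume 0 t := by
      intro k
      have h := iB k
      rw [intervalIntegrable_iff_integrableOn_Ioo_of_le ht.le] at h ⊢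
      refine Integrable.mono' h ?_ ((ae_restrict_iff' measurableSet_Ioo).2
        (Eventually.of_forall (hpt k)))
      refine ContinuousOn.aestronglyMeasurable (ContinuousOn.mul ?_ ?_) measurableSet_Ioo
      · exact hwc.comp (by fun_prop) fun τ hτ => by simpa using hτ.2
      · exact (hheat.continuousOn_right k).mono Ioo_subset_Ioi_self
    obtain ⟨r1, r2⟩ := hheat.causalConv_integral hg hwc (C := Cw * (t / 2) ^ b * C1 +
      Cw * (C2 / (t / 2)) * ∫ τ in (0 : ℝ)..t, (t - τ) ^ b) ht hi (fun k => by
        refine (intervalIntegral.integral_mono_on_of_le_Ioo ht.le (hi k).norm (iB k)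
          (hpt k)).trans ?_
        rw [intervalIntegral.integral_add ((ih k).norm.const_mul _) (ib.const_mul _),
          intervalIntegral.integral_const_mul, intervalIntegral.integral_const_mul]
        gcongr
        exact hC1 k) x
    have e : EqOn (fun τ => -(w (t - τ) * multiplierIntegral g (heatMultiplier α ω γ ρ 0 M) x τ))
        (fun τ => w (t - τ) * u τ) (Ioc 0 t) := fun τ hτ => by
      simp only
      rw [hu τ hτ.1, mul_neg]
    constructor
    · rw [PrabhakarIntegrable]
      refine r1.neg.congr ?_
      rw [uIoc_of_le ht.le]
      exact e
    · rw [prabhakarIntegral, if_neg hμ.ne', zero_add, intervalIntegral.integral_of_le ht.le,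
        ← setIntegral_congr_fun measurableSet_Ioc e, integral_neg,
        ← intervalIntegral.integral_of_le ht.le]
      refine congrArg Neg.neg (r2.trans ?_)
      rw [multiplierIntegral]
      congr 1 with k
      exact congrArg _ (hid k)

theorem solution_differentiable (hα : 0 < α) (hγ : 0 ≤ γ) (hρ : ρ ∈ Ioo (0 : ℝ) 1)
    (hν : ν ∈ Icc (0 : ℝ) 1) (hM : 0 < M) (hg : FourierPair g) (ω : ℝ) (x : ℝ) :
    HilferPrabhakarDifferentiable α ω γ ρ ν (solution α ω γ ρ ν M g x) := by
  have h00 : (0 : ℝ) ∈ Icc (0 : ℝ) 1 := by simp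
  refine ⟨fun b hb => ?_, fun t ht => (solution_inner hα hγ hρ hν hM hg ω ht x).1, fun b hb => ?_,
    fun t ht => (solution_inner_hasDerivAt hα hγ hρ hν hM hg ω ht x).differentiableAt,
    fun t ht => ?_⟩
  · obtain ⟨C, hC0, hC⟩ := modeSeries_rpow_bound hα hγ hρ hν ω b
    have hp := mode_order_pos hρ hν
    have hi := (intervalIntegral.intervalIntegrable_rpow' (a := 0) (b := b)
      (by linarith : -1 < ρ + ν * (1 - ρ) - 1)).const_mul C
    have ik : ∀ k, IntervalIntegrable (modeMultiplier α ω γ ρ ν M k) volume 0 b := fun k => by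
      have h := modeSeries_intervalIntegrable hα hγ hρ hν ω (by positivity : 0 ≤ M * k ^ 2) hb
      exact ⟨h.1.ofReal, h.2.ofReal⟩
    have h := (modeMultiplier_timeMultiplier hα hγ hρ hν hM ω).causalConv_integral hg
      (w := fun _ => 1) continuousOn_const
      (C := ∫ τ in (0 : ℝ)..b, C * τ ^ (ρ + ν * (1 - ρ) - 1)) hb
      (fun k => by simpa using ik k) (fun k => by
        simp only [one_mul]
        refine intervalIntegral.integral_mono_on_of_le_Ioo hb.le (ik k).norm hi fun τ hτ => ?_
        rw [modeMultiplier, Complex.norm_real]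
        exact (hC (M * k ^ 2) (by positivity) τ ⟨hτ.1, hτ.2.le⟩).1) x
    rw [solution_eq]
    simpa using h.1
  · exact ⟨_, absolutelyContinuousOnInterval_const_sub_integral (g x)
      (heat_integral hα hγ hρ h00 hM hg ω hb x).1,
      fun t ht => (solution_inner hα hγ hρ hν hM hg ω ht.1 x).2.symm⟩
  · exact (solution_outer hα hγ hρ hν hM hg ω ht x fun τ hτ =>
      (solution_inner_hasDerivAt hα hγ hρ hν hM hg ω hτ x).deriv).1

theorem solution_equation (hα : 0 < α) (hγ : 0 ≤ γ) (hρ : ρ ∈ Ioo (0 : ℝ) 1)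
    (hν : ν ∈ Icc (0 : ℝ) 1) (hM : 0 < M) (hg : FourierPair g) (ω x : ℝ) {t : ℝ} (ht : 0 < t) :
    hilferPrabhakarDeriv α ω γ ρ ν (solution α ω γ ρ ν M g x) t =
      (M : ℂ) * iteratedDeriv 2 (fun y => solution α ω γ ρ ν M g y t) x := by
  rw [(solution_contDiff hα hγ hρ hν hM hg ht).2, hilferPrabhakarDeriv]
  exact (solution_outer hα hγ hρ hν hM hg ω ht x fun τ hτ =>
    (solution_inner_hasDerivAt hα hγ hρ hν hM hg ω hτ x).deriv).2

theorem solution_initial (hα : 0 < α) (hγ : 0 ≤ γ) (hρ : ρ ∈ Ioo (0 : ℝ) 1)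
    (hν : ν ∈ Icc (0 : ℝ) 1) (hM : 0 < M) (hg : FourierPair g) (ω x : ℝ) :
    Tendsto (innerIntegral α ω γ ρ ν (solution α ω γ ρ ν M g x)) (𝓝[>] 0) (𝓝 (g x)) := by
  have h00 : (0 : ℝ) ∈ Icc (0 : ℝ) 1 := by simp
  have hac := (absolutelyContinuousOnInterval_const_sub_integral (g x)
    (heat_integral hα hγ hρ h00 hM hg ω one_pos x).1).continuousOn
  rw [uIcc_of_le zero_le_one] at hac
  have h := (hac 0 (by simp)).mono Ioc_subset_Icc_self
  rw [ContinuousWithinAt, nhdsWithin_Ioc_eq_nhdsGT zero_lt_one] at h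
  simp only [intervalIntegral.integral_same, sub_zero] at h
  refine h.congr' ?_
  filter_upwards [self_mem_nhdsWithin] with t ht
  exact (solution_inner hα hγ hρ hν hM hg ω ht x).2.symm

/-- The majorant ∫ |g*(k)| |heat multiplier| dk is integrable in t but does not depend on x, whence
local integrability in x only. -/
theorem solution_dxx_integrable (hα : 0 < α) (hγ : 0 ≤ γ) (hρ : ρ ∈ Ioo (0 : ℝ) 1)
    (hν : ν ∈ Icc (0 : ℝ) 1) (hM : 0 < M) (hg : FourierPair g) (ω R : ℝ) {T : ℝ} (hT : 0 < T) :
    IntegrableOn (fun p : ℝ × ℝ => iteratedDeriv 2 (fun y => solution α ω γ ρ ν M g y p.2) p.1)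
      (Icc (-R) R ×ˢ Ioc 0 T) volume := by
  have hMc : (M : ℂ) ≠ 0 := by exact_mod_cast hM.ne'
  have hheat := heatMultiplier_timeMultiplier hα hγ hρ hν hM ω
  obtain ⟨C, hC0, hC⟩ := heatMultiplier_l1_bound hα hγ hρ hν hM ω hT
  have hms : MeasurableSet (Icc (-R) R ×ˢ Ioc 0 T) := measurableSet_Icc.prod measurableSet_Ioc
  have e : EqOn (fun p : ℝ × ℝ => -(M : ℂ)⁻¹ * multiplierIntegral g (heatMultiplier α ω γ ρ ν M)
      p.1 p.2) (fun p : ℝ × ℝ => iteratedDeriv 2 (fun y => solution α ω γ ρ ν M g y p.2) p.1)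
      (Icc (-R) R ×ˢ Ioc 0 T) := by
    intro p hp
    have := (solution_contDiff (ω := ω) hα hγ hρ hν hM hg hp.2.1).2 p.1
    simp only
    rw [neg_mul, ← mul_neg, ← this, inv_mul_cancel_left₀ hMc]
  refine IntegrableOn.congr_fun ?_ e hms
  refine Integrable.const_mul ?_ _
  have hm : AEStronglyMeasurable (fun p : ℝ × ℝ => multiplierIntegral g
      (heatMultiplier α ω γ ρ ν M) p.1 p.2) (volume.restrict (Icc (-R) R ×ˢ Ioc 0 T)) :=
    ((hheat.continuousOn_integral hg).mono (prod_mono (subset_univ _)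
      Ioc_subset_Ioi_self)).aestronglyMeasurable hms
  have hk : AEStronglyMeasurable (fun p : ℝ × ℝ => fourierTransform g p.1 *
      heatMultiplier α ω γ ρ ν M p.1 p.2) (volume.prod (volume.restrict (Ioc 0 T))) := by
    have e : (volume : Measure ℝ).prod (volume.restrict (Ioc 0 T)) =
        (volume.prod volume).restrict (univ ×ˢ Ioc 0 T) := by
      rw [← Measure.prod_restrict, Measure.restrict_univ]
    rw [e]
    refine ContinuousOn.aestronglyMeasurable (ContinuousOn.mul ?_
      (hheat.cont.mono (prod_mono_right Ioc_subset_Ioi_self)))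
      (MeasurableSet.univ.prod measurableSet_Ioc)
    have := fourierTransform_continuous hg.int
    fun_prop
  have hint : Integrable (fun p : ℝ × ℝ => fourierTransform g p.1 *
      heatMultiplier α ω γ ρ ν M p.1 p.2) (volume.prod (volume.restrict (Ioc 0 T))) := by
    rw [integrable_prod_iff hk]
    refine ⟨Eventually.of_forall fun k => ?_, ?_⟩
    · exact Integrable.const_mul (f := heatMultiplier α ω γ ρ ν M k)
        (heatMultiplier_intervalIntegrable hα hγ hρ hν hM ω hT k).1 (fourierTransform g k)
    refine Integrable.mono' (hg.fourier.norm.mul_const C) hk.norm.integral_prod_right'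
      (Eventually.of_forall fun k => ?_)
    rw [Real.norm_of_nonneg (integral_nonneg fun _ => norm_nonneg _)]
    simp only [norm_mul]
    rw [integral_const_mul, ← intervalIntegral.integral_of_le hT.le]
    gcongr
    exact hC k
  have hB := hint.norm.integral_prod_right
  rw [Measure.volume_eq_prod, ← Measure.prod_restrict] at hm ⊢
  refine Integrable.mono' (hB.comp_snd (volume.restrict (Icc (-R) R))) hm
    (Eventually.of_forall fun p => ?_)
  exact norm_inverseFourierTransform_le _ _

end Existence

/-! ### Integrability of the solution over space and time. -/

section SpatialIntegrability

variable {α ω γ ρ ν M : ℝ} {g : ℝ → ℂ}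

theorem norm_modeSymbolDeriv₂_line_le (hα : 0 < α) (hγ : 0 ≤ γ) (hρ : ρ ∈ Ioo (0 : ℝ) 1)
    (hν : ν ∈ Icc (0 : ℝ) 1) (ω : ℝ) : ∃ K : ℝ, 0 ≤ K ∧ ∀ c, Admissible α ω γ ρ c →
      ∀ l : ℝ, 0 ≤ l → ∀ y : ℝ, ‖modeSymbolDeriv₂ α ω γ ρ ν l (c + y * Complex.I)‖ ≤
        K * ‖(c : ℂ) + y * Complex.I‖ ^ (-(2 + ν * (1 - ρ))) / c ^ ρ ∧
      ‖modeSymbolDeriv₂ α ω γ ρ ν l (c + y * Complex.I)‖ ≤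
        K * c ^ (-(2 + ν * (1 - ρ))) / c ^ ρ := by
  obtain ⟨K, hK0, hK⟩ := modeSymbolDeriv₂_bound (ω := ω) hα hγ hρ hν
  have hν0 : 0 ≤ ν * (1 - ρ) := mul_nonneg hν.1 (by linarith [hρ.2])
  refine ⟨K, hK0, fun c h l hl y => ?_⟩
  have hc := h.pos
  have h1 := (hK ((c : ℂ) + y * Complex.I) c h (by simp) l hl).1
  have h2 : ‖modeSymbolDeriv₂ α ω γ ρ ν l (c + y * Complex.I)‖ ≤
      K * ‖(c : ℂ) + y * Complex.I‖ ^ (-(2 + ν * (1 - ρ))) / c ^ ρ := by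
    refine h1.trans ?_
    have : 0 < c ^ ρ := by positivity
    gcongr
    linarith
  refine ⟨h2, h2.trans ?_⟩
  have h3 : ‖(c : ℂ) + y * Complex.I‖ ^ (-(2 + ν * (1 - ρ))) ≤ c ^ (-(2 + ν * (1 - ρ))) :=
    Real.rpow_le_rpow_of_nonpos hc (le_norm_line c y) (by linarith)
  have : 0 < c ^ ρ := by positivity
  gcongr

theorem line_kernel_continuous {c : ℝ} (h : Admissible α ω γ ρ c) (hα : 0 < α) (hγ : 0 ≤ γ)
    (hρ : ρ ∈ Ioo (0 : ℝ) 1) (hM : 0 < M) : Continuous fun p : ℝ × ℝ =>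
      modeSymbolDeriv₂ α ω γ ρ ν (M * p.1 ^ 2) (c + p.2 * Complex.I) :=
  (modeSymbolDeriv₂_continuous h hα hγ hρ).comp_continuous
    (f := fun p : ℝ × ℝ => (M * p.1 ^ 2, p.2)) (by fun_prop)
    fun p => ⟨mul_nonneg hM.le (sq_nonneg _), mem_univ _⟩

/-- Inverse Fourier transform in space of the second derivative of the Laplace symbol. -/
def lineProfile (α ω γ ρ ν M : ℝ) (g : ℝ → ℂ) (s : ℂ) (x : ℝ) : ℂ :=
  inverseFourierTransform (fun k => fourierTransform g k *
    modeSymbolDeriv₂ α ω γ ρ ν (M * k ^ 2) s) x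

theorem lineProfile_continuous {c : ℝ} (h : Admissible α ω γ ρ c) (hα : 0 < α) (hγ : 0 ≤ γ)
    (hρ : ρ ∈ Ioo (0 : ℝ) 1) (hν : ν ∈ Icc (0 : ℝ) 1) (hM : 0 < M) (hg : FourierPair g) :
    Continuous fun p : ℝ × ℝ => lineProfile α ω γ ρ ν M g (c + p.2 * Complex.I) p.1 := by
  obtain ⟨K, hK0, hK⟩ := norm_modeSymbolDeriv₂_line_le hα hγ hρ hν ω
  have hQ := line_kernel_continuous (ν := ν) h hα hγ hρ hM
  have hgc := fourierTransform_continuous hg.int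
  refine continuous_const.mul ?_
  refine continuous_of_dominated (bound := fun k => ‖fourierTransform g k‖ *
    (K * c ^ (-(2 + ν * (1 - ρ))) / c ^ ρ)) (fun p => ?_) (fun p => ?_)
    (hg.fourier.norm.mul_const _) ?_
  · refine Continuous.aestronglyMeasurable ((hgc.mul ?_).mul (by fun_prop))
    exact hQ.comp (by fun_prop : Continuous fun k : ℝ => (k, p.2))
  · refine Eventually.of_forall fun k => ?_
    rw [norm_mul, norm_mul, norm_cexp_neg_I_mul, mul_one]
    gcongr
    exact (hK c h _ (by positivity) p.2).2
  · refine Eventually.of_forall fun k => (continuous_const.mul ?_).mul (by fun_prop)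
    exact hQ.comp (by fun_prop : Continuous fun p : ℝ × ℝ => (k, p.2))

/-- Exchanging the frequency integral with the inversion integral isolates, at each point of the
line, a function of x whose L¹ norm is controlled by the resolvent estimate. -/
theorem solution_eq_line_integral {c : ℝ} (h : Admissible α ω γ ρ c) (hα : 0 < α) (hγ : 0 ≤ γ)
    (hρ : ρ ∈ Ioo (0 : ℝ) 1) (hν : ν ∈ Icc (0 : ℝ) 1) (hM : 0 < M) (hg : FourierPair g) {t : ℝ}
    (ht : 0 < t) (x : ℝ) : (t : ℂ) ^ 2 * solution α ω γ ρ ν M g x t =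
      (1 / (2 * Real.pi) : ℂ) * ∫ y : ℝ, Complex.exp ((c + y * Complex.I) * t) *
        lineProfile α ω γ ρ ν M g (c + y * Complex.I) x := by
  obtain ⟨K, hK0, hK⟩ := norm_modeSymbolDeriv₂_line_le hα hγ hρ hν ω
  have hQ := line_kernel_continuous (ν := ν) h hα hγ hρ hM
  have hgc := fourierTransform_continuous hg.int
  have hν0 : 0 ≤ ν * (1 - ρ) := mul_nonneg hν.1 (by linarith [hρ.2])
  set Φ : ℝ → ℝ → ℂ := fun k y => fourierTransform g k * Complex.exp (-Complex.I * k * x) *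
    (Complex.exp ((c + y * Complex.I) * t) *
      modeSymbolDeriv₂ α ω γ ρ ν (M * k ^ 2) (c + y * Complex.I)) with hΦ
  have hint : Integrable (Function.uncurry Φ) (volume.prod volume) := by
    have hb := hg.fourier.norm.mul_prod (((line_integrable (r := 2 + ν * (1 - ρ)) (by linarith)
      h.pos).1.const_mul K).div_const (c ^ ρ) |>.const_mul (Real.exp (c * t)))
    refine Integrable.mono' hb (Continuous.aestronglyMeasurable ?_) (Eventually.of_forall ?_)
    · refine Continuous.mul (by fun_prop) (Continuous.mul (by fun_prop) ?_)
      exact hQ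
    · rintro ⟨k, y⟩
      simp only [hΦ, Function.uncurry_apply_pair]
      rw [norm_mul, norm_mul, norm_mul, norm_cexp_neg_I_mul, mul_one, Complex.norm_exp]
      have : (((c : ℂ) + y * Complex.I) * t).re = c * t := by simp
      rw [this]
      gcongr
      exact (hK c h _ (by positivity) y).1
  have e1 : ∀ k, ∫ y, Φ k y = fourierTransform g k * Complex.exp (-Complex.I * k * x) *
      ∫ y : ℝ, Complex.exp ((c + y * Complex.I) * t) *
        modeSymbolDeriv₂ α ω γ ρ ν (M * k ^ 2) (c + y * Complex.I) := fun k =>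
    integral_const_mul _ _
  have e2 : ∀ y, (1 / (2 * Real.pi) : ℂ) * ∫ k, Φ k y = Complex.exp ((c + y * Complex.I) * t) *
      lineProfile α ω γ ρ ν M g (c + y * Complex.I) x := by
    intro y
    rw [lineProfile, inverseFourierTransform, mul_left_comm]
    congr 1
    rw [← integral_const_mul]
    congr 1 with k
    rw [hΦ]
    ring
  simp_rw [← e2]
  rw [integral_const_mul, ← integral_integral_swap hint]
  simp_rw [e1]
  rw [solution_eq, multiplierIntegral, inverseFourierTransform, mul_left_comm]
  congr 1
  rw [← integral_const_mul, ← integral_const_mul]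
  congr 1 with k
  have hm := modeSeries_eq_integral (ν := ν) h hα hγ hρ hν (by positivity : 0 ≤ M * k ^ 2) ht
  rw [modeMultiplier]
  linear_combination fourierTransform g k * Complex.exp (-Complex.I * k * x) * hm

/-- Integrate the L¹ bounds of the profiles along the line with abscissa κ/t, as in
`modeSeries_bound`. The decay exponent r = 2 + ν(1-ρ) + ρ gives t^{r-1} and, after division by t², a
power integrable at 0. -/
theorem solution_l1 (hα : 0 < α) (hγ : 0 ≤ γ) (hρ : ρ ∈ Ioo (0 : ℝ) 1)
    (hν : ν ∈ Icc (0 : ℝ) 1) (hM : 0 < M) (hg : FourierPair g) (ω T : ℝ) :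
    ∃ C : ℝ, 0 ≤ C ∧ ∀ t ∈ Ioc 0 T, Integrable (fun x => solution α ω γ ρ ν M g x t) ∧
      ∫ x, ‖solution α ω γ ρ ν M g x t‖ ≤ C * t ^ (ρ + ν * (1 - ρ) - 1) := by
  obtain ⟨c₀, hc₀⟩ := (eventually_admissible (ω := ω) (γ := γ) hα hρ.2).exists
  obtain ⟨K, hK0, hK⟩ := modeSymbolDeriv₂_l1 (ω := ω) hα hγ hρ hν hM hg
  have hν0 : 0 ≤ ν * (1 - ρ) := mul_nonneg hν.1 (by linarith [hρ.2])
  set r := 2 + ν * (1 - ρ) + ρ with hr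
  have hr1 : 1 < r := by linarith [hρ.1]
  set κ : ℝ := max 1 (c₀ * T) with hκ
  have hκ1 : 1 ≤ κ := le_max_left _ _
  have hL := lineConst_nonneg r
  refine ⟨Real.exp κ * K * lineConst r, by positivity, fun t ht => ?_⟩
  have ht0 := ht.1
  have hκ0 : 0 < κ := by linarith
  set c := κ / t with hcdef
  have hc : c₀ ≤ c := by
    rw [hcdef, le_div_iff₀ ht0]
    exact (mul_le_mul_of_nonneg_left ht.2 hc₀.pos.le).trans (le_max_right _ _)
  have h := hc₀.mono hα hγ hc
  have hct : c * t = κ := div_mul_cancel₀ _ ht0.ne'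
  set G : ℝ × ℝ → ℂ := fun p => Complex.exp ((c + p.2 * Complex.I) * t) *
    lineProfile α ω γ ρ ν M g (c + p.2 * Complex.I) p.1 with hG
  have hexp : ∀ y : ℝ, ‖Complex.exp ((c + y * Complex.I) * t)‖ = Real.exp κ := by
    intro y
    rw [Complex.norm_exp]
    simp [hct]
  have hGm : AEStronglyMeasurable G (volume.prod volume) :=
    Continuous.aestronglyMeasurable
      (Continuous.mul (by fun_prop) (lineProfile_continuous h hα hγ hρ hν hM hg))
  obtain ⟨iL, eL⟩ := line_integrable hr1 h.pos
  have hline := fun y : ℝ => hK ((c : ℂ) + y * Complex.I) c h (by simp)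
  have hGle : ∀ y, ∫ x, ‖G (x, y)‖ ≤ Real.exp κ * K * ‖(c : ℂ) + y * Complex.I‖ ^ (-r) := by
    intro y
    simp only [hG, norm_mul, hexp]
    rw [integral_const_mul, mul_assoc]
    gcongr
    exact (hline y).2
  have hGi : Integrable G (volume.prod volume) := by
    rw [integrable_prod_iff' hGm]
    refine ⟨Eventually.of_forall fun y => (hline y).1.const_mul
      (Complex.exp ((c + y * Complex.I) * t)), ?_⟩
    refine Integrable.mono' (iL.const_mul (Real.exp κ * K))
      hGm.norm.prod_swap.integral_prod_right' (Eventually.of_forall fun y => ?_)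
    rw [Real.norm_of_nonneg (integral_nonneg fun _ => norm_nonneg _)]
    exact hGle y
  have hpt : ∀ x, t ^ 2 * ‖solution α ω γ ρ ν M g x t‖ ≤ ∫ y, ‖G (x, y)‖ := by
    intro x
    have e := congrArg norm (solution_eq_line_integral h hα hγ hρ hν hM hg ht0 x)
    rw [norm_mul, norm_pow, Complex.norm_real, Real.norm_of_nonneg ht0.le, norm_mul] at e
    rw [e]
    have h2 : ‖(1 / (2 * Real.pi) : ℂ)‖ ≤ 1 := by
      rw [norm_div, norm_one, norm_mul, Complex.norm_real, Real.norm_of_nonneg Real.pi_pos.le,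
        div_le_one (by norm_num; exact Real.pi_pos)]
      have := Real.pi_gt_three
      norm_num
      linarith
    exact (mul_le_of_le_one_left (norm_nonneg _) h2).trans (norm_integral_le_integral_norm _)
  have hcont := ((solution_contDiff (ω := ω) hα hγ hρ hν hM hg ht0).1).continuous
  have hleft := hGi.norm.integral_prod_left
  have hint : Integrable (fun x => solution α ω γ ρ ν M g x t) := by
    refine Integrable.mono' (hleft.const_mul (t ^ 2)⁻¹) hcont.aestronglyMeasurable
      (Eventually.of_forall fun x => ?_)
    rw [← div_eq_inv_mul, le_div_iff₀ (by positivity), mul_comm]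
    exact hpt x
  refine ⟨hint, ?_⟩
  have hsum : t ^ 2 * ∫ x, ‖solution α ω γ ρ ν M g x t‖ ≤
      Real.exp κ * K * (c ^ (1 - r) * lineConst r) := by
    rw [← integral_const_mul]
    calc _ ≤ ∫ x, ∫ y, ‖G (x, y)‖ := integral_mono (hint.norm.const_mul _) hleft hpt
      _ = ∫ y, ∫ x, ‖G (x, y)‖ := integral_integral_swap hGi.norm
      _ ≤ ∫ y : ℝ, Real.exp κ * K * ‖(c : ℂ) + y * Complex.I‖ ^ (-r) :=
          integral_mono hGi.norm.integral_prod_right (iL.const_mul _) hGle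
      _ = _ := by rw [integral_const_mul, eL]
  have hcp : c ^ (1 - r) ≤ t ^ (r - 1) := by
    rw [hcdef, Real.div_rpow hκ0.le ht0.le, div_eq_mul_inv, ← Real.rpow_neg ht0.le, neg_sub]
    exact mul_le_of_le_one_left (by positivity)
      (Real.rpow_le_one_of_one_le_of_nonpos hκ1 (by linarith))
  have hfin : t ^ (r - 1) = t ^ 2 * t ^ (ρ + ν * (1 - ρ) - 1) := by
    rw [← Real.rpow_natCast, ← Real.rpow_add ht0]
    congr 1
    push_cast
    linarith
  have : t ^ 2 * ∫ x, ‖solution α ω γ ρ ν M g x t‖ ≤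
      t ^ 2 * (Real.exp κ * K * lineConst r * t ^ (ρ + ν * (1 - ρ) - 1)) := by
    refine hsum.trans ?_
    calc _ ≤ Real.exp κ * K * (t ^ (r - 1) * lineConst r) := by gcongr
      _ = _ := by rw [hfin]; ring
  exact le_of_mul_le_mul_left this (by positivity)

theorem solution_integrable (hα : 0 < α) (hγ : 0 ≤ γ) (hρ : ρ ∈ Ioo (0 : ℝ) 1)
    (hν : ν ∈ Icc (0 : ℝ) 1) (hM : 0 < M) (hg : FourierPair g) (ω T : ℝ) :
    IntegrableOn (fun p : ℝ × ℝ => solution α ω γ ρ ν M g p.1 p.2) (univ ×ˢ Ioc 0 T) volume := by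
  obtain ⟨C, hC0, hC⟩ := solution_l1 hα hγ hρ hν hM hg ω T
  have hp := mode_order_pos hρ hν
  have hm : AEStronglyMeasurable (fun p : ℝ × ℝ => solution α ω γ ρ ν M g p.1 p.2)
      (volume.restrict (univ ×ˢ Ioc 0 T)) := by
    simp_rw [solution_eq]
    exact (((modeMultiplier_timeMultiplier hα hγ hρ hν hM ω).continuousOn_integral hg).mono
      (prod_mono_right Ioc_subset_Ioi_self)).aestronglyMeasurable
      (MeasurableSet.univ.prod measurableSet_Ioc)
  rw [IntegrableOn]
  rw [Measure.volume_eq_prod, ← Measure.prod_restrict, Measure.restrict_univ] at hm ⊢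
  rw [integrable_prod_iff' hm]
  refine ⟨(ae_restrict_iff' measurableSet_Ioc).2 (Eventually.of_forall fun t ht => (hC t ht).1),
    ?_⟩
  have hi := ((intervalIntegral.intervalIntegrable_rpow' (a := 0) (b := T)
    (by linarith : -1 < ρ + ν * (1 - ρ) - 1)).const_mul C).1
  refine Integrable.mono' hi hm.norm.prod_swap.integral_prod_right'
    ((ae_restrict_iff' measurableSet_Ioc).2 (Eventually.of_forall fun t ht => ?_))
  rw [Real.norm_of_nonneg (integral_nonneg fun _ => norm_nonneg _)]
  exact (hC t ht).2

theorem solution_isSolution (hα : 0 < α) (hγ : 0 ≤ γ) (hρ : ρ ∈ Ioo (0 : ℝ) 1)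
    (hν : ν ∈ Icc (0 : ℝ) 1) (hM : 0 < M) (hg : FourierPair g) (ω : ℝ) :
    IsSolution α ω γ ρ ν M g (solution α ω γ ρ ν M g) where
  integrable T _ := solution_integrable hα hγ hρ hν hM hg ω T
  locallyIntegrable_dxx R _ _ hT := solution_dxx_integrable hα hγ hρ hν hM hg ω R hT
  contDiff _ ht := (solution_contDiff hα hγ hρ hν hM hg ht).1
  differentiable x := solution_differentiable hα hγ hρ hν hM hg ω x
  equation x _ ht := solution_equation hα hγ hρ hν hM hg ω x ht
  initial x := solution_initial hα hγ hρ hν hM hg ω x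
  decay t _ := by
    simp_rw [solution_eq]
    exact inverseFourierTransform_tendsto_zero _

end SpatialIntegrability

/-! ### Pointwise associativity of causal convolution. -/

section Associativity

variable {a b c d : ℝ} {f g : ℝ → ℂ}

/-- The convolution of the moduli is O(s^{a+b-1}), and a + b ≥ 1 makes this bounded down to s = 0.
The bound lets associativity hold at every t against a merely integrable function. -/
theorem LaplaceKernel.integral_norm_conv_le (hf : LaplaceKernel a c f) (hg : LaplaceKernel b d g)
    (hab : 1 ≤ a + b) {t : ℝ} (ht : 0 < t) :
    ∃ C : ℝ, 0 ≤ C ∧ ∀ s ∈ Ioc 0 t, ∫ τ in (0 : ℝ)..s, ‖f (s - τ) * g τ‖ ≤ C := by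
  obtain ⟨Cf, -, hfb⟩ := hf.bound t
  obtain ⟨Cg, -, hgb⟩ := hg.bound t
  obtain ⟨C, hC0, hC⟩ := (causalConv_bound_continuousAt hf.pos hg.pos (T := t)
    (f := fun τ => (‖f τ‖ : ℂ)) (g := fun τ => (‖g τ‖ : ℂ))
    (Complex.continuous_ofReal.comp_continuousOn hf.cont.norm)
    (Complex.continuous_ofReal.comp_continuousOn hg.cont.norm)
    (fun τ hτ => by simpa using hfb τ hτ) (fun τ hτ => by simpa using hgb τ hτ)).2
  refine ⟨C * t ^ (a + b - 1), by positivity, fun s hs => ?_⟩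
  have h1 := hC s hs
  have e : causalConv (fun τ => (‖f τ‖ : ℂ)) (fun τ => (‖g τ‖ : ℂ)) s =
      ((∫ τ in (0 : ℝ)..s, ‖f (s - τ) * g τ‖ : ℝ) : ℂ) := by
    rw [causalConv, ← intervalIntegral.integral_ofReal]
    simp
  rw [e, Complex.norm_real] at h1
  exact (le_abs_self _).trans (h1.trans (mul_le_mul_of_nonneg_left
    (Real.rpow_le_rpow hs.1.le hs.2 (by linarith)) hC0))

/-- Associativity of causal convolution against an integrable function, at every point. -/
theorem causalConv_assoc (hf : LaplaceKernel a c f) (hg : LaplaceKernel b d g) (hab : 1 ≤ a + b)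
    {u : ℝ → ℂ} {t : ℝ} (ht : 0 < t) (hu : IntervalIntegrable u volume 0 t) :
    IntervalIntegrable (fun σ => f (t - σ) * causalConv g u σ) volume 0 t ∧
    causalConv f (causalConv g u) t = causalConv (causalConv f g) u t := by
  obtain ⟨C, hC0, hC⟩ := hf.integral_norm_conv_le hg hab ht
  -- Fubini takes place on the triangle 0 < τ < σ < t; the strict inequalities keep the arguments of
  -- f and g positive.
  set S : Set (ℝ × ℝ) := {p | 0 < p.2 ∧ p.2 < p.1 ∧ p.1 < t} with hS
  have hSm : MeasurableSet S := by
    refine (measurableSet_lt measurable_const measurable_snd).inter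
      ((measurableSet_lt measurable_snd measurable_fst).inter
        (measurableSet_lt measurable_fst measurable_const))
  set K : ℝ × ℝ → ℂ := S.indicator fun p => f (t - p.1) * g (p.1 - p.2) with hK
  set U : ℝ → ℂ := (Ioo 0 t).indicator u with hU
  have hUi : Integrable U := (integrable_indicator_iff measurableSet_Ioo).2
    ((intervalIntegrable_iff_integrableOn_Ioo_of_le ht.le).1 hu)
  have hKm : AEStronglyMeasurable K (volume.prod volume) := by
    rw [hK, aestronglyMeasurable_indicator_iff hSm]
    refine ContinuousOn.aestronglyMeasurable (ContinuousOn.mul ?_ ?_) hSm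
    · exact hf.cont.comp (by fun_prop) fun p hp => by simpa using hp.2.2
    · exact hg.cont.comp (by fun_prop) fun p hp => by simpa using hp.2.1
  have hKτ : ∀ τ ∈ Ioo 0 t, (fun σ => K (σ, τ)) =
      (Ioo τ t).indicator fun σ => f (t - σ) * g (σ - τ) := by
    intro τ hτ
    ext σ
    by_cases h : σ ∈ Ioo τ t
    · rw [indicator_of_mem h, hK, indicator_of_mem (show (σ, τ) ∈ S from ⟨hτ.1, h.1, h.2⟩)]
    · rw [indicator_of_notMem h, hK,
        indicator_of_notMem (show (σ, τ) ∉ S from fun hs => h ⟨hs.2.1, hs.2.2⟩)]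
  have hshift : ∀ τ ∈ Ioo 0 t,
      IntervalIntegrable (fun σ => f (t - σ) * g (σ - τ)) volume τ t ∧
      ∫ σ in τ..t, f (t - σ) * g (σ - τ) = causalConv f g (t - τ) ∧
      ∫ σ in τ..t, ‖f (t - σ) * g (σ - τ)‖ ≤ C := by
    intro τ hτ
    have hpos : 0 < t - τ := by linarith [hτ.2]
    have h1 := (hf.conv_integrable hg hpos).comp_sub_right τ
    simp only [sub_sub_sub_cancel_right, zero_add, sub_add_cancel] at h1
    refine ⟨h1, ?_, ?_⟩
    · have := intervalIntegral.integral_comp_sub_right (a := τ) (b := t)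
        (fun s => f (t - τ - s) * g s) τ
      rw [sub_self] at this
      rw [causalConv, ← this]
      simp only [sub_sub_sub_cancel_right]
    · have := intervalIntegral.integral_comp_sub_right (a := τ) (b := t)
        (fun s => ‖f (t - τ - s) * g s‖) τ
      rw [sub_self] at this
      simp only [sub_sub_sub_cancel_right] at this
      rw [this]
      exact hC _ ⟨hpos, by linarith [hτ.1]⟩
  have hτint : ∀ τ ∈ Ioo 0 t, Integrable (fun σ => K (σ, τ)) ∧ ∫ σ, ‖K (σ, τ)‖ ≤ C ∧
      ∫ σ, K (σ, τ) = causalConv f g (t - τ) := by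
    intro τ hτ
    obtain ⟨h1, h2, h3⟩ := hshift τ hτ
    rw [hKτ τ hτ, integrable_indicator_iff measurableSet_Ioo]
    refine ⟨(intervalIntegrable_iff_integrableOn_Ioo_of_le hτ.2.le).1 h1, ?_, ?_⟩
    · have e : ∀ σ, ‖K (σ, τ)‖ = (Ioo τ t).indicator (fun σ => ‖f (t - σ) * g (σ - τ)‖) σ := by
        intro σ
        rw [congrFun (hKτ τ hτ) σ, norm_indicator_eq_indicator_norm]
      simp_rw [e]
      rw [integral_indicator measurableSet_Ioo, ← integral_Ioc_eq_integral_Ioo,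
        ← intervalIntegral.integral_of_le hτ.2.le]
      exact h3
    · rw [integral_indicator measurableSet_Ioo, ← integral_Ioc_eq_integral_Ioo,
        ← intervalIntegral.integral_of_le hτ.2.le]
      exact h2
  have hUz : ∀ τ, τ ∉ Ioo 0 t → U τ = 0 := fun τ hτ => indicator_of_notMem hτ _
  have hm : AEStronglyMeasurable (Function.uncurry fun σ τ => K (σ, τ) * U τ)
      (volume.prod volume) := hKm.mul hUi.aestronglyMeasurable.comp_snd
  have hint : Integrable (Function.uncurry fun σ τ => K (σ, τ) * U τ) (volume.prod volume) := by
    rw [integrable_prod_iff' hm]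
    refine ⟨Eventually.of_forall fun τ => ?_, ?_⟩
    · simp only [Function.uncurry_apply_pair]
      by_cases hτ : τ ∈ Ioo 0 t
      · exact (hτint τ hτ).1.mul_const _
      · simp [hUz τ hτ]
    · refine Integrable.mono' (hUi.norm.const_mul C) hm.norm.prod_swap.integral_prod_right'
        (Eventually.of_forall fun τ => ?_)
      rw [Real.norm_of_nonneg (integral_nonneg fun _ => norm_nonneg _)]
      simp only [Function.uncurry_apply_pair, norm_mul]
      rw [integral_mul_const]
      by_cases hτ : τ ∈ Ioo 0 t
      · have := (hτint τ hτ).2.1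
        gcongr
      · simp [hUz τ hτ]
  have e1 : ∀ σ ∈ Ioo 0 t, ∫ τ, K (σ, τ) * U τ = f (t - σ) * causalConv g u σ := by
    intro σ hσ
    have e : ∀ τ, K (σ, τ) * U τ = (Ioo 0 σ).indicator
        (fun τ => f (t - σ) * (g (σ - τ) * u τ)) τ := by
      intro τ
      by_cases h : τ ∈ Ioo 0 σ
      · rw [indicator_of_mem h, hK, indicator_of_mem (show (σ, τ) ∈ S from ⟨h.1, h.2, hσ.2⟩), hU,
          indicator_of_mem (show τ ∈ Ioo 0 t from ⟨h.1, h.2.trans hσ.2⟩)]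
        ring
      · rw [indicator_of_notMem h, hK,
          indicator_of_notMem (show (σ, τ) ∉ S from fun hs => h ⟨hs.1, hs.2.1⟩), zero_mul]
    simp_rw [e]
    rw [integral_indicator measurableSet_Ioo, integral_const_mul, ← integral_Ioc_eq_integral_Ioo,
      ← intervalIntegral.integral_of_le hσ.1.le, causalConv]
  have e1' : ∀ σ, σ ∉ Ioo 0 t → ∫ τ, K (σ, τ) * U τ = 0 := by
    intro σ hσ
    have e : ∀ τ, K (σ, τ) * U τ = 0 := fun τ => by
      rw [hK, indicator_of_notMem (show (σ, τ) ∉ S from fun hs => hσ ⟨hs.1.trans hs.2.1, hs.2.2⟩),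
        zero_mul]
    simp_rw [e, integral_zero]
  have e2 : ∀ τ, ∫ σ, K (σ, τ) * U τ =
      (Ioo 0 t).indicator (fun τ => causalConv f g (t - τ) * u τ) τ := by
    intro τ
    rw [integral_mul_const]
    by_cases hτ : τ ∈ Ioo 0 t
    · rw [indicator_of_mem hτ, (hτint τ hτ).2.2, hU, indicator_of_mem hτ]
    · rw [indicator_of_notMem hτ, hUz τ hτ, mul_zero]
  have e3 : ∀ σ, ∫ τ, K (σ, τ) * U τ =
      (Ioo 0 t).indicator (fun σ => f (t - σ) * causalConv g u σ) σ := by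
    intro σ
    by_cases hσ : σ ∈ Ioo 0 t
    · rw [indicator_of_mem hσ, e1 σ hσ]
    · rw [indicator_of_notMem hσ, e1' σ hσ]
  constructor
  · rw [intervalIntegrable_iff_integrableOn_Ioo_of_le ht.le,
      ← integrable_indicator_iff measurableSet_Ioo]
    exact hint.integral_prod_left.congr (Eventually.of_forall e3)
  · have h := integral_integral_swap hint
    simp_rw [e2, e3] at h
    rw [integral_indicator measurableSet_Ioo, integral_indicator measurableSet_Ioo,
      ← integral_Ioc_eq_integral_Ioo, ← integral_Ioc_eq_integral_Ioo,
      ← intervalIntegral.integral_of_le ht.le, ← intervalIntegral.integral_of_le ht.le] at h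
    exact h

end Associativity

/-! ### Semigroup property and inversion of Prabhakar integrals. -/

section KernelInverses

variable {α ω μ β μ' β' : ℝ}

theorem prabhakarKernel_laplaceKernel (hα : 0 < α) (ω : ℝ) : ∃ c : ℝ, 0 < c ∧ ∀ μ β : ℝ, 0 < μ →
    LaplaceKernel μ c (fun t => (prabhakarKernel α μ ω β t : ℂ)) := by
  obtain ⟨c, h⟩ := (eventually_admissible (ω := ω) (γ := 0) hα (by norm_num : (0:ℝ) < 1)).exists
  exact ⟨c, h.pos, fun μ β hμ => (prabhakarKernel_laplace β hα hμ h.pos h.small_lt).1⟩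

/-- Symbols multiply by adding orders and exponents; injectivity of the Laplace transform does the
rest. -/
theorem prabhakarKernel_conv (hα : 0 < α) (hμ : 0 < μ) (hμ' : 0 < μ') (ω β β' : ℝ) {t : ℝ}
    (ht : 0 < t) :
    causalConv (fun t => (prabhakarKernel α μ ω β t : ℂ))
      (fun t => (prabhakarKernel α μ' ω β' t : ℂ)) t =
      (prabhakarKernel α (μ + μ') ω (β + β') t : ℂ) := by
  obtain ⟨c, h⟩ := (eventually_admissible (ω := ω) (γ := 0) hα (by norm_num : (0:ℝ) < 1)).exists
  obtain ⟨k1, l1⟩ := prabhakarKernel_laplace β hα hμ h.pos h.small_lt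
  obtain ⟨k2, l2⟩ := prabhakarKernel_laplace β' hα hμ' h.pos h.small_lt
  obtain ⟨k3, l3⟩ := prabhakarKernel_laplace (β + β') hα (add_pos hμ hμ') h.pos h.small_lt
  refine (k1.conv k2).ext k3 (fun s hs => ?_) ht
  rw [k1.laplace_conv k2 hs.ge, l1 s hs.ge, l2 s hs.ge, l3 s hs.ge, prabhakarSymbol_mul h hα hs.ge]

theorem causalConv_congr_left {f f' g : ℝ → ℂ} (h : EqOn f f' (Ioi 0)) {t : ℝ} (ht : 0 < t) :
    causalConv f g t = causalConv f' g t := by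
  rw [causalConv, causalConv, intervalIntegral.integral_of_le ht.le,
    intervalIntegral.integral_of_le ht.le, integral_Ioc_eq_integral_Ioo,
    integral_Ioc_eq_integral_Ioo]
  refine setIntegral_congr_fun measurableSet_Ioo fun τ hτ => ?_
  rw [h (by simpa using hτ.2)]

theorem causalConv_congr_right {f g g' : ℝ → ℂ} (h : EqOn g g' (Ioi 0)) {t : ℝ} (ht : 0 < t) :
    causalConv f g t = causalConv f g' t := by
  rw [causalConv, causalConv, intervalIntegral.integral_of_le ht.le,
    intervalIntegral.integral_of_le ht.le]
  refine setIntegral_congr_fun measurableSet_Ioc fun τ hτ => ?_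
  rw [h hτ.1]

/-- The Prabhakar integral of order `μ < 1` is inverted, up to one integration, by the kernel of
complementary order. -/
theorem causalConv_prabhakarIntegral (hα : 0 < α) (h0 : 0 ≤ μ) (h1 : μ < 1) (hβ : μ = 0 → β = 0)
    (ω : ℝ) {u : ℝ → ℂ} {t : ℝ} (ht : 0 < t) (hu : IntervalIntegrable u volume 0 t) :
    IntervalIntegrable (fun τ => (prabhakarKernel α (1 - μ) ω (-β) (t - τ) : ℂ) *
      prabhakarIntegral α μ ω β u τ) volume 0 t ∧
    causalConv (fun t => (prabhakarKernel α (1 - μ) ω (-β) t : ℂ))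
      (prabhakarIntegral α μ ω β u) t = ∫ τ in (0 : ℝ)..t, u τ := by
  rcases h0.eq_or_lt with h | h
  · subst h
    have hβ0 := hβ rfl
    subst hβ0
    have e : prabhakarIntegral α 0 ω 0 u = u := by
      ext t
      simp [prabhakarIntegral, prabhakarKernel_zero]
    rw [e]
    simpa [causalConv, prabhakarKernel_one] using hu
  · obtain ⟨c, -, hc⟩ := prabhakarKernel_laplaceKernel hα ω
    have e : prabhakarIntegral α μ ω β u =
        causalConv (fun t => (prabhakarKernel α μ ω β t : ℂ)) u := by
      ext t
      rw [prabhakarIntegral, if_neg h.ne', zero_add, causalConv]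
    have hpos : 0 < 1 - μ := by linarith
    obtain ⟨i, a⟩ := causalConv_assoc (hc (1 - μ) (-β) hpos) (hc μ β h) (by linarith) ht hu
    rw [e]
    refine ⟨i, a.trans ?_⟩
    rw [causalConv_congr_left (f' := fun _ => 1) (fun s hs => ?_) ht]
    · simp [causalConv]
    · rw [prabhakarKernel_conv hα hpos h ω _ _ hs, sub_add_cancel, neg_add_cancel,
        prabhakarKernel_one]
      simp

end KernelInverses

/-! ### The inner integral as the primitive of its derivative. -/

section FundamentalTheorem

variable {α ω γ ρ ν : ℝ} {u : ℝ → ℂ}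

/-- The fundamental theorem is applied to the absolutely continuous extension f. It agrees with the
inner integral on (0, b] only, so its value at 0 has to come from the initial condition. -/
theorem HilferPrabhakarDifferentiable.inner_eq_integral
    (h : HilferPrabhakarDifferentiable α ω γ ρ ν u) {z : ℂ}
    (h0 : Tendsto (innerIntegral α ω γ ρ ν u) (𝓝[>] 0) (𝓝 z)) {b : ℝ} (hb : 0 < b) :
    IntervalIntegrable (deriv (innerIntegral α ω γ ρ ν u)) volume 0 b ∧
    innerIntegral α ω γ ρ ν u b = z + ∫ τ in (0 : ℝ)..b, deriv (innerIntegral α ω γ ρ ν u) τ := by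
  obtain ⟨f, hf, hfe⟩ := h.inner_absolutelyContinuous b hb
  set F := innerIntegral α ω γ ρ ν u with hF
  obtain ⟨hr, hi⟩ := absolutelyContinuousOnInterval_re_im hf
  have hf0 : f 0 = z := by
    have hc := hf.continuousOn
    rw [uIcc_of_le hb.le] at hc
    have h1 := (hc 0 ⟨le_rfl, hb.le⟩).mono Ioc_subset_Icc_self
    rw [ContinuousWithinAt, nhdsWithin_Ioc_eq_nhdsGT hb] at h1
    refine tendsto_nhds_unique (h1.congr' ?_) h0
    filter_upwards [Ioc_mem_nhdsGT hb] with t ht using hfe t ht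
  have hder : ∀ t ∈ Ioo 0 b, HasDerivAt f (deriv F t) t := by
    intro t ht
    refine (h.inner_differentiable t ht.1).hasDerivAt.congr_of_eventuallyEq ?_
    filter_upwards [Ioo_mem_nhds ht.1 ht.2] with s hs using hfe s ⟨hs.1, hs.2.le⟩
  have dr : EqOn (deriv fun t => (f t).re) (fun t => (deriv F t).re) (Ioo 0 b) := fun t ht =>
    (Complex.reCLM.hasFDerivAt.comp_hasDerivAt t (hder t ht)).deriv
  have di : EqOn (deriv fun t => (f t).im) (fun t => (deriv F t).im) (Ioo 0 b) := fun t ht =>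
    (Complex.imCLM.hasFDerivAt.comp_hasDerivAt t (hder t ht)).deriv
  have ir : IntegrableOn (fun t => (deriv F t).re) (Ioo 0 b) :=
    ((intervalIntegrable_iff_integrableOn_Ioo_of_le hb.le).1 hr.intervalIntegrable_deriv).congr_fun
      dr measurableSet_Ioo
  have ii : IntegrableOn (fun t => (deriv F t).im) (Ioo 0 b) :=
    ((intervalIntegrable_iff_integrableOn_Ioo_of_le hb.le).1 hi.intervalIntegrable_deriv).congr_fun
      di measurableSet_Ioo
  have hF' : IntegrableOn (deriv F) (Ioo 0 b) := by
    refine (ir.ofReal.add (ii.ofReal.mul_const Complex.I)).congr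
      (Eventually.of_forall fun t => ?_)
    exact Complex.re_add_im _
  have hF'' := (intervalIntegrable_iff_integrableOn_Ioo_of_le hb.le).2 hF'
  refine ⟨hF'', ?_⟩
  have er := hr.integral_deriv_eq_sub
  have ei := hi.integral_deriv_eq_sub
  rw [intervalIntegral.integral_of_le hb.le, integral_Ioc_eq_integral_Ioo,
    setIntegral_congr_fun measurableSet_Ioo dr, ← integral_Ioc_eq_integral_Ioo,
    ← intervalIntegral.integral_of_le hb.le] at er
  rw [intervalIntegral.integral_of_le hb.le, integral_Ioc_eq_integral_Ioo,
    setIntegral_congr_fun measurableSet_Ioo di, ← integral_Ioc_eq_integral_Ioo,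
    ← intervalIntegral.integral_of_le hb.le] at ei
  have cr := Complex.reCLM.intervalIntegral_comp_comm hF''
  have ci := Complex.imCLM.intervalIntegral_comp_comm hF''
  simp only [Complex.reCLM_apply, Complex.imCLM_apply] at cr ci
  rw [← hfe b ⟨hb, le_rfl⟩, ← hf0]
  apply Complex.ext
  · rw [Complex.add_re, ← cr, er]; ring
  · rw [Complex.add_im, ← ci, ei]; ring

end FundamentalTheorem

/-! ### The equation integrated in time. -/

section IntegratedEquation

variable {α ω γ ρ ν M : ℝ} {g : ℝ → ℂ} {ψ : ℝ → ℝ → ℂ}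

theorem causalConv_const_mul_right (f u : ℝ → ℂ) (z : ℂ) (t : ℝ) :
    causalConv f (fun τ => z * u τ) t = z * causalConv f u t := by
  rw [causalConv, causalConv, ← intervalIntegral.integral_const_mul]
  congr 1 with τ
  ring

theorem order_lt_one (hρ : ρ ∈ Ioo (0 : ℝ) 1) {ν : ℝ} (hν : ν ∈ Icc (0 : ℝ) 1) :
    0 ≤ ν * (1 - ρ) ∧ ν * (1 - ρ) < 1 := by
  have h := hρ.2
  have h' := hρ.1
  exact ⟨mul_nonneg hν.1 (by linarith), by nlinarith [hν.1, hν.2]⟩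

/-- Time-integrated form of the equation. -/
theorem IsSolution.integrated (h : IsSolution α ω γ ρ ν M g ψ) (hα : 0 < α)
    (hρ : ρ ∈ Ioo (0 : ℝ) 1) (hν : ν ∈ Icc (0 : ℝ) 1) {x : ℝ}
    {t : ℝ} (ht : 0 < t)
    (hx : IntervalIntegrable (fun τ => iteratedDeriv 2 (fun y => ψ y τ) x) volume 0 t) :
    ∫ τ in (0 : ℝ)..t, ψ x τ = g x * causalConv
        (fun t => (prabhakarKernel α (1 - (1 - ν) * (1 - ρ)) ω (-(-γ * (1 - ν))) t : ℂ))
        (fun _ => 1) t +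
      M * causalConv (fun t => (prabhakarKernel α (1 + ρ) ω γ t : ℂ))
        (fun τ => iteratedDeriv 2 (fun y => ψ y τ) x) t := by
  have hν' : 1 - ν ∈ Icc (0 : ℝ) 1 := ⟨by linarith [hν.2], by linarith [hν.1]⟩
  obtain ⟨a0, a1⟩ := order_lt_one hρ hν'
  obtain ⟨b0, b1⟩ := order_lt_one hρ hν
  have hρ1 : 1 - ρ ≠ 0 := by linarith [hρ.2]
  obtain ⟨c, hc0, hc⟩ := prabhakarKernel_laplaceKernel hα ω
  set V : ℝ → ℂ := fun τ => iteratedDeriv 2 (fun y => ψ y τ) x with hV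
  set pa : ℝ → ℂ :=
    fun t => (prabhakarKernel α (1 - (1 - ν) * (1 - ρ)) ω (-(-γ * (1 - ν))) t : ℂ) with hpa
  set pb : ℝ → ℂ := fun t => (prabhakarKernel α (1 - ν * (1 - ρ)) ω (-(-γ * ν)) t : ℂ) with hpb
  have ka : LaplaceKernel _ c pa := hc _ _ (by linarith)
  have kb : LaplaceKernel _ c pb := hc _ _ (by linarith)
  -- The inner integral F equals g + ∫ F', and ∫ F' is recovered by convolving the outer integral,
  -- which by the equation is M ∂ₓ²ψ, with the complementary kernel pb.
  have hF : EqOn (innerIntegral α ω γ ρ ν (ψ x))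
      (fun s => g x * 1 + M * causalConv pb V s) (Ioc 0 t) := by
    intro s hs
    obtain ⟨i, e⟩ := (h.differentiable x).inner_eq_integral (h.initial x) hs.1
    obtain ⟨-, e2⟩ := causalConv_prabhakarIntegral hα b0 b1 (β := -γ * ν) (fun h0 => by
      rw [(mul_eq_zero.1 h0).resolve_right hρ1, mul_zero]) ω hs.1 i
    simp only [mul_one]
    rw [e, ← e2, ← causalConv_const_mul_right]
    congr 1
    exact causalConv_congr_right (fun τ hτ => h.equation x τ hτ) hs.1
  -- In the same way, convolving F with pa gives the time integral of ψ.
  obtain ⟨-, e3⟩ := causalConv_prabhakarIntegral hα a0 a1 (β := -γ * (1 - ν)) (fun h0 => by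
    rw [(mul_eq_zero.1 h0).resolve_right hρ1, mul_zero]) ω ht
    ((h.differentiable x).locallyIntegrable t ht)
  obtain ⟨i4, e4⟩ := causalConv_assoc ka kb
    (by nlinarith [hρ.1]) ht hx
  have i5 : IntervalIntegrable (fun τ => pa (t - τ) * 1) volume 0 t := by
    obtain ⟨C, -, hC⟩ := ka.bound t
    exact causalConv_integrable_of_bound (b := 1) (Cg := 1) ka.pos one_pos ka.cont
      continuousOn_const ht hC fun τ _ => by simp
  have e6 : causalConv pa (innerIntegral α ω γ ρ ν (ψ x)) t =
      g x * causalConv pa (fun _ => 1) t + M * causalConv pa (causalConv pb V) t := by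
    have e7 : causalConv pa (innerIntegral α ω γ ρ ν (ψ x)) t =
        causalConv pa (fun s => g x * 1 + M * causalConv pb V s) t := by
      rw [causalConv, causalConv, intervalIntegral.integral_of_le ht.le,
        intervalIntegral.integral_of_le ht.le]
      refine setIntegral_congr_fun measurableSet_Ioc fun τ hτ => ?_
      rw [hF hτ]
    rw [e7, causalConv, causalConv, causalConv, ← intervalIntegral.integral_const_mul,
      ← intervalIntegral.integral_const_mul, ← intervalIntegral.integral_add (i5.const_mul _)
      (i4.const_mul _)]
    congr 1 with τ
    ring
  rw [← e3]
  refine e6.trans ?_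
  rw [e4]
  congr 2
  refine causalConv_congr_left (fun s hs => ?_) ht
  simp only [hpa, hpb]
  -- The complementary orders add up to 2 - (1 - ρ) = 1 + ρ and the exponents to γ(1-ν) + γν = γ, so
  -- ν drops out of the kernel.
  rw [prabhakarKernel_conv hα (by linarith) (by linarith) ω _ _ hs]
  congr 2 <;> ring

end IntegratedEquation

/-! ### Weak form of the integrated equation. -/

section WeakForm

theorem integral_mul_iteratedDeriv_two {η v : ℝ → ℂ} (hη : ContDiff ℝ 2 η) (hv : ContDiff ℝ 2 v)
    (hc : HasCompactSupport η) :
    ∫ x, η x * iteratedDeriv 2 v x = ∫ x, iteratedDeriv 2 η x * v x := by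
  have e : ∀ f : ℝ → ℂ, iteratedDeriv 2 f = deriv (deriv f) := fun f => by
    rw [iteratedDeriv_succ, iteratedDeriv_one]
  have hd : ∀ {f : ℝ → ℂ}, ContDiff ℝ 2 f → ContDiff ℝ 1 (deriv f) := fun {f} hf => by
    have := ContDiff.iterate_deriv' (𝕜 := ℝ) 1 1 (f := f) (by norm_num; exact hf)
    simpa using this
  have c0 : ∀ {f : ℝ → ℂ}, ContDiff ℝ 2 f → Continuous f := fun hf => hf.continuous
  have c1 : ∀ {f : ℝ → ℂ}, ContDiff ℝ 2 f → Continuous (deriv f) := fun hf => (hd hf).continuous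
  have c2 : ∀ {f : ℝ → ℂ}, ContDiff ℝ 2 f → Continuous (deriv (deriv f)) := fun hf =>
    (hd hf).continuous_deriv le_rfl
  have d0 : ∀ {f : ℝ → ℂ}, ContDiff ℝ 2 f → ∀ x, HasDerivAt f (deriv f x) x := fun hf x =>
    ((hf.differentiable (by norm_num)) x).hasDerivAt
  have d1 : ∀ {f : ℝ → ℂ}, ContDiff ℝ 2 f → ∀ x, HasDerivAt (deriv f) (deriv (deriv f) x) x :=
    fun hf x => (((hd hf).differentiable (by norm_num)) x).hasDerivAt
  have int : ∀ {f h : ℝ → ℂ}, Continuous f → Continuous h → HasCompactSupport f →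
      Integrable (f * h) := fun hf hh hfc =>
    (hf.mul hh).integrable_of_hasCompactSupport hfc.mul_right
  rw [e, e, integral_mul_deriv_eq_deriv_mul_of_integrable (fun x _ => d0 hη x) (fun x _ => d1 hv x)
    (int (c0 hη) (c2 hv) hc) (int (c1 hη) (c1 hv) hc.deriv) (int (c0 hη) (c1 hv) hc),
    integral_mul_deriv_eq_deriv_mul_of_integrable (fun x _ => d1 hη x) (fun x _ => d0 hv x)
    (int (c1 hη) (c1 hv) hc.deriv) (int (c2 hη) (c0 hv) hc.deriv.deriv)
    (int (c1 hη) (c0 hv) hc.deriv), neg_neg]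

/-- Integrability hypotheses and time-integrated equation `∫₀ᵗ φ = M q * ∂ₓ²φ` satisfied by the
difference of two solutions. -/
structure IntegratedEquation (M : ℝ) (q : ℝ → ℂ) (φ : ℝ → ℝ → ℂ) : Prop where
  integrable : ∀ T : ℝ, 0 < T →
    IntegrableOn (fun p : ℝ × ℝ => φ p.1 p.2) (univ ×ˢ Ioc 0 T) volume
  locallyIntegrable_dxx : ∀ R T : ℝ, 0 < R → 0 < T →
    IntegrableOn (fun p : ℝ × ℝ => iteratedDeriv 2 (fun y => φ y p.2) p.1)
      (Icc (-R) R ×ˢ Ioc 0 T) volume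
  contDiff : ∀ t : ℝ, 0 < t → ContDiff ℝ 2 (fun x => φ x t)
  equation : ∀ᵐ x : ℝ, ∀ t : ℝ, 0 < t → ∫ τ in (0 : ℝ)..t, φ x τ =
    M * causalConv q (fun τ => iteratedDeriv 2 (fun y => φ y τ) x) t

variable {M c r : ℝ} {q : ℝ → ℂ} {φ : ℝ → ℝ → ℂ}

theorem IntegratedEquation.integrable_prod (h : IntegratedEquation M q φ) {t : ℝ} (ht : 0 < t) :
    Integrable (fun p : ℝ × ℝ => φ p.1 p.2) (volume.prod (volume.restrict (Ioo 0 t))) := by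
  have h1 := (h.integrable t ht).mono_set
    (prod_mono_right (s := univ) (Ioo_subset_Ioc_self : Ioo 0 t ⊆ Ioc 0 t))
  rw [IntegrableOn, Measure.volume_eq_prod, ← Measure.prod_restrict, Measure.restrict_univ] at h1
  exact h1

/-- A kernel of order at least 1 has no singularity at 0; this is the benefit of integrating the
equation in time. -/
theorem LaplaceKernel.reflected_bound (hq : LaplaceKernel (1 + r) c q) (hr : 0 ≤ r) {t : ℝ}
    (ht : 0 < t) : ∃ C : ℝ, 0 ≤ C ∧ ∀ τ ∈ Ioo 0 t, ‖q (t - τ)‖ ≤ C := by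
  obtain ⟨C, hC0, hC⟩ := hq.bound t
  refine ⟨C * t ^ r, by positivity, fun τ hτ => ?_⟩
  have h1 := hC (t - τ) ⟨by linarith [hτ.2], by linarith [hτ.1]⟩
  rw [add_sub_cancel_left] at h1
  exact h1.trans (mul_le_mul_of_nonneg_left
    (Real.rpow_le_rpow (by linarith [hτ.2]) (by linarith [hτ.1]) hr) hC0)

theorem reflected_aestronglyMeasurable (hq : ContinuousOn q (Ioi 0)) (t : ℝ) :
    AEStronglyMeasurable (fun p : ℝ × ℝ => q (t - p.2))
      ((volume : Measure ℝ).prod (volume.restrict (Ioo 0 t))) := by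
  have : AEStronglyMeasurable (fun τ : ℝ => q (t - τ)) (volume.restrict (Ioo 0 t)) :=
    (hq.comp (by fun_prop) fun τ hτ => by simpa using hτ.2).aestronglyMeasurable measurableSet_Ioo
  exact this.comp_snd

theorem ae_snd_mem (t : ℝ) :
    ∀ᵐ p : ℝ × ℝ ∂((volume : Measure ℝ).prod (volume.restrict (Ioo 0 t))), p.2 ∈ Ioo 0 t := by
  have h : ∀ᵐ τ ∂(volume.restrict (Ioo 0 t)), τ ∈ Ioo 0 t := ae_restrict_mem measurableSet_Ioo
  exact Measure.quasiMeasurePreserving_snd.ae h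

/-- ∂ₓ²φ is only locally integrable in x, so the equation is tested with a compactly supported η and
both derivatives are moved onto η, next to the globally integrable φ. -/
theorem IntegratedEquation.weak_form (h : IntegratedEquation M q φ)
    (hq : LaplaceKernel (1 + r) c q) (hr : 0 ≤ r) {t : ℝ} (ht : 0 < t) {η : ℝ → ℂ}
    (hη : ContDiff ℝ 2 η) (hc : HasCompactSupport η) :
    ∫ p : ℝ × ℝ, η p.1 * φ p.1 p.2 ∂(volume.prod (volume.restrict (Ioo 0 t))) =
      M * ∫ p : ℝ × ℝ, q (t - p.2) * (iteratedDeriv 2 η p.1 * φ p.1 p.2)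
        ∂(volume.prod (volume.restrict (Ioo 0 t))) := by
  set μ := (volume : Measure ℝ).prod (volume.restrict (Ioo 0 t)) with hμ
  have hφ := h.integrable_prod ht
  obtain ⟨Cq, hCq0, hCq⟩ := hq.reflected_bound hr ht
  have hqm := reflected_aestronglyMeasurable hq.cont t
  have hqb : ∀ᵐ p ∂μ, ‖q (t - p.2)‖ ≤ Cq := (ae_snd_mem t).mono fun p hp => hCq p.2 hp
  obtain ⟨Cη, hCη⟩ := hc.exists_bound_of_continuous hη.continuous
  have hη2c : Continuous (iteratedDeriv 2 η) := hη.continuous_iteratedDeriv 2 le_rfl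
  have hη2s : HasCompactSupport (iteratedDeriv 2 η) := by
    rw [iteratedDeriv_succ, iteratedDeriv_one]; exact hc.deriv.deriv
  obtain ⟨Cη2, hCη2⟩ := hη2s.exists_bound_of_continuous hη2c
  have i1 : Integrable (fun p : ℝ × ℝ => η p.1 * φ p.1 p.2) μ :=
    hφ.bdd_mul (hη.continuous.comp continuous_fst).aestronglyMeasurable
      (Eventually.of_forall fun p => hCη p.1)
  have i2 : Integrable (fun p : ℝ × ℝ => q (t - p.2) * (iteratedDeriv 2 η p.1 * φ p.1 p.2)) μ :=
    (hφ.bdd_mul (hη2c.comp continuous_fst).aestronglyMeasurable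
      (Eventually.of_forall fun p => hCη2 p.1)).bdd_mul hqm hqb
  set W : ℝ × ℝ → ℂ := fun p => iteratedDeriv 2 (fun y => φ y p.2) p.1 with hW
  obtain ⟨R, hR0, hR⟩ : ∃ R : ℝ, 0 < R ∧ ∀ x, x ∉ Icc (-R) R → η x = 0 := by
    obtain ⟨R, hR⟩ := hc.isCompact.isBounded.subset_closedBall 0
    refine ⟨max R 1, by positivity, fun x hx => ?_⟩
    by_contra hne
    apply hx
    have := hR (subset_tsupport η hne)
    rw [Real.closedBall_eq_Icc, zero_sub, zero_add] at this
    exact ⟨by linarith [this.1, le_max_left R 1], this.2.trans (le_max_left R 1)⟩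
  have i3 : Integrable (fun p : ℝ × ℝ => η p.1 * W p) μ := by
    have h1 := (h.locallyIntegrable_dxx R t hR0 ht).mono_set
      (prod_mono_right (s := Icc (-R) R) (Ioo_subset_Ioc_self : Ioo 0 t ⊆ Ioc 0 t))
    have hms : MeasurableSet (Icc (-R) R ×ˢ (univ : Set ℝ)) :=
      measurableSet_Icc.prod MeasurableSet.univ
    have h2 : IntegrableOn W (Icc (-R) R ×ˢ univ) μ := by
      rw [IntegrableOn, hμ, ← Measure.prod_restrict, Measure.restrict_univ, Measure.prod_restrict]
      exact h1
    have h3 := ((integrable_indicator_iff hms).2 h2).bdd_mul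
      (hη.continuous.comp continuous_fst).aestronglyMeasurable
      (Eventually.of_forall fun p => hCη p.1)
    refine h3.congr (Eventually.of_forall fun p => ?_)
    simp only [Function.comp_apply]
    by_cases hp : p.1 ∈ Icc (-R) R
    · rw [indicator_of_mem (show p ∈ Icc (-R) R ×ˢ (univ : Set ℝ) from ⟨hp, mem_univ _⟩)]
    · rw [hR p.1 hp, zero_mul, zero_mul]
  have i4 : Integrable (fun p : ℝ × ℝ => q (t - p.2) * (η p.1 * W p)) μ := i3.bdd_mul hqm hqb
  have ibp : ∫ p, q (t - p.2) * (η p.1 * W p) ∂μ =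
      ∫ p : ℝ × ℝ, q (t - p.2) * (iteratedDeriv 2 η p.1 * φ p.1 p.2) ∂μ := by
    rw [hμ, integral_prod_symm _ i4, integral_prod_symm _ i2]
    refine setIntegral_congr_fun measurableSet_Ioo fun τ hτ => ?_
    simp only [hW]
    rw [integral_const_mul, integral_const_mul,
      integral_mul_iteratedDeriv_two hη (h.contDiff τ hτ.1) hc]
  rw [← ibp, hμ, integral_prod _ i1, integral_prod _ i4, ← integral_const_mul]
  refine integral_congr_ae (h.equation.mono fun x hx => ?_)
  have hx := hx t ht
  rw [intervalIntegral.integral_of_le ht.le, integral_Ioc_eq_integral_Ioo, causalConv,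
    intervalIntegral.integral_of_le ht.le, integral_Ioc_eq_integral_Ioo] at hx
  simp only
  rw [integral_const_mul, hx, ← integral_const_mul, ← integral_const_mul, ← integral_const_mul]
  congr 1 with τ
  simp only [hW]
  ring

end WeakForm

/-! ### Homogeneous Volterra equations. -/

section Volterra

variable {a c : ℝ} {f V : ℝ → ℂ}

/-- Dominated convergence as d → ∞; the lemma lets an exponential weight turn convolution with f
into a contraction. -/
theorem LaplaceKernel.tendsto_weighted_norm (hf : LaplaceKernel a c f) :
    Tendsto (fun d : ℝ => ∫ s in Ioi (0 : ℝ), Real.exp (-(d * s)) * ‖f s‖) atTop (𝓝 0) := by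
  have hb : Integrable (fun s : ℝ => Real.exp (-(c * s)) * ‖f s‖) (volume.restrict (Ioi 0)) := by
    refine hf.integrable.norm.congr (Eventually.of_forall fun s => ?_)
    simp only [norm_mul, Complex.norm_exp]
    simp
  have h := tendsto_integral_filter_of_dominated_convergence
    (F := fun (d : ℝ) (s : ℝ) => Real.exp (-(d * s)) * ‖f s‖) (f := fun _ => 0) (l := atTop)
    (μ := volume.restrict (Ioi (0 : ℝ))) (fun s => Real.exp (-(c * s)) * ‖f s‖) ?_ ?_ hb ?_
  · simpa using h
  · refine Eventually.of_forall fun d => ContinuousOn.aestronglyMeasurable ?_ measurableSet_Ioi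
    exact ContinuousOn.mul (by fun_prop) hf.cont.norm
  · filter_upwards [eventually_ge_atTop c] with d hd
    refine (ae_restrict_iff' measurableSet_Ioi).2 (Eventually.of_forall fun s hs => ?_)
    have hs : 0 < s := hs
    rw [Real.norm_of_nonneg (by positivity)]
    gcongr
  · refine (ae_restrict_iff' measurableSet_Ioi).2 (Eventually.of_forall fun s hs => ?_)
    have hs : 0 < s := hs
    have h1 : Tendsto (fun d : ℝ => -(d * s)) atTop atBot :=
      tendsto_neg_atTop_atBot.comp (tendsto_id.atTop_mul_const hs)
    simpa using (Real.tendsto_exp_atBot.comp h1).mul_const ‖f s‖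

/-- Uniqueness for bounded solutions of a homogeneous Volterra equation. -/
theorem LaplaceKernel.volterra_unique (hf : LaplaceKernel a c f) {z : ℂ} {T B : ℝ}
    (hB : ∀ t ∈ Ioc 0 T, ‖V t‖ ≤ B) (hV : ∀ t ∈ Ioc 0 T, V t = z * causalConv f V t) :
    ∀ t ∈ Ioc 0 T, V t = 0 := by
  obtain ⟨d, hd, hd0, hdc⟩ : ∃ d : ℝ,
      ‖z‖ * ∫ s in Ioi (0 : ℝ), Real.exp (-(d * s)) * ‖f s‖ < 1 / 2 ∧ 0 ≤ d ∧ c ≤ d := by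
    have h := hf.tendsto_weighted_norm.const_mul ‖z‖
    rw [mul_zero] at h
    obtain ⟨d, h1, h2, h3⟩ := ((h.eventually (gt_mem_nhds (by norm_num : (0:ℝ) < 1 / 2))).and
      ((eventually_ge_atTop 0).and (eventually_ge_atTop c))).exists
    exact ⟨d, h1, h2, h3⟩
  have hint : IntegrableOn (fun s : ℝ => Real.exp (-(d * s)) * ‖f s‖) (Ioi 0) := by
    refine (hf.mono hdc).integrable.norm.congr (Eventually.of_forall fun s => ?_)
    simp only [norm_mul, Complex.norm_exp]
    simp
  set I := ∫ s in Ioi (0 : ℝ), Real.exp (-(d * s)) * ‖f s‖ with hI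
  -- In the sup norm weighted by e^{-dt} the operator has norm below 1/2, so any bound N improves to
  -- N/2, and iteration drives it to 0.
  have step : ∀ N : ℝ, 0 ≤ N → (∀ t ∈ Ioc 0 T, ‖V t‖ ≤ N * Real.exp (d * t)) →
      ∀ t ∈ Ioc 0 T, ‖V t‖ ≤ N / 2 * Real.exp (d * t) := by
    intro N hN h t ht
    have i1 : IntervalIntegrable (fun s : ℝ => Real.exp (-(d * s)) * ‖f s‖) volume 0 t := by
      rw [intervalIntegrable_iff_integrableOn_Ioc_of_le ht.1.le]
      exact hint.mono_set Ioc_subset_Ioi_self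
    have i2 : IntervalIntegrable (fun τ : ℝ => N * Real.exp (d * t) *
        (Real.exp (-(d * (t - τ))) * ‖f (t - τ)‖)) volume 0 t := by
      have := i1.comp_sub_left t
      rw [sub_zero, sub_self] at this
      exact this.symm.const_mul _
    have h1 : ‖causalConv f V t‖ ≤ ∫ τ in (0 : ℝ)..t, N * Real.exp (d * t) *
        (Real.exp (-(d * (t - τ))) * ‖f (t - τ)‖) := by
      refine intervalIntegral.norm_integral_le_of_norm_le ht.1.le
        (Eventually.of_forall fun τ hτ => ?_) i2
      have h2 := h τ ⟨hτ.1, hτ.2.trans ht.2⟩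
      have h3 : Real.exp (d * τ) = Real.exp (d * t) * Real.exp (-(d * (t - τ))) := by
        rw [← Real.exp_add]; congr 1; ring
      rw [h3] at h2
      rw [norm_mul]
      calc _ ≤ ‖f (t - τ)‖ * (N * (Real.exp (d * t) * Real.exp (-(d * (t - τ))))) := by gcongr
        _ = _ := by ring
    have h4 : ∫ τ in (0 : ℝ)..t, (Real.exp (-(d * (t - τ))) * ‖f (t - τ)‖) ≤ I := by
      have := intervalIntegral.integral_comp_sub_left (a := 0) (b := t)
        (fun s => Real.exp (-(d * s)) * ‖f s‖) t
      rw [sub_self, sub_zero] at this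
      rw [this, intervalIntegral.integral_of_le ht.1.le]
      exact setIntegral_mono_set hint (Eventually.of_forall fun s => by positivity)
        Ioc_subset_Ioi_self.eventuallyLE
    rw [intervalIntegral.integral_const_mul] at h1
    rw [hV t ht, norm_mul]
    calc ‖z‖ * ‖causalConv f V t‖ ≤ ‖z‖ * (N * Real.exp (d * t) * I) := by
          gcongr
          exact h1.trans (by gcongr)
      _ = (‖z‖ * I) * (N * Real.exp (d * t)) := by ring
      _ ≤ 1 / 2 * (N * Real.exp (d * t)) := by gcongr
      _ = _ := by ring
  intro t ht
  have hB0 : 0 ≤ B := (norm_nonneg _).trans (hB t ht)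
  have hn : ∀ n : ℕ, ∀ s ∈ Ioc 0 T, ‖V s‖ ≤ B * (1 / 2) ^ n * Real.exp (d * s) := by
    intro n
    induction n with
    | zero =>
      intro s hs
      have h1 : 1 ≤ Real.exp (d * s) := Real.one_le_exp (mul_nonneg hd0 hs.1.le)
      rw [pow_zero, mul_one]
      exact (hB s hs).trans (le_mul_of_one_le_right hB0 h1)
    | succ n ih =>
      intro s hs
      refine (step _ (by positivity) ih s hs).trans (le_of_eq ?_)
      rw [pow_succ]
      ring
  have hlim : Tendsto (fun n : ℕ => B * (1 / 2 : ℝ) ^ n * Real.exp (d * t)) atTop (𝓝 0) := by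
    simpa using ((tendsto_pow_atTop_nhds_zero_of_lt_one (by norm_num : (0:ℝ) ≤ 1 / 2)
      (by norm_num)).const_mul B).mul_const (Real.exp (d * t))
  exact norm_le_zero_iff.1 (ge_of_tendsto' hlim fun n => hn n t ht)

/-- Lebesgue differentiation: the primitive has derivative u almost everywhere, and it is locally
constant. -/
theorem ae_eq_zero_of_primitive_eq_zero {u : ℝ → ℂ} {T : ℝ}
    (hu : IntervalIntegrable u volume 0 T) (h : ∀ t ∈ Ioc 0 T, ∫ τ in (0 : ℝ)..t, u τ = 0) :
    ∀ᵐ t, t ∈ Ioo 0 T → u t = 0 := by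
  filter_upwards [hu.ae_hasDerivAt_integral] with t ht hmem
  have hT : 0 ≤ T := (hmem.1.trans hmem.2).le
  have h1 := ht (by rw [uIcc_of_le hT]; exact Ioo_subset_Icc_self hmem) 0 left_mem_uIcc
  have h2 : HasDerivAt (fun x => ∫ τ in (0 : ℝ)..x, u τ) 0 t := by
    refine (hasDerivAt_const t (0 : ℂ)).congr_of_eventuallyEq ?_
    filter_upwards [Ioo_mem_nhds hmem.1 hmem.2] with s hs using h s (Ioo_subset_Ioc_self hs)
  exact h1.unique h2

end Volterra

/-! ### Cut-off characters as test functions. -/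

section Cutoff

theorem exists_cutoff : ∃ χ : ℝ → ℂ, ContDiff ℝ 2 χ ∧ HasCompactSupport χ ∧ χ 0 = 1 := by
  set b : ContDiffBump (0 : ℝ) := ⟨1, 2, one_pos, one_lt_two⟩
  refine ⟨fun x => (b x : ℂ), ?_, ?_, ?_⟩
  · exact Complex.ofRealCLM.contDiff.comp (b.contDiff (n := 2))
  · exact b.hasCompactSupport.comp_left (g := fun x : ℝ => (x : ℂ)) Complex.ofReal_zero
  · have : b 0 = 1 := b.one_of_mem_closedBall (by simp [b])
    simp [this]

/-- A dilated cutoff times a character. -/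
def modulatedCutoff (χ : ℝ → ℂ) (k r x : ℝ) : ℂ := χ (r * x) * Complex.exp (Complex.I * k * x)

variable {χ : ℝ → ℂ} {k : ℝ}

theorem modulatedCutoff_contDiff (hχ : ContDiff ℝ 2 χ) (r : ℝ) :
    ContDiff ℝ 2 (modulatedCutoff χ k r) := by
  refine ContDiff.mul (hχ.comp (by fun_prop)) (Complex.contDiff_exp.comp ?_)
  exact ContDiff.mul contDiff_const Complex.ofRealCLM.contDiff

theorem modulatedCutoff_hasCompactSupport (hc : HasCompactSupport χ) {r : ℝ} (hr : r ≠ 0) :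
    HasCompactSupport (modulatedCutoff χ k r) :=
  HasCompactSupport.mul_right (by simpa using hc.comp_smul hr)

theorem modulatedCutoff_iteratedDeriv (hχ : ContDiff ℝ 2 χ) (r x : ℝ) :
    iteratedDeriv 2 (modulatedCutoff χ k r) x = (r ^ 2 * deriv (deriv χ) (r * x) +
      2 * Complex.I * k * r * deriv χ (r * x) - (k : ℂ) ^ 2 * χ (r * x)) *
      Complex.exp (Complex.I * k * x) := by
  have hd : ContDiff ℝ 1 (deriv χ) := by
    have := ContDiff.iterate_deriv' (𝕜 := ℝ) 1 1 (f := χ) (by norm_num; exact hχ)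
    simpa using this
  have d0 : ∀ x : ℝ, HasDerivAt (fun x : ℝ => χ (r * x)) (r * deriv χ (r * x)) x := fun x => by
    have := ((hχ.differentiable (by norm_num)) (r * x)).hasDerivAt.scomp x
      ((hasDerivAt_id x).const_mul r)
    exact this.congr_deriv (by simp)
  have d1 : ∀ x : ℝ, HasDerivAt (fun x : ℝ => deriv χ (r * x)) (r * deriv (deriv χ) (r * x)) x :=
    fun x => by
      have := ((hd.differentiable (by norm_num)) (r * x)).hasDerivAt.scomp x
        ((hasDerivAt_id x).const_mul r)
      exact this.congr_deriv (by simp)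
  have de : ∀ x : ℝ, HasDerivAt (fun x : ℝ => Complex.exp (Complex.I * k * x))
      (Complex.exp (Complex.I * k * x) * (Complex.I * k)) x := fun x => by
    have h := ((hasDerivAt_id (x : ℂ)).const_mul (Complex.I * k)).cexp.comp_ofReal
    simpa using h
  have e1 : deriv (modulatedCutoff χ k r) = fun x : ℝ => (r * deriv χ (r * x) +
      Complex.I * k * χ (r * x)) * Complex.exp (Complex.I * k * x) := by
    ext x
    refine (((d0 x).mul (de x)).congr_deriv ?_).deriv
    ring
  rw [iteratedDeriv_succ, iteratedDeriv_one, e1]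
  refine (((((d1 x).const_mul (r : ℂ)).add ((d0 x).const_mul (Complex.I * k))).mul
    (de x)).congr_deriv ?_).deriv
  simp only [Pi.add_apply]
  linear_combination (k : ℂ) ^ 2 * χ (r * x) * Complex.exp (Complex.I * k * x) * Complex.I_sq

end Cutoff

/-! ### Fourier transform of the integrated equation. -/

section FourierEquation

variable {M c r : ℝ} {q : ℝ → ℂ} {φ : ℝ → ℝ → ℂ}

/-- The weak form is used with test functions χ(x/(n+1)) e^{ikx}. Every derivative falling on the
cutoff produces a factor 1/(n+1), so as n → ∞ only -k² e^{ikx} survives, by dominated convergence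
against φ. -/
theorem IntegratedEquation.fourier_prod (h : IntegratedEquation M q φ)
    (hq : LaplaceKernel (1 + r) c q) (hr : 0 ≤ r) {t : ℝ} (ht : 0 < t) (k : ℝ) :
    ∫ p : ℝ × ℝ, Complex.exp (Complex.I * k * p.1) * φ p.1 p.2
        ∂(volume.prod (volume.restrict (Ioo 0 t))) =
      M * ∫ p : ℝ × ℝ, q (t - p.2) * (-(k : ℂ) ^ 2 * Complex.exp (Complex.I * k * p.1) * φ p.1 p.2)
        ∂(volume.prod (volume.restrict (Ioo 0 t))) := by
  obtain ⟨χ, hχ, hc, hχ0⟩ := exists_cutoff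
  set μ := (volume : Measure ℝ).prod (volume.restrict (Ioo 0 t)) with hμ
  have hφ := h.integrable_prod ht
  obtain ⟨Cq, hCq0, hCq⟩ := hq.reflected_bound hr ht
  have hqm := reflected_aestronglyMeasurable hq.cont t
  have hqb : ∀ᵐ p ∂μ, ‖q (t - p.2)‖ ≤ Cq := (ae_snd_mem t).mono fun p hp => hCq p.2 hp
  have hd : ContDiff ℝ 1 (deriv χ) := by
    have := ContDiff.iterate_deriv' (𝕜 := ℝ) 1 1 (f := χ) (by norm_num; exact hχ)
    simpa using this
  have hc0 : Continuous χ := hχ.continuous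
  have hc1 : Continuous (deriv χ) := hd.continuous
  have hc2 : Continuous (deriv (deriv χ)) := hd.continuous_deriv le_rfl
  obtain ⟨C0, hC0⟩ := hc.exists_bound_of_continuous hc0
  obtain ⟨C1, hC1⟩ := hc.deriv.exists_bound_of_continuous hc1
  obtain ⟨C2, hC2⟩ := hc.deriv.deriv.exists_bound_of_continuous hc2
  set rn : ℕ → ℝ := fun n => 1 / ((n : ℝ) + 1) with hrn
  have hr0 : ∀ n, 0 < rn n := fun n => by positivity
  have hr1 : ∀ n, rn n ≤ 1 := fun n => by
    rw [hrn]; simp only; rw [div_le_one (by positivity)]; linarith [Nat.cast_nonneg (α := ℝ) n]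
  have hrlim : Tendsto rn atTop (𝓝 0) := tendsto_one_div_add_atTop_nhds_zero_nat
  have hweak := fun n => h.weak_form hq hr ht (modulatedCutoff_contDiff (k := k) hχ (rn n))
    (modulatedCutoff_hasCompactSupport hc (hr0 n).ne')
  have lim1 : Tendsto (fun n => ∫ p : ℝ × ℝ, modulatedCutoff χ k (rn n) p.1 * φ p.1 p.2 ∂μ) atTop
      (𝓝 (∫ p : ℝ × ℝ, Complex.exp (Complex.I * k * p.1) * φ p.1 p.2 ∂μ)) := by
    refine tendsto_integral_of_dominated_convergence (fun p => C0 * ‖φ p.1 p.2‖) (fun n => ?_)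
      (hφ.norm.const_mul C0) (fun n => Eventually.of_forall fun p => ?_)
      (Eventually.of_forall fun p => ?_)
    · exact ((modulatedCutoff_contDiff hχ (rn n)).continuous.comp
        continuous_fst).aestronglyMeasurable.mul hφ.aestronglyMeasurable
    · rw [modulatedCutoff, norm_mul, norm_mul, norm_cexp_I_mul, mul_one]
      gcongr
      exact hC0 _
    · refine Tendsto.mul_const _ ?_
      have h1 : Tendsto (fun n => χ (rn n * p.1)) atTop (𝓝 1) := by
        rw [← hχ0]
        refine (hc0.tendsto 0).comp ?_
        simpa using hrlim.mul_const p.1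
      simpa [modulatedCutoff] using h1.mul_const (Complex.exp (Complex.I * k * p.1))
  have lim2 : Tendsto (fun n => ∫ p : ℝ × ℝ, q (t - p.2) *
      (iteratedDeriv 2 (modulatedCutoff χ k (rn n)) p.1 * φ p.1 p.2) ∂μ) atTop
      (𝓝 (∫ p : ℝ × ℝ, q (t - p.2) *
        (-(k : ℂ) ^ 2 * Complex.exp (Complex.I * k * p.1) * φ p.1 p.2) ∂μ)) := by
    refine tendsto_integral_of_dominated_convergence
      (fun p => Cq * ((C2 + 2 * |k| * C1 + |k| ^ 2 * C0) * ‖φ p.1 p.2‖)) (fun n => ?_)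
      ((hφ.norm.const_mul _).const_mul _) (fun n => hqb.mono fun p hp => ?_)
      (Eventually.of_forall fun p => ?_)
    · exact hqm.mul ((((modulatedCutoff_contDiff hχ (rn n)).continuous_iteratedDeriv 2
        le_rfl).comp continuous_fst).aestronglyMeasurable.mul hφ.aestronglyMeasurable)
    · have hb : ‖iteratedDeriv 2 (modulatedCutoff χ k (rn n)) p.1‖ ≤
          C2 + 2 * |k| * C1 + |k| ^ 2 * C0 := by
        rw [modulatedCutoff_iteratedDeriv hχ, norm_mul, norm_cexp_I_mul, mul_one]
        have hrp := (hr0 n).le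
        have hrl := hr1 n
        have n2 : ‖(rn n : ℂ) ^ 2 * deriv (deriv χ) (rn n * p.1)‖ ≤ C2 := by
          rw [norm_mul, norm_pow, Complex.norm_real, Real.norm_of_nonneg hrp]
          exact (mul_le_of_le_one_left (norm_nonneg _) (pow_le_one₀ hrp hrl)).trans (hC2 _)
        have n1 : ‖2 * Complex.I * k * (rn n : ℂ) * deriv χ (rn n * p.1)‖ ≤ 2 * |k| * C1 := by
          simp only [norm_mul, Complex.norm_I, Complex.norm_real, Complex.norm_ofNat, mul_one,
            Real.norm_eq_abs, abs_of_nonneg hrp]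
          have h3 : rn n * ‖deriv χ (rn n * p.1)‖ ≤ C1 :=
            (mul_le_of_le_one_left (norm_nonneg _) hrl).trans (hC1 _)
          rw [mul_assoc (2 * |k|)]
          gcongr
        have n0 : ‖(k : ℂ) ^ 2 * χ (rn n * p.1)‖ ≤ |k| ^ 2 * C0 := by
          rw [norm_mul, norm_pow, Complex.norm_real, Real.norm_eq_abs]
          gcongr
          exact hC0 _
        exact (norm_sub_le _ _).trans (add_le_add ((norm_add_le _ _).trans (add_le_add n2 n1)) n0)
      rw [norm_mul, norm_mul]
      gcongr
    · refine Tendsto.const_mul _ (Tendsto.mul_const _ ?_)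
      simp_rw [modulatedCutoff_iteratedDeriv hχ]
      refine Tendsto.mul_const _ ?_
      have hx : Tendsto (fun n => rn n * p.1) atTop (𝓝 0) := by simpa using hrlim.mul_const p.1
      have hrc : Tendsto (fun n => (rn n : ℂ)) atTop (𝓝 0) := by
        have := (Complex.continuous_ofReal.tendsto 0).comp hrlim
        rwa [Complex.ofReal_zero] at this
      have t0 : Tendsto (fun n => χ (rn n * p.1)) atTop (𝓝 1) := by
        rw [← hχ0]; exact (hc0.tendsto 0).comp hx
      have t1 := (hc1.tendsto 0).comp hx
      have t2 := (hc2.tendsto 0).comp hx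
      have := (((hrc.pow 2).mul t2).add (((hrc.const_mul (2 * Complex.I * k))).mul t1)).sub
        (t0.const_mul ((k : ℂ) ^ 2))
      simpa using this
  exact tendsto_nhds_unique lim1 ((lim2.const_mul (M : ℂ)).congr fun n => (hweak n).symm)

theorem IntegratedEquation.fourier (h : IntegratedEquation M q φ)
    (hq : LaplaceKernel (1 + r) c q) (hr : 0 ≤ r) {t : ℝ} (ht : 0 < t) (k : ℝ) :
    IntervalIntegrable (fun τ => fourierTransform (fun x => φ x τ) k) volume 0 t ∧
    ∫ τ in (0 : ℝ)..t, fourierTransform (fun x => φ x τ) k =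
      -(M * k ^ 2 : ℝ) * causalConv q (fun τ => fourierTransform (fun x => φ x τ) k) t := by
  have hφ := h.integrable_prod ht
  obtain ⟨Cq, hCq0, hCq⟩ := hq.reflected_bound hr ht
  have hqm := reflected_aestronglyMeasurable hq.cont t
  have hqb : ∀ᵐ p ∂((volume : Measure ℝ).prod (volume.restrict (Ioo 0 t))), ‖q (t - p.2)‖ ≤ Cq :=
    (ae_snd_mem t).mono fun p hp => hCq p.2 hp
  have i1 : Integrable (fun p : ℝ × ℝ => Complex.exp (Complex.I * k * p.1) * φ p.1 p.2)
      (volume.prod (volume.restrict (Ioo 0 t))) :=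
    hφ.bdd_mul (by fun_prop : Continuous fun p : ℝ × ℝ =>
      Complex.exp (Complex.I * k * p.1)).aestronglyMeasurable
      (Eventually.of_forall fun p => (norm_cexp_I_mul k p.1).le)
  have i2 : Integrable (fun p : ℝ × ℝ => q (t - p.2) *
      (-(k : ℂ) ^ 2 * Complex.exp (Complex.I * k * p.1) * φ p.1 p.2))
      (volume.prod (volume.restrict (Ioo 0 t))) := by
    refine Integrable.bdd_mul ?_ hqm hqb
    refine (i1.const_mul (-(k : ℂ) ^ 2)).congr (Eventually.of_forall fun p => ?_)
    simp only
    ring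
  have e : ∀ τ, ∫ x : ℝ, Complex.exp (Complex.I * k * x) * φ x τ =
      fourierTransform (fun x => φ x τ) k := fun τ => by
    rw [fourierTransform]
    congr 1 with x
    ring
  have hp := h.fourier_prod hq hr ht k
  rw [integral_prod_symm _ i1, integral_prod_symm _ i2] at hp
  have e' : ∀ τ, ∫ x : ℝ, q (t - τ) *
      (-(k : ℂ) ^ 2 * Complex.exp (Complex.I * k * x) * φ x τ) =
      q (t - τ) * (-(k : ℂ) ^ 2 * fourierTransform (fun x => φ x τ) k) := fun τ => by
    rw [← e, ← integral_const_mul, ← integral_const_mul]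
    congr 1 with x
    ring
  simp only [e, e'] at hp
  constructor
  · rw [intervalIntegrable_iff_integrableOn_Ioo_of_le ht.le]
    refine i1.integral_prod_right.congr (Eventually.of_forall fun τ => ?_)
    exact e τ
  · rw [intervalIntegral.integral_of_le ht.le, integral_Ioc_eq_integral_Ioo, hp, causalConv,
      intervalIntegral.integral_of_le ht.le, integral_Ioc_eq_integral_Ioo, ← integral_const_mul,
      ← integral_const_mul]
    congr 1 with τ
    push_cast
    ring

/-- For each k the time primitive of the mode solves a homogeneous Volterra equation and vanishes;
hence so does the mode for almost every t. Fourier inversion for the continuous integrable function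
φ(·, t) concludes. -/
theorem IntegratedEquation.ae_eq_zero {α ω γ ρ : ℝ} (hα : 0 < α) (hρ : 0 < ρ)
    (h : IntegratedEquation M (fun t => (prabhakarKernel α (1 + ρ) ω γ t : ℂ)) φ) :
    ∀ᵐ t : ℝ, 0 < t → ∀ x, φ x t = 0 := by
  obtain ⟨c, -, hc⟩ := prabhakarKernel_laplaceKernel hα ω
  have hq := hc (1 + ρ) γ (by linarith)
  have he := hc ρ γ hρ
  have h1 := hc 1 0 one_pos
  have hfour : ∀ k T : ℝ, 0 < T →
      ∀ᵐ t : ℝ, t ∈ Ioo 0 T → fourierTransform (fun x => φ x t) k = 0 := by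
    intro k T hT
    set u : ℝ → ℂ := fun τ => fourierTransform (fun x => φ x τ) k with hu
    have hui : ∀ t, 0 < t → IntervalIntegrable u volume 0 t := fun t ht =>
      (h.fourier hq hρ.le ht k).1
    refine ae_eq_zero_of_primitive_eq_zero (hui T hT) ?_
    refine he.volterra_unique (z := -(M * k ^ 2 : ℝ)) (B := ∫ τ in (0 : ℝ)..T, ‖u τ‖)
      (fun t ht => ?_) (fun t ht => ?_)
    · refine (intervalIntegral.norm_integral_le_integral_norm ht.1.le).trans ?_
      exact intervalIntegral.integral_mono_interval le_rfl ht.1.le ht.2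
        (Eventually.of_forall fun _ => norm_nonneg _) (hui T hT).norm
    · rw [(h.fourier hq hρ.le ht.1 k).2]
      congr 1
      -- The kernel of order 1 + ρ is the kernel of order ρ convolved with 1, so q * u becomes the
      -- kernel of order ρ convolved with the primitive of u, and the equation closes on that
      -- primitive.
      have ha := (causalConv_assoc he h1 (by linarith) ht.1 (hui t ht.1)).2
      have e1 : causalConv (fun t => (prabhakarKernel α 1 ω 0 t : ℂ)) u =
          fun t => ∫ τ in (0 : ℝ)..t, u τ := by
        ext t
        simp [causalConv, prabhakarKernel_one]
      rw [e1] at ha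
      rw [ha]
      refine causalConv_congr_left (fun s hs => ?_) ht.1
      rw [prabhakarKernel_conv hα hρ one_pos ω _ _ hs, add_comm 1 ρ, add_zero]
  -- The exceptional null set depends on k and on the time interval, so only rational k and integer
  -- endpoints are collected; continuity of the transform in k covers the rest.
  have hall : ∀ᵐ t : ℝ, ∀ (n : ℕ) (k : ℚ), t ∈ Ioo (0 : ℝ) (n + 1) →
      fourierTransform (fun x => φ x t) k = 0 :=
    ae_all_iff.2 fun n => ae_all_iff.2 fun k => hfour k (n + 1) (by positivity)
  have hint : ∀ᵐ t : ℝ, ∀ n : ℕ, t ∈ Ioo (0 : ℝ) (n + 1) → Integrable fun x => φ x t := by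
    refine ae_all_iff.2 fun n => ?_
    have := (h.integrable_prod (t := (n : ℝ) + 1) (by positivity)).prod_left_ae
    exact (ae_restrict_iff' measurableSet_Ioo).1 this
  filter_upwards [hall, hint] with t h2 h3 ht x
  obtain ⟨n, hn⟩ := exists_nat_gt t
  have hmem : t ∈ Ioo (0 : ℝ) (n + 1) := ⟨ht, by linarith⟩
  have hi := h3 n hmem
  have hz : fourierTransform (fun x => φ x t) = fun _ => 0 := by
    refine Continuous.ext_on Rat.denseRange_cast (fourierTransform_continuous hi)
      continuous_const ?_
    rintro _ ⟨k, rfl⟩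
    exact h2 n k hmem
  have := inverseFourierTransform_fourierTransform (h.contDiff t ht).continuous hi
    (by rw [hz]; exact integrable_zero _ _ _) x
  rw [← this, hz]
  simp [inverseFourierTransform]

end FourierEquation

/-! ### From almost every time to every time. -/

section Uniqueness

variable {α ω γ ρ ν M : ℝ} {g : ℝ → ℂ} {ψ ψ₁ ψ₂ : ℝ → ℝ → ℂ}

/-- Fubini on an exhaustion by rectangles. It yields almost every x only, which is why
`IntegratedEquation` asks for its identity almost everywhere. -/
theorem IsSolution.ae_intervalIntegrable_dxx (h : IsSolution α ω γ ρ ν M g ψ) :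
    ∀ᵐ x : ℝ, ∀ t : ℝ, 0 < t →
      IntervalIntegrable (fun τ => iteratedDeriv 2 (fun y => ψ y τ) x) volume 0 t := by
  have hn : ∀ᵐ x : ℝ, ∀ n : ℕ, x ∈ Icc (-((n : ℝ) + 1)) (n + 1) →
      IntegrableOn (fun τ => iteratedDeriv 2 (fun y => ψ y τ) x) (Ioc 0 ((n : ℝ) + 1)) := by
    refine ae_all_iff.2 fun n => ?_
    have h1 := h.locallyIntegrable_dxx (n + 1) (n + 1) (by positivity) (by positivity)
    rw [IntegrableOn, Measure.volume_eq_prod, ← Measure.prod_restrict] at h1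
    exact (ae_restrict_iff' measurableSet_Icc).1 h1.prod_right_ae
  filter_upwards [hn] with x hx t ht
  obtain ⟨n, hn⟩ := exists_nat_gt (max |x| t)
  have hxn : |x| < n := (le_max_left _ _).trans_lt hn
  have htn : t < n := (le_max_right _ _).trans_lt hn
  rw [abs_lt] at hxn
  rw [intervalIntegrable_iff_integrableOn_Ioc_of_le ht.le]
  exact (hx n ⟨by linarith [hxn.1], by linarith [hxn.2]⟩).mono_set
    (Ioc_subset_Ioc_right (by linarith))

/-- The term carrying g is the same for both solutions and cancels. -/
theorem IsSolution.integratedEquation_sub (h₁ : IsSolution α ω γ ρ ν M g ψ₁)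
    (h₂ : IsSolution α ω γ ρ ν M g ψ₂) (hα : 0 < α) (hρ : ρ ∈ Ioo (0 : ℝ) 1)
    (hν : ν ∈ Icc (0 : ℝ) 1) :
    IntegratedEquation M (fun t => (prabhakarKernel α (1 + ρ) ω γ t : ℂ))
      (fun x t => ψ₁ x t - ψ₂ x t) := by
  have hsub : ∀ t, 0 < t → ∀ x, iteratedDeriv 2 (fun y => ψ₁ y t - ψ₂ y t) x =
      iteratedDeriv 2 (fun y => ψ₁ y t) x - iteratedDeriv 2 (fun y => ψ₂ y t) x := fun t ht x =>
    iteratedDeriv_sub (h₁.contDiff t ht).contDiffAt (h₂.contDiff t ht).contDiffAt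
  obtain ⟨c, -, hc⟩ := prabhakarKernel_laplaceKernel hα ω
  have hq := hc (1 + ρ) γ (by linarith [hρ.1])
  refine ⟨fun T hT => (h₁.integrable T hT).sub (h₂.integrable T hT), fun R T hR hT => ?_,
    fun t ht => (h₁.contDiff t ht).sub (h₂.contDiff t ht), ?_⟩
  · refine ((h₁.locallyIntegrable_dxx R T hR hT).sub
      (h₂.locallyIntegrable_dxx R T hR hT)).congr_fun (fun p hp => ?_)
      (measurableSet_Icc.prod measurableSet_Ioc)
    exact (hsub p.2 hp.2.1 p.1).symm
  · filter_upwards [h₁.ae_intervalIntegrable_dxx, h₂.ae_intervalIntegrable_dxx] with x i₁ i₂ t ht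
    obtain ⟨Cq, hCq0, hCq⟩ := hq.reflected_bound hρ.1.le ht
    have hqi : ∀ {V : ℝ → ℂ}, IntervalIntegrable V volume 0 t → IntervalIntegrable
        (fun τ => (prabhakarKernel α (1 + ρ) ω γ (t - τ) : ℂ) * V τ) volume 0 t := by
      intro V hV
      rw [intervalIntegrable_iff_integrableOn_Ioo_of_le ht.le] at hV ⊢
      refine hV.bdd_mul ?_ ((ae_restrict_iff' measurableSet_Ioo).2 (Eventually.of_forall hCq))
      exact (hq.cont.comp (by fun_prop) fun τ hτ => by simpa using hτ.2).aestronglyMeasurable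
        measurableSet_Ioo
    have e := causalConv_congr_right
      (f := fun t => (prabhakarKernel α (1 + ρ) ω γ t : ℂ)) (fun τ hτ => hsub τ hτ x) ht
    rw [e, intervalIntegral.integral_sub ((h₁.differentiable x).locallyIntegrable t ht)
      ((h₂.differentiable x).locallyIntegrable t ht), h₁.integrated hα hρ hν ht (i₁ t ht),
      h₂.integrated hα hρ hν ht (i₂ t ht)]
    simp only [causalConv, mul_sub]
    rw [intervalIntegral.integral_sub (hqi (i₁ t ht)) (hqi (i₂ t ht))]
    ring

/-- Equality of ψ₁ and ψ₂ at almost every time gives equal integrals. At order 0 the value at t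
itself enters, so this first yields equality for almost every t; continuity of both sides removes
the exception. -/
theorem IsSolution.innerIntegral_eqOn (h₁ : IsSolution α ω γ ρ ν M g ψ₁)
    (h₂ : IsSolution α ω γ ρ ν M g ψ₂) (hae : ∀ᵐ t : ℝ, 0 < t → ∀ x, ψ₁ x t - ψ₂ x t = 0) (x : ℝ) :
    EqOn (innerIntegral α ω γ ρ ν (ψ₁ x)) (innerIntegral α ω γ ρ ν (ψ₂ x)) (Ioi 0) := by
  refine Measure.eqOn_open_of_ae_eq (μ := volume) ?_ isOpen_Ioi
    (fun t ht => ((h₁.differentiable x).inner_differentiable t ht).continuousAt.continuousWithinAt)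
    (fun t ht => ((h₂.differentiable x).inner_differentiable t ht).continuousAt.continuousWithinAt)
  refine (ae_restrict_iff' measurableSet_Ioi).2 ?_
  filter_upwards [hae] with t ht hpos
  have hpos : 0 < t := hpos
  rw [innerIntegral, prabhakarIntegral, innerIntegral, prabhakarIntegral,
    sub_eq_zero.1 (ht hpos x)]
  congr 1
  refine intervalIntegral.integral_congr_ae ?_
  filter_upwards [hae] with τ hτ hmem
  rw [uIoc_of_le hpos.le] at hmem
  rw [sub_eq_zero.1 (hτ hmem.1 x)]

/-- Such a function is affine, and its constant increment d(y+1) - d(y) tends to 0, so its slope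
vanishes and then its constant term does. -/
theorem eq_zero_of_iteratedDeriv_two_eq_zero {d : ℝ → ℂ} (hd : ContDiff ℝ 2 d)
    (h : ∀ x, iteratedDeriv 2 d x = 0) (hlim : Tendsto d atTop (𝓝 0)) (x : ℝ) : d x = 0 := by
  have hd1 : ContDiff ℝ 1 (deriv d) := by
    have := ContDiff.iterate_deriv' (𝕜 := ℝ) 1 1 (f := d) (by norm_num; exact hd)
    simpa using this
  have h1 : ∀ y, deriv d y = deriv d 0 := fun y =>
    is_const_of_deriv_eq_zero (hd1.differentiable (by norm_num)) (fun z => by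
      have := h z
      rwa [iteratedDeriv_succ, iteratedDeriv_one] at this) y 0
  set m := deriv d 0 with hm
  have h2 : ∀ y : ℝ, d y = d 0 + m * y := by
    have hder : ∀ y : ℝ, HasDerivAt (fun y : ℝ => d y - m * y) 0 y := fun y => by
      have e1 := ((hd.differentiable (by norm_num)) y).hasDerivAt
      rw [h1] at e1
      have e2 := ((hasDerivAt_id (y : ℂ)).const_mul m).comp_ofReal
      exact (e1.sub e2).congr_deriv (by simp)
    intro y
    have := is_const_of_deriv_eq_zero (fun y => (hder y).differentiableAt)
      (fun y => (hder y).deriv) y 0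
    simp only [Complex.ofReal_zero, mul_zero, sub_zero] at this
    rw [← this]
    ring
  have hm0 : m = 0 := by
    have h3 : Tendsto (fun y : ℝ => d (y + 1) - d y) atTop (𝓝 (0 - 0)) :=
      (hlim.comp (tendsto_atTop_add_const_right _ 1 tendsto_id)).sub hlim
    have h4 : (fun y : ℝ => d (y + 1) - d y) = fun _ => m := by
      ext y
      rw [h2 (y + 1), h2 y]
      push_cast
      ring
    rw [h4, sub_zero] at h3
    exact tendsto_nhds_unique tendsto_const_nhds h3
  have h5 : d = fun _ => d 0 := by
    ext y
    rw [h2 y, hm0]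
    ring
  have h6 : d 0 = 0 := by
    rw [h5] at hlim
    exact tendsto_nhds_unique tendsto_const_nhds hlim
  rw [h2 x, hm0, h6]
  ring

/-- The equation expresses ∂ₓ²ψ at every single t through the derivative of the inner integral, on
which the two solutions agree for all t > 0. Hence ψ₁ - ψ₂ is affine in x at each t, and decay at +∞
alone forces it to vanish. -/
theorem IsSolution.unique (h₁ : IsSolution α ω γ ρ ν M g ψ₁) (h₂ : IsSolution α ω γ ρ ν M g ψ₂)
    (hα : 0 < α) (hρ : ρ ∈ Ioo (0 : ℝ) 1) (hν : ν ∈ Icc (0 : ℝ) 1) (hM : 0 < M) (x : ℝ) {t : ℝ}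
    (ht : 0 < t) : ψ₁ x t = ψ₂ x t := by
  have hae := (h₁.integratedEquation_sub h₂ hα hρ hν).ae_eq_zero hα hρ.1
  have hF := fun x => h₁.innerIntegral_eqOn h₂ hae x
  have hMc : (M : ℂ) ≠ 0 := by exact_mod_cast hM.ne'
  have hder : ∀ x, EqOn (deriv (innerIntegral α ω γ ρ ν (ψ₁ x)))
      (deriv (innerIntegral α ω γ ρ ν (ψ₂ x))) (Ioi 0) := fun x s hs =>
    ((hF x).eventuallyEq_of_mem (Ioi_mem_nhds hs)).deriv_eq
  have hxx : ∀ y, iteratedDeriv 2 (fun y => ψ₁ y t) y = iteratedDeriv 2 (fun y => ψ₂ y t) y := by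
    intro y
    refine mul_left_cancel₀ hMc ?_
    rw [← h₁.equation y t ht, ← h₂.equation y t ht, hilferPrabhakarDeriv, hilferPrabhakarDeriv,
      prabhakarIntegral, prabhakarIntegral, hder y ht]
    congr 1
    exact causalConv_congr_right
      (f := fun s => (prabhakarKernel α (ν * (1 - ρ)) ω (-γ * ν) s : ℂ)) (hder y) ht
  have hc₁ := h₁.contDiff t ht
  have hc₂ := h₂.contDiff t ht
  have hlim := (h₁.decay t ht).sub (h₂.decay t ht)
  rw [sub_zero] at hlim
  refine sub_eq_zero.1 (eq_zero_of_iteratedDeriv_two_eq_zero (d := fun y => ψ₁ y t - ψ₂ y t)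
    (hc₁.sub hc₂) (fun y => ?_) hlim x)
  have := iteratedDeriv_sub (x := y) hc₁.contDiffAt hc₂.contDiffAt
  refine this.trans ?_
  rw [hxx y, sub_self]

end Uniqueness

end HilferPrabhakar

end

theorem mainTheorem10 (α ω γ ρ ν M : ℝ) (hα : 0 < α) (hγ : 0 ≤ γ) (hρ : ρ ∈ Set.Ioo (0 : ℝ) 1)
    (hν : ν ∈ Set.Icc (0 : ℝ) 1) (hM : 0 < M) (g : ℝ → ℂ) (hg_cont : Continuous g)
    (hg_int : MeasureTheory.Integrable g)
    (hg_fourier : MeasureTheory.Integrable (HilferPrabhakar.fourierTransform g)) :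
    (∀ t k : ℝ, 0 < t → Summable (HilferPrabhakar.seriesTerm α ω γ ρ ν M g t k)) ∧
    (∀ t : ℝ, 0 < t → MeasureTheory.Integrable
      (fun k : ℝ => ∑' n : ℕ, HilferPrabhakar.seriesTerm α ω γ ρ ν M g t k n)) ∧
    HilferPrabhakar.IsSolution α ω γ ρ ν M g (HilferPrabhakar.solution α ω γ ρ ν M g) ∧
    (∀ ψ : ℝ → ℝ → ℂ, HilferPrabhakar.IsSolution α ω γ ρ ν M g ψ →
      ∀ x t : ℝ, 0 < t → ψ x t = HilferPrabhakar.solution α ω γ ρ ν M g x t) := by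
  have hg : HilferPrabhakar.FourierPair g := ⟨hg_cont, hg_int, hg_fourier⟩
  have hsol := HilferPrabhakar.solution_isSolution hα hγ hρ hν hM hg ω
  refine ⟨fun t k ht => HilferPrabhakar.summable_seriesTerm hα hγ hρ hν hM ht k, fun t ht => ?_,
    hsol, fun ψ hψ x t ht => hψ.unique hsol hα hρ hν hM x ht⟩
  simp_rw [HilferPrabhakar.tsum_seriesTerm]
  exact (HilferPrabhakar.modeMultiplier_timeMultiplier hα hγ hρ hν hM ω).integrable hg ht
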